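/- For $j\in\{0,\tfrac12,1,\dots\}$ let $[2j]$ be the irreducible complex representation of $\mathfrak{su}(2)$ of dimension $2j+1$, with generators $\mathfrak s^\alpha$, $[\mathfrak s^\alpha,\mathfrak s^\beta]=i\epsilon_{\alpha\beta\gamma}\mathfrak s^\gamma$. Given positive integers or half-integers $j_1,j_2,j_3$, let $s_a^\alpha$ be the action of $\mathfrak s^\alpha$ on the $a$-th factor of $[2j_1]\otimes[2j_2]\otimes[2j_3]$, and put $K_{ab}=\sum_\alpha (s_a^\alpha+s_b^\alpha)^2$, $K_{123}=\sum_\alpha (s_1^\alpha+s_2^\alpha+s_3^\alpha)^2$. Let $$\mathcal C_{j_1,j_2,j_3}=\{M\in\mathrm{End}([2j_1]\otimes[2j_2]\otimes[2j_3]) : [M,s_1^\alpha+s_2^\alpha+s_3^\alpha]=0,\ \alpha=1,2,3\}.$$ Let $\mathcal J_{ab}=\{|j_a-j_b|,|j_a-j_b|+1,\dots,j_a+j_b\}$. For $\{a,b,c\}=\{1,2,3\}$ let $\mathcal M_{abc}$ be the set of the numbers $\ell(\ell+1)-p(p+1)$ with $p\in\mathcal J_{ab}$ and $[2\ell]$ occurring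 in $[2p]\otimes[2j_c]$. Let $\mathcal J_{123}$ be the set of all $\ell$ such that $[2\ell]$ occurs in $[2j_1]\otimes[2j_2]\otimes[2j_3]$. The universal Racah algebra $\mathcal R$ is the unital associative $\mathbb C$-algebra generated by $A,B$ and central elements $C,\alpha_1,\alpha_2,\alpha_3$, with relations $$[B,[A,B]]=-2B^2-2\{A,B\}+2(C+\alpha_1+\alpha_2+\alpha_3)B+2(\alpha_1-C)(\alpha_3-\alpha_2),$$ $$[A,[B,A]]=-2A^2-2\{A,B\}+2(C+\alpha_1+\alpha_2+\alpha_3)A+2(\alpha_1-\alpha_2)(\alpha_3-C),$$ where $\{X,Y\}=XY+YX$. Its quotient by the relations $\alpha_i=j_i(j_i+1)$ ($i=1,2,3$) and $$\prod_{p\in\mathcal J_{12}}(A-p(p+1))=0,\quad \prod_{p\in\mathcal J_{23}}(B-p(p+1))=0,\quad \prod_{p\in\mathcal J_{123}}(C-p(p+1))=0,$$ $$\prod_{p\in\mathcal J_{13}}(C-A-B+\alpha_1+\alpha_2+\alpha_3-p(p+1))=0,\quad \prod_{m\in\mathcal M_{132}}(A+B-\alpha_1-\alpha_2-\alpha_3-m)=0,$$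 $$\prod_{m\in\mathcal M_{123}}(C-A-m)=0,\quad \prod_{m\in\mathcal M_{231}}(C-B-m)=0$$ is denoted by $\overline{\mathcal R}=\overline{\mathcal R}(j_1(j_1+1),j_2(j_2+1),j_3(j_3+1))$. **Theorem.** Let $j$ and $k$ be positive integers or half-integers and let $(j_1,j_2,j_3)$ be any ordering of $\tfrac12,j,k$ (for example $(j,\tfrac12,k)$). 1. There is an isomorphism of algebras $\overline\phi:\overline{\mathcal R}\to\mathcal C_{j_1,j_2,j_3}$ with $\overline\phi(A)=K_{12}$, $\overline\phi(B)=K_{23}$, $\overline\phi(C)=K_{123}$. 2. There is a surjective homomorphism of algebras $\phi:\mathcal R\to\mathcal C_{j_1,j_2,j_3}$ with $\phi(\alpha_i)=j_i(j_i+1)$, $\phi(A)=K_{12}$, $\phi(B)=K_{23}$, $\phi(C)=K_{123}$. 3. For every $x\in\mathcal J_{123}$, the quotient $\overline{\mathcal R}_x$ of $\overline{\mathcal R}$ by the relation $C=x(x+1)$ has dimension at most $4$, and at most $1$ if $x=j+k+\tfrac12$ or $x=|j-k|-\tfrac12$. -/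

import Mathlib

open scoped TensorProduct

noncomputable section

namespace RacahSU2

/-! ### Spins

A spin `j ∈ {0, 1/2, 1, 3/2, …}` is encoded by the natural number `n = 2j`, so that `[n]` is the
irreducible representation of dimension `n + 1`. -/

/-- The value `j(j+1)` of the Casimir on the spin-`j` representation, where `j = n/2`. -/
def cas (n : ℕ) : ℚ := ((n : ℚ) / 2) * ((n : ℚ) / 2 + 1)

/-- The doubled set `{|j_a - j_b|, |j_a - j_b| + 1, …, j_a + j_b}`, for `a = 2 j_a`, `b = 2 j_b`:
the `c` that satisfy the triangle inequalities with `a` and `b` and have the parity of `a + b`. -/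
def J₂ (a b : ℕ) : Finset ℕ :=
  (Finset.range (a + b + 1)).filter fun c => a ≤ b + c ∧ b ≤ a + c ∧ Even (a + b + c)

/-- The edges `([k], [l])` from the second to the third row of the Bratteli diagram of
`[a] ⊗ [b] ⊗ [c]`: `[k]` occurs in `[a] ⊗ [b]` and `[l]` occurs in `[k] ⊗ [c]`. -/
def edges (a b c : ℕ) : Finset (ℕ × ℕ) :=
  (J₂ a b).biUnion fun k => (J₂ k c).image fun l => (k, l)

/-- The (doubled) spins in the third row of the Bratteli diagram of `[a] ⊗ [b] ⊗ [c]`. -/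
def J₃ (a b c : ℕ) : Finset ℕ := (edges a b c).image Prod.snd

/-- The set of the numbers `ℓ(ℓ+1) - k(k+1)`, over the edges from the second to the third row of
the Bratteli diagram; a number that comes from several edges occurs once. -/
def M₃ (a b c : ℕ) : Finset ℚ := (edges a b c).image fun e => cas e.2 - cas e.1

/-! ### The spin representations of `su(2)` -/

/-- The space of the representation `[n]`, of dimension `n + 1`. -/
abbrev Spin (n : ℕ) : Type := Fin (n + 1) → ℂ

/-- The raising operator `s¹ + i s²`, sending `e_i` to `(n - i + 1) e_{i-1}`. -/
def sPlus (n : ℕ) : Matrix (Fin (n + 1)) (Fin (n + 1)) ℂ :=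
  Matrix.of fun r c => if (r : ℕ) + 1 = (c : ℕ) then (n : ℂ) - ((r : ℕ) : ℂ) else 0

/-- The lowering operator `s¹ - i s²`, sending `e_i` to `(i + 1) e_{i+1}`. -/
def sMinus (n : ℕ) : Matrix (Fin (n + 1)) (Fin (n + 1)) ℂ :=
  Matrix.of fun r c => if (c : ℕ) + 1 = (r : ℕ) then ((r : ℕ) : ℂ) else 0

/-- The matrices of `s¹, s², s³` in `[n]`; for `n = 1` they are half the Pauli matrices. -/
def sMat (n : ℕ) : Fin 3 → Matrix (Fin (n + 1)) (Fin (n + 1)) ℂ :=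
  ![(1 / 2 : ℂ) • (sPlus n + sMinus n),
    (-Complex.I / 2) • (sPlus n - sMinus n),
    Matrix.diagonal fun i => (n : ℂ) / 2 - ((i : ℕ) : ℂ)]

/-- The image of the generator `s^α` in `End [n]`. -/
def s (n : ℕ) (α : Fin 3) : Module.End ℂ (Spin n) := Matrix.toLin' (sMat n α)

/-- The space `[n₁] ⊗ [n₂] ⊗ [n₃]`. -/
abbrev Triple (n₁ n₂ n₃ : ℕ) : Type := (Spin n₁ ⊗[ℂ] Spin n₂) ⊗[ℂ] Spin n₃

section Casimirs

variable (n₁ n₂ n₃ : ℕ)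

/-- `s^α` acting on the first factor of the threefold tensor product. -/
def s₁ (α : Fin 3) : Module.End ℂ (Triple n₁ n₂ n₃) :=
  TensorProduct.map (TensorProduct.map (s n₁ α) LinearMap.id) LinearMap.id

/-- `s^α` acting on the second factor. -/
def s₂ (α : Fin 3) : Module.End ℂ (Triple n₁ n₂ n₃) :=
  TensorProduct.map (TensorProduct.map LinearMap.id (s n₂ α)) LinearMap.id

/-- `s^α` acting on the third factor. -/
def s₃ (α : Fin 3) : Module.End ℂ (Triple n₁ n₂ n₃) :=
  TensorProduct.map (TensorProduct.map LinearMap.id LinearMap.id) (s n₃ α)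

/-- The intermediate Casimir `K₁₂`. -/
def K₁₂ : Module.End ℂ (Triple n₁ n₂ n₃) :=
  ∑ α : Fin 3, (s₁ n₁ n₂ n₃ α + s₂ n₁ n₂ n₃ α) ^ 2

/-- The intermediate Casimir `K₂₃`. -/
def K₂₃ : Module.End ℂ (Triple n₁ n₂ n₃) :=
  ∑ α : Fin 3, (s₂ n₁ n₂ n₃ α + s₃ n₁ n₂ n₃ α) ^ 2

/-- The total Casimir `K₁₂₃`. -/
def K₁₂₃ : Module.End ℂ (Triple n₁ n₂ n₃) :=
  ∑ α : Fin 3, (s₁ n₁ n₂ n₃ α + s₂ n₁ n₂ n₃ α + s₃ n₁ n₂ n₃ α) ^ 2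

/-- The centralizer of the diagonal action of `su(2)` in `End ([n₁] ⊗ [n₂] ⊗ [n₃])`. -/
def Cent : Subalgebra ℂ (Module.End ℂ (Triple n₁ n₂ n₃)) :=
  Subalgebra.centralizer ℂ
    (Set.range fun α : Fin 3 => s₁ n₁ n₂ n₃ α + s₂ n₁ n₂ n₃ α + s₃ n₁ n₂ n₃ α)

end Casimirs

/-! ### The universal Racah algebra -/

/-- The generators of the universal Racah algebra. -/
inductive Gen : Type
  | A | B | C | α₁ | α₂ | α₃

/-- A generator, as an element of the free algebra. -/
abbrev fgen (g : Gen) : FreeAlgebra ℂ Gen := FreeAlgebra.ι ℂ g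

/-- The defining relations of the universal Racah algebra: `C, α₁, α₂, α₃` are central, and the
two relations for the double commutators of `A` and `B`. -/
inductive RacahRel : FreeAlgebra ℂ Gen → FreeAlgebra ℂ Gen → Prop
  | central_C (g : Gen) : RacahRel (fgen .C * fgen g) (fgen g * fgen .C)
  | central_α₁ (g : Gen) : RacahRel (fgen .α₁ * fgen g) (fgen g * fgen .α₁)
  | central_α₂ (g : Gen) : RacahRel (fgen .α₂ * fgen g) (fgen g * fgen .α₂)
  | central_α₃ (g : Gen) : RacahRel (fgen .α₃ * fgen g) (fgen g * fgen .α₃)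
  | bracket_B :
      RacahRel ⁅fgen .B, ⁅fgen .A, fgen .B⁆⁆
        (-2 * fgen .B ^ 2 - 2 * (fgen .A * fgen .B + fgen .B * fgen .A)
          + 2 * (fgen .C + fgen .α₁ + fgen .α₂ + fgen .α₃) * fgen .B
          + 2 * (fgen .α₁ - fgen .C) * (fgen .α₃ - fgen .α₂))
  | bracket_A :
      RacahRel ⁅fgen .A, ⁅fgen .B, fgen .A⁆⁆
        (-2 * fgen .A ^ 2 - 2 * (fgen .A * fgen .B + fgen .B * fgen .A)
          + 2 * (fgen .C + fgen .α₁ + fgen .α₂ + fgen .α₃) * fgen .A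
          + 2 * (fgen .α₁ - fgen .α₂) * (fgen .α₃ - fgen .C))

/-- The universal Racah algebra, over `ℂ`. -/
abbrev Racah : Type := RingQuot RacahRel

/-- A generator, as an element of the universal Racah algebra. -/
def gen (g : Gen) : Racah := RingQuot.mkAlgHom ℂ RacahRel (fgen g)

/-! ### The quotiented Racah algebra -/

/-- The polynomial `∏_{j ∈ J} (X - j(j+1))`, for a set `J` of doubled spins. -/
def polyJ (J : Finset ℕ) : Polynomial ℂ :=
  ∏ n ∈ J, (Polynomial.X - Polynomial.C ((cas n : ℚ) : ℂ))

/-- The polynomial `∏_{m ∈ M} (X - m)`. -/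
def polyM (M : Finset ℚ) : Polynomial ℂ :=
  ∏ m ∈ M, (Polynomial.X - Polynomial.C ((m : ℚ) : ℂ))

/-- The relations imposed on the universal Racah algebra, for the spins `n₁/2, n₂/2, n₃/2`. -/
inductive QuotRel (n₁ n₂ n₃ : ℕ) : Racah → Racah → Prop
  | α₁ : QuotRel n₁ n₂ n₃ (gen .α₁) (algebraMap ℂ Racah ((cas n₁ : ℚ) : ℂ))
  | α₂ : QuotRel n₁ n₂ n₃ (gen .α₂) (algebraMap ℂ Racah ((cas n₂ : ℚ) : ℂ))
  | α₃ : QuotRel n₁ n₂ n₃ (gen .α₃) (algebraMap ℂ Racah ((cas n₃ : ℚ) : ℂ))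
  | A : QuotRel n₁ n₂ n₃ (Polynomial.aeval (gen .A) (polyJ (J₂ n₁ n₂))) 0
  | B : QuotRel n₁ n₂ n₃ (Polynomial.aeval (gen .B) (polyJ (J₂ n₂ n₃))) 0
  | C : QuotRel n₁ n₂ n₃ (Polynomial.aeval (gen .C) (polyJ (J₃ n₁ n₂ n₃))) 0
  | CAB : QuotRel n₁ n₂ n₃
      (Polynomial.aeval (gen .C - gen .A - gen .B + gen .α₁ + gen .α₂ + gen .α₃)
        (polyJ (J₂ n₁ n₃))) 0
  | AB : QuotRel n₁ n₂ n₃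
      (Polynomial.aeval (gen .A + gen .B - gen .α₁ - gen .α₂ - gen .α₃)
        (polyM (M₃ n₁ n₃ n₂))) 0
  | CA : QuotRel n₁ n₂ n₃ (Polynomial.aeval (gen .C - gen .A) (polyM (M₃ n₁ n₂ n₃))) 0
  | CB : QuotRel n₁ n₂ n₃ (Polynomial.aeval (gen .C - gen .B) (polyM (M₃ n₂ n₃ n₁))) 0

/-- The quotiented Racah algebra for the spins `n₁/2, n₂/2, n₃/2`. -/
abbrev QRacah (n₁ n₂ n₃ : ℕ) : Type := RingQuot (QuotRel n₁ n₂ n₃)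

/-- A generator, as an element of the quotiented Racah algebra. -/
def qgen (n₁ n₂ n₃ : ℕ) (g : Gen) : QRacah n₁ n₂ n₃ :=
  RingQuot.mkAlgHom ℂ (QuotRel n₁ n₂ n₃) (gen g)

/-- The relation `C = x(x+1)`, where `x = n/2`. -/
inductive BlockRel (n₁ n₂ n₃ n : ℕ) : QRacah n₁ n₂ n₃ → QRacah n₁ n₂ n₃ → Prop
  | C : BlockRel n₁ n₂ n₃ n (qgen n₁ n₂ n₃ .C)
      (algebraMap ℂ (QRacah n₁ n₂ n₃) ((cas n : ℚ) : ℂ))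

/-- The block of the quotiented Racah algebra at the eigenvalue `x(x+1)` of `C`, where `x = n/2`:
its quotient by `C = x(x+1)`. -/
abbrev Block (n₁ n₂ n₃ n : ℕ) : Type := RingQuot (BlockRel n₁ n₂ n₃ n)

end RacahSU2

end

open scoped TensorProduct

noncomputable section

namespace RacahSU2

/-! Let `X` and `Y` be the Casimirs that couple the spin-1/2 factor to its partners, of doubled
spins `a` and `b`, and let `C` be the total Casimir. Coupling to spin 1/2 leaves `X` only two
eigenvalues, symmetric about `dimSq a`, so `x = X - dimSq a` satisfies `x² = dimSq a`; likewise `y²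
= dimSq b` for `y = Y - dimSq b`. The Pauli relations give `xy + yx = C - (cc a + cc b + 1/4)`
(`clifford_anticomm`). Hence at each value of `C` the algebra is a quotient of a Clifford algebra on
two generators, spanned by `1, x, y, xy`.

When `x²` is scalar, the Racah relation is equivalent to `(x + 1)(xy + yx - C + const) = 0`
(`bracket_iff`). So it holds in the representation. Conversely, in the abstract quotient `x + 1` is
invertible unless `a = 1`, and the Clifford relation follows. If `a = 1` the relation for `b` serves
instead; if all three spins are 1/2, the third quadratic relation and the relations for `C - X`, `C
- Y` fill the gap (`HalfAlg.anticomm`).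

The part of the quotient over an eigenvalue of `C` therefore has dimension at most 4
(`exists_four`). The discriminant of the Clifford form is a product of linear factors that vanishes
only at the extremal spins (`nondegenerate`). There the relations for `C - X` or `C - Y` exclude one
of the two eigenvalues, `x` and `y` become scalars, and one dimension is left (`exists_one`). At the
other spins the nondegenerate Clifford algebra acts faithfully (`clifford_independent`) on a nonzero
multiplicity space of dimension at most 2, whose endomorphism algebra has dimension at most 4, so
the action is bijective. At an extremal spin the multiplicity space is a line. An operator commuting
with the total spin is determined by its action on highest weight vectors (`eq_zero_of_central`), so
the spectral idempotents of `C` assemble these local statements into the isomorphism.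

That the polynomial relations hold in the representation is the Clebsch–Gordan rule
(`clebsch_gordan`), valid for all spins. It is proved for abstract operators `E, F, H`, with
nilpotency of `E` and `F` in place of finite dimension. In `IsTriple` the Casimirs fix the three
spins, and `top` makes the triple product occur only once. -/

/-! ### Casimir eigenvalues -/

/-- The Casimir eigenvalue as a function of a complex doubled weight. -/
def cc (z : ℂ) : ℂ := z / 2 * (z / 2 + 1)

lemma cas_cast (n : ℕ) : ((cas n : ℚ) : ℂ) = cc n := by
  simp [cas, cc]

/-- `cc` is symmetric about the weight `-1`; the second root is the reflected weight, which the
arguments below exclude by positivity. -/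
lemma cc_eq_iff (z w : ℂ) : cc z = cc w ↔ z = w ∨ z = -w - 2 := by
  constructor
  · intro h
    have : (z - w) * (z + w + 2) = 0 := by
      unfold cc at h; linear_combination 4 * h
    rcases mul_eq_zero.1 this with h | h
    · left; linear_combination h
    · right; linear_combination h
  · rintro (rfl | rfl)
    · rfl
    · unfold cc; ring

lemma cas_injective : Function.Injective fun n : ℕ => ((cas n : ℚ) : ℂ) := by
  intro m n h
  simp only [cas_cast] at h
  rcases (cc_eq_iff _ _).1 h with h | h
  · exact_mod_cast h
  · exfalso
    have h1 : (m : ℂ) + n + 2 = 0 := by linear_combination h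
    have h2 : ((m + n + 2 : ℕ) : ℂ) = 0 := by push_cast; exact h1
    have := Nat.cast_eq_zero.1 h2
    omega

/-! ### Raising, lowering and weight operators; highest weights -/

section

variable {V : Type*} [AddCommGroup V] [Module ℂ V]

/-- A nilpotent operator has a last nonzero iterate on a nonzero vector. -/
lemma exists_last_iterate {A : Module.End ℂ V} (hA : IsNilpotent A) {v : V} (hv : v ≠ 0) :
    ∃ k : ℕ, (A ^ k) v ≠ 0 ∧ (A ^ (k + 1)) v = 0 := by
  classical
  obtain ⟨N, hN⟩ := hA
  have hex : ∃ k, (A ^ k) v = 0 := ⟨N, by simp [hN]⟩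
  have h0 : Nat.find hex ≠ 0 := by
    intro h
    have := Nat.find_spec hex
    rw [h] at this
    exact hv (by simpa using this)
  obtain ⟨k, hk⟩ := Nat.exists_eq_succ_of_ne_zero h0
  refine ⟨k, Nat.find_min hex (by omega), ?_⟩
  have := Nat.find_spec hex
  rwa [hk] at this

variable (V) in
/-- A raising, a lowering and a weight operator. -/
structure Ops where
  /-- raising operator -/
  E : Module.End ℂ V
  /-- lowering operator -/
  F : Module.End ℂ V
  /-- doubled weight operator -/
  H : Module.End ℂ V

namespace Ops

instance : Add (Ops V) := ⟨fun T U => ⟨T.E + U.E, T.F + U.F, T.H + U.H⟩⟩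

@[simp] lemma add_E (T U : Ops V) : (T + U).E = T.E + U.E := rfl
@[simp] lemma add_F (T U : Ops V) : (T + U).F = T.F + U.F := rfl
@[simp] lemma add_H (T U : Ops V) : (T + U).H = T.H + U.H := rfl

lemma add_assoc' (T U W : Ops V) : T + U + W = T + (U + W) := by
  show Ops.mk _ _ _ = Ops.mk _ _ _
  simp [add_assoc]

lemma add_comm' (T U : Ops V) : T + U = U + T := by
  show Ops.mk _ _ _ = Ops.mk _ _ _
  simp [add_comm]

/-- The Casimir operator. -/
def K (T : Ops V) : Module.End ℂ V := T.F * T.E + (1 / 4 : ℂ) • T.H ^ 2 + (1 / 2 : ℂ) • T.H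

/-- The `sl₂` relations, with nilpotent raising and lowering operators. -/
structure IsRep (T : Ops V) : Prop where
  HE : T.H * T.E = T.E * T.H + (2 : ℂ) • T.E
  HF : T.H * T.F = T.F * T.H - (2 : ℂ) • T.F
  EF : T.E * T.F = T.F * T.E + T.H
  nilE : IsNilpotent T.E
  nilF : IsNilpotent T.F

/-- All operators of `T` commute with all operators of `U`. -/
structure Comm (T U : Ops V) : Prop where
  EE : Commute T.E U.E
  EF : Commute T.E U.F
  EH : Commute T.E U.H
  FE : Commute T.F U.E
  FF : Commute T.F U.F
  FH : Commute T.F U.H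
  HE : Commute T.H U.E
  HF : Commute T.H U.F
  HH : Commute T.H U.H

lemma Comm.symm {T U : Ops V} (h : T.Comm U) : U.Comm T :=
  ⟨h.EE.symm, h.FE.symm, h.HE.symm, h.EF.symm, h.FF.symm, h.HF.symm, h.EH.symm, h.FH.symm,
    h.HH.symm⟩

lemma Comm.add_left {T U W : Ops V} (h : T.Comm W) (h' : U.Comm W) : (T + U).Comm W :=
  ⟨h.EE.add_left h'.EE, h.EF.add_left h'.EF, h.EH.add_left h'.EH, h.FE.add_left h'.FE,
    h.FF.add_left h'.FF, h.FH.add_left h'.FH, h.HE.add_left h'.HE, h.HF.add_left h'.HF,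
    h.HH.add_left h'.HH⟩

/-- An operator commuting with `E`, `F`, `H`. -/
structure Central (T : Ops V) (M : Module.End ℂ V) : Prop where
  E : Commute M T.E
  F : Commute M T.F
  H : Commute M T.H

lemma Central.K {T : Ops V} {M : Module.End ℂ V} (h : T.Central M) : Commute M T.K :=
  ((h.F.mul_right h.E).add_right ((h.H.pow_right 2).smul_right _)).add_right (h.H.smul_right _)

lemma Central.add {T U : Ops V} {M : Module.End ℂ V} (h : T.Central M) (h' : U.Central M) :
    (T + U).Central M :=
  ⟨h.E.add_right h'.E, h.F.add_right h'.F, h.H.add_right h'.H⟩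

lemma Comm.central_K {T U : Ops V} (h : T.Comm U) : T.Central U.K :=
  ⟨(Central.K (T := U) ⟨h.EE, h.EF, h.EH⟩).symm, (Central.K (T := U) ⟨h.FE, h.FF, h.FH⟩).symm,
    (Central.K (T := U) ⟨h.HE, h.HF, h.HH⟩).symm⟩

lemma IsRep.add {T U : Ops V} (hT : T.IsRep) (hU : U.IsRep) (h : T.Comm U) : (T + U).IsRep where
  HE := by
    have h1 := h.HE.eq
    have h2 := h.EH.eq
    simp only [add_E, add_H, mul_add, add_mul, hT.HE, hU.HE, h1, h2]
    module
  HF := by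
    have h1 := h.HF.eq
    have h2 := h.FH.eq
    simp only [add_F, add_H, mul_add, add_mul, hT.HF, hU.HF, h1, h2]
    module
  EF := by
    have h1 := h.EF.eq
    have h2 := h.FE.eq
    simp only [add_F, add_H, add_E, mul_add, add_mul, hT.EF, hU.EF, h1, h2]
    module
  nilE := h.EE.isNilpotent_add hT.nilE hU.nilE
  nilF := h.FF.isNilpotent_add hT.nilF hU.nilF

lemma IsRep.central_K {T : Ops V} (h : T.IsRep) : T.Central T.K where
  E := by
    have h1 : T.E * T.F * T.E = T.F * T.E * T.E + T.H * T.E := by rw [h.EF, add_mul]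
    have h2 : T.H * T.H * T.E = T.E * T.H * T.H + (4 : ℂ) • (T.E * T.H) + (4 : ℂ) • T.E := by
      rw [mul_assoc, h.HE, mul_add, ← mul_assoc, h.HE, mul_smul_comm, h.HE, add_mul,
        smul_mul_assoc]
      module
    show T.K * T.E = T.E * T.K
    simp only [K, add_mul, mul_add, smul_mul_assoc, mul_smul_comm, pow_two, h2, ← mul_assoc, h1,
      h.HE]
    module
  F := by
    have h1 : T.F * T.E * T.F = T.F * T.F * T.E + T.F * T.H := by
      rw [mul_assoc, h.EF, mul_add, mul_assoc]
    have h2 : T.H * T.H * T.F = T.F * T.H * T.H - (4 : ℂ) • (T.F * T.H) + (4 : ℂ) • T.F := by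
      rw [mul_assoc, h.HF, mul_sub, ← mul_assoc, h.HF, mul_smul_comm, h.HF, sub_mul,
        smul_mul_assoc]
      module
    show T.K * T.F = T.F * T.K
    simp only [K, add_mul, mul_add, smul_mul_assoc, mul_smul_comm, pow_two, h2, ← mul_assoc, h1,
      h.HF]
    module
  H := by
    have h1 : T.H * T.F * T.E = T.F * T.E * T.H := by
      rw [h.HF, sub_mul, mul_assoc, h.HE, mul_add, smul_mul_assoc, mul_smul_comm, mul_assoc]
      module
    show T.K * T.H = T.H * T.K
    simp only [K, add_mul, mul_add, smul_mul_assoc, mul_smul_comm, pow_two, ← mul_assoc, h1]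

section Vectors

variable {T : Ops V}

lemma IsRep.H_E (h : T.IsRep) {v : V} {z : ℂ} (hv : T.H v = z • v) :
    T.H (T.E v) = (z + 2) • T.E v := by
  have := congr($(h.HE) v)
  simp only [Module.End.mul_apply, LinearMap.add_apply, LinearMap.smul_apply, hv, map_smul] at this
  rw [this]; module

lemma IsRep.H_F (h : T.IsRep) {v : V} {z : ℂ} (hv : T.H v = z • v) :
    T.H (T.F v) = (z - 2) • T.F v := by
  have := congr($(h.HF) v)
  simp only [Module.End.mul_apply, LinearMap.sub_apply, LinearMap.smul_apply, hv, map_smul] at this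
  rw [this]; module

lemma IsRep.H_E_pow (h : T.IsRep) {v : V} {z : ℂ} (hv : T.H v = z • v) (k : ℕ) :
    T.H ((T.E ^ k) v) = (z + 2 * k) • (T.E ^ k) v := by
  induction k with
  | zero => simpa using hv
  | succ k ih =>
    rw [pow_succ', Module.End.mul_apply, h.H_E ih]
    push_cast; module

lemma IsRep.H_F_pow (h : T.IsRep) {v : V} {z : ℂ} (hv : T.H v = z • v) (k : ℕ) :
    T.H ((T.F ^ k) v) = (z - 2 * k) • (T.F ^ k) v := by
  induction k with
  | zero => simpa using hv
  | succ k ih =>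
    rw [pow_succ', Module.End.mul_apply, h.H_F ih]
    push_cast; module

lemma K_apply (T : Ops V) {v : V} {z : ℂ} (hv : T.H v = z • v) :
    T.K v = T.F (T.E v) + cc z • v := by
  simp only [K, LinearMap.add_apply, LinearMap.smul_apply, Module.End.mul_apply, pow_two, hv,
    map_smul, cc]
  module

lemma IsRep.K_apply' (h : T.IsRep) {v : V} {z : ℂ} (hv : T.H v = z • v) :
    T.K v = T.E (T.F v) + cc (-z) • v := by
  have := congr($(h.EF) v)
  simp only [Module.End.mul_apply, LinearMap.add_apply, hv] at this
  rw [T.K_apply hv, this]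
  unfold cc
  module

lemma commute_apply {M N : Module.End ℂ V} (h : Commute M N) (v : V) : M (N v) = N (M v) :=
  congr($(h.eq) v)

lemma eigen_of_commute {M N : Module.End ℂ V} (h : Commute M N) {v : V} {z : ℂ}
    (hv : M v = z • v) : M (N v) = z • N v := by
  rw [commute_apply h, hv, map_smul]

/-- The weights of an isotypic component of spin `p / 2`. -/
lemma IsRep.weight_bounds (h : T.IsRep) {v : V} (hv : v ≠ 0) {p : ℕ} {z : ℂ}
    (hK : T.K v = cc p • v) (hH : T.H v = z • v) :
    ∃ i j : ℕ, z + 2 * j = p ∧ z - 2 * i = -p ∧ (T.E ^ (j + 1)) v = 0 := by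
  obtain ⟨j, hj, hj'⟩ := exists_last_iterate h.nilE hv
  obtain ⟨i, hi, hi'⟩ := exists_last_iterate h.nilF hv
  have e1 : cc (z + 2 * j) = cc p := by
    have h1 := T.K_apply (h.H_E_pow hH j)
    rw [eigen_of_commute (h.central_K.E.pow_right j) hK, ← Module.End.mul_apply T.E, ← pow_succ',
      hj', map_zero, zero_add] at h1
    exact (smul_left_injective ℂ hj h1).symm
  have e2 : cc (-(z - 2 * i)) = cc p := by
    have h1 := h.K_apply' (h.H_F_pow hH i)
    rw [eigen_of_commute (h.central_K.F.pow_right i) hK, ← Module.End.mul_apply T.F, ← pow_succ',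
      hi', map_zero, zero_add] at h1
    exact (smul_left_injective ℂ hi h1).symm
  have key : ∀ n : ℕ, (n : ℂ) + 2 ≠ 0 := fun n hn => by
    have : ((n + 2 : ℕ) : ℂ) = 0 := by push_cast; exact hn
    have := Nat.cast_eq_zero.1 this
    omega
  -- The two ends of the weight string differ by `2 (i + j) ≥ 0`. Any choice of a reflected root
  -- would make this difference negative.
  rcases (cc_eq_iff _ _).1 e1 with e1 | e1 <;> rcases (cc_eq_iff _ _).1 e2 with e2 | e2
  · exact ⟨i, j, e1, by linear_combination -e2, hj'⟩
  · exact absurd (by push_cast; linear_combination e1 + e2) (key (2 * i + 2 * j))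
  · exact absurd (by push_cast; linear_combination e1 + e2) (key (2 * i + 2 * j))
  · exact absurd (by push_cast; linear_combination e1 + e2) (key (2 * i + 2 * j + 2 * p + 2))

/-- A highest weight vector in an isotypic component of spin `p / 2` has weight `p`. -/
lemma IsRep.highest_weight (h : T.IsRep) {v : V} {p : ℕ} (hK : T.K v = cc p • v)
    (hE : T.E v = 0) : T.H v = (p : ℂ) • v := by
  -- No weight is assumed for `v`. Since `E v = 0`, the Casimir equation factors as `(H - p)(H + p +
  -- 2) v = 0`, so `u` would have weight `-p - 2`, below the lowest weight `-p`.
  set u := T.H v - (p : ℂ) • v with hu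
  have hKv : (1 / 4 : ℂ) • T.H (T.H v) + (1 / 2 : ℂ) • T.H v = cc p • v := by
    rw [← hK]
    simp [K, hE, pow_two]
  have hHu : T.H u = (-(p : ℂ) - 2) • u := by
    have : T.H (T.H v) = (4 * cc p) • v - (2 : ℂ) • T.H v := by
      rw [mul_smul, ← hKv]; module
    rw [hu, map_sub, this, map_smul]
    unfold cc
    module
  have hKu : T.K u = cc p • u := by
    rw [hu, map_sub, map_smul, eigen_of_commute h.central_K.H hK, hK]
    module
  by_contra hne
  obtain ⟨i, j, -, h2, -⟩ := h.weight_bounds (v := u) (by rwa [hu, sub_ne_zero]) hKu hHu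
  have : ((2 + 2 * i : ℕ) : ℂ) = 0 := by push_cast; linear_combination -h2
  have := Nat.cast_eq_zero.1 this
  omega

end Vectors

end Ops

end


/-! ### Index sets, spectral polynomials and the Clebsch–Gordan rule -/

open Polynomial

/-- `k` is the number of lowering steps below the top weight `a + b`; the Clebsch–Gordan arguments
produce and consume the set in this form. -/
lemma mem_J₂ {a b c : ℕ} : c ∈ J₂ a b ↔ ∃ k, k ≤ a ∧ k ≤ b ∧ c + 2 * k = a + b := by
  simp only [J₂, Finset.mem_filter, Finset.mem_range]
  constructor
  · rintro ⟨h1, h2, h3, h4⟩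
    obtain ⟨r, hr⟩ := h4
    exact ⟨a + b - r, by omega, by omega, by omega⟩
  · rintro ⟨k, h1, h2, h3⟩
    exact ⟨by omega, by omega, by omega, ⟨a + b - k, by omega⟩⟩

lemma J₂_comm (a b : ℕ) : J₂ a b = J₂ b a := by
  ext c
  simp only [mem_J₂]
  constructor <;> rintro ⟨k, h1, h2, h3⟩ <;> exact ⟨k, h2, h1, by omega⟩

lemma J₂_nonempty (a b : ℕ) : (J₂ a b).Nonempty :=
  ⟨a + b, mem_J₂.2 ⟨0, by omega, by omega, by omega⟩⟩

lemma M₃_comm (a b c : ℕ) : M₃ a b c = M₃ b a c := by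
  simp only [M₃, edges, J₂_comm a b]

lemma mem_edges {a b c : ℕ} {e : ℕ × ℕ} : e ∈ edges a b c ↔ e.1 ∈ J₂ a b ∧ e.2 ∈ J₂ e.1 c := by
  obtain ⟨k, l⟩ := e
  simp only [edges, Finset.mem_biUnion, Finset.mem_image, Prod.mk.injEq]
  constructor
  · rintro ⟨k', hk, l', hl, rfl, rfl⟩
    exact ⟨hk, hl⟩
  · rintro ⟨hk, hl⟩
    exact ⟨k, hk, l, hl, rfl, rfl⟩

lemma mem_J₃ {a b c l : ℕ} : l ∈ J₃ a b c ↔ ∃ k ∈ J₂ a b, l ∈ J₂ k c := by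
  simp only [J₃, Finset.mem_image, mem_edges]
  constructor
  · rintro ⟨⟨k, l'⟩, ⟨h1, h2⟩, rfl⟩
    exact ⟨k, h1, h2⟩
  · rintro ⟨k, h1, h2⟩
    exact ⟨(k, l), ⟨h1, h2⟩, rfl⟩

/-- This form, parity and the quadrilateral inequalities, is symmetric in the three spins, so
permutation invariance of `J₃` becomes a matter of `omega`. -/
lemma mem_J₃_iff {a b c l : ℕ} : l ∈ J₃ a b c ↔
    (a + b + c + l) % 2 = 0 ∧ a ≤ b + c + l ∧ b ≤ a + c + l ∧ c ≤ a + b + l ∧ l ≤ a + b + c := by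
  simp only [mem_J₃, mem_J₂]
  constructor
  · rintro ⟨k, ⟨r, h1, h2, h3⟩, ⟨t, h4, h5, h6⟩⟩
    omega
  · rintro ⟨h0, h1, h2, h3, h4⟩
    have key : ∀ k, k ≤ a + b → a ≤ b + k → b ≤ a + k → (a + b + k) % 2 = 0 → l ≤ k + c →
        k ≤ l + c → c ≤ k + l → ∃ k, (∃ r, r ≤ a ∧ r ≤ b ∧ k + 2 * r = a + b) ∧
          ∃ r, r ≤ k ∧ r ≤ c ∧ l + 2 * r = k + c := fun k _ _ _ _ _ _ _ =>
      ⟨k, ⟨(a + b - k) / 2, by omega, by omega, by omega⟩,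
        (k + c - l) / 2, by omega, by omega, by omega⟩
    -- The smallest possible intermediate spin is the larger of `|a - b|` and `|l - c|`; each
    -- absolute value is a sum of two truncated differences.
    by_cases h5 : (a - b) + (b - a) ≤ (l - c) + (c - l)
    · exact key ((l - c) + (c - l)) (by omega) (by omega) (by omega) (by omega) (by omega)
        (by omega) (by omega)
    · exact key ((a - b) + (b - a)) (by omega) (by omega) (by omega) (by omega) (by omega)
        (by omega) (by omega)

lemma J₃_nonempty (a b c : ℕ) : (J₃ a b c).Nonempty := by
  obtain ⟨k, hk⟩ := J₂_nonempty a b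
  obtain ⟨l, hl⟩ := J₂_nonempty k c
  exact ⟨l, mem_J₃.2 ⟨k, hk, hl⟩⟩

lemma mem_M₃ {a b c : ℕ} {m : ℚ} :
    m ∈ M₃ a b c ↔ ∃ k ∈ J₂ a b, ∃ l ∈ J₂ k c, cas l - cas k = m := by
  simp only [M₃, Finset.mem_image, mem_edges]
  constructor
  · rintro ⟨⟨k, l⟩, ⟨h1, h2⟩, h⟩
    exact ⟨k, h1, l, h2, h⟩
  · rintro ⟨k, h1, l, h2, h⟩
    exact ⟨(k, l), ⟨h1, h2⟩, h⟩

/-- Lagrange idempotents for the roots of `polyJ J`. -/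
lemma exists_lagrange {J : Finset ℕ} (hJ : J.Nonempty) :
    ∃ e : ℕ → ℂ[X], ∑ p ∈ J, e p = 1 ∧
      (∀ p ∈ J, polyJ J ∣ (X - C ((cas p : ℚ) : ℂ)) * e p) ∧
      ∀ p ∈ J, ∀ q ∈ J, (e p).eval ((cas q : ℚ) : ℂ) = if p = q then 1 else 0 := by
  have hinj : Set.InjOn (fun n : ℕ => ((cas n : ℚ) : ℂ)) J := cas_injective.injOn
  refine ⟨fun p => Lagrange.basis J (fun n => ((cas n : ℚ) : ℂ)) p,
    Lagrange.sum_basis hinj hJ, fun p hp => ?_, fun p hp q hq => ?_⟩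
  swap
  · split_ifs with hpq
    · subst hpq; exact Lagrange.eval_basis_self hinj hp
    · exact Lagrange.eval_basis_of_ne (v := fun n : ℕ => ((cas n : ℚ) : ℂ)) hpq hq
  have h1 : polyJ J = (X - C ((cas p : ℚ) : ℂ)) *
      ∏ n ∈ J.erase p, (X - C ((cas n : ℚ) : ℂ)) :=
    (Finset.mul_prod_erase J (fun n => (X - C ((cas n : ℚ) : ℂ))) hp).symm
  rw [h1]
  refine mul_dvd_mul_left _ ?_
  unfold Lagrange.basis
  refine Finset.prod_dvd_prod_of_dvd _ _ fun n _ => ?_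
  exact Dvd.intro_left _ rfl

lemma polyJ_dvd {s t : Finset ℕ} (h : s ⊆ t) : polyJ s ∣ polyJ t :=
  Finset.prod_dvd_prod_of_subset _ _ _ h

lemma commute_aeval {R : Type*} [Ring R] [Algebra ℂ R] {K M : R} (h : Commute K M) (P : ℂ[X]) :
    Commute (aeval K P) M := by
  induction P using Polynomial.induction_on' with
  | add p q hp hq => simpa using hp.add_left hq
  | monomial n a =>
    rw [aeval_monomial]
    exact (Algebra.commute_algebraMap_left a M).mul_left (h.pow_left n)

section

variable {V : Type*} [AddCommGroup V] [Module ℂ V]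

lemma aeval_apply_eq_zero_of_dvd {K : Module.End ℂ V} {P Q : ℂ[X]} (h : P ∣ Q) {v : V}
    (hv : aeval K P v = 0) : aeval K Q v = 0 := by
  obtain ⟨R, rfl⟩ := h
  rw [mul_comm, map_mul, Module.End.mul_apply, hv, map_zero]

lemma aeval_apply_eigen {K : Module.End ℂ V} {v : V} {c : ℂ} (h : K v = c • v) (P : ℂ[X]) :
    aeval K P v = P.eval c • v := by
  induction P using Polynomial.induction_on' with
  | add p q hp hq => simp [hp, hq, add_smul]
  | monomial n a =>
    have : (K ^ n) v = c ^ n • v := by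
      induction n with
      | zero => simp
      | succ n ih => rw [pow_succ', Module.End.mul_apply, ih, map_smul, h, smul_smul, pow_succ]
    simp [aeval_monomial, this, Module.algebraMap_end_apply, smul_smul, mul_comm]

/-- `K` preserves the eigenspaces of `A`, so there `K - A` is `K` shifted by a scalar. This reduces
a relation for a difference of Casimirs to one for a single Casimir. -/
lemma aeval_sub_apply {K A : Module.End ℂ V} (h : Commute K A) {v : V} {c : ℂ}
    (hv : A v = c • v) (P : ℂ[X]) : aeval (K - A) P v = aeval K (P.comp (X - C c)) v := by
  induction P using Polynomial.induction_on' with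
  | add p q hp hq => simp [hp, hq]
  | monomial n a =>
    have h1 : ∀ n : ℕ, ((K - A) ^ n) v = aeval K ((X - C c) ^ n) v := by
      intro n
      induction n with
      | zero => simp
      | succ n ih =>
        rw [pow_succ', Module.End.mul_apply, ih, pow_succ', map_mul, Module.End.mul_apply,
          LinearMap.sub_apply,
          Ops.eigen_of_commute (commute_aeval h _).symm hv]
        simp [Module.algebraMap_end_apply]
    rw [aeval_monomial, Module.End.mul_apply, h1, monomial_comp, map_mul, Module.End.mul_apply]
    simp

/-- An operator annihilated by `polyJ J` splits every vector into eigenvectors. -/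
lemma exists_eigen_decomposition {K : Module.End ℂ V} {J : Finset ℕ} (hJ : J.Nonempty)
    (hK : aeval K (polyJ J) = 0) :
    ∃ e : ℕ → ℂ[X], (∀ v, ∑ p ∈ J, aeval K (e p) v = v) ∧
      (∀ p ∈ J, ∀ v, K (aeval K (e p) v) = cc p • aeval K (e p) v) ∧
      ∀ q : ℕ, ∀ v, K v = cc q • v → ∀ p ∈ J, p ≠ q → aeval K (e p) v = 0 := by
  obtain ⟨e, he, he', -⟩ := exists_lagrange hJ
  have h2 : ∀ p ∈ J, ∀ v, K (aeval K (e p) v) = cc p • aeval K (e p) v := by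
    intro p hp v
    have := aeval_apply_eq_zero_of_dvd (v := v) (he' p hp) (by rw [hK]; rfl)
    simpa [sub_eq_zero, Module.algebraMap_end_apply, cas_cast] using this
  refine ⟨e, fun v => ?_, h2, fun q v hv p hp hpq => ?_⟩
  · have := congr(aeval K $he v)
    simpa using this
  · have h3 := h2 p hp v
    rw [aeval_apply_eigen hv, map_smul, hv, smul_comm, ← sub_eq_zero, ← sub_smul] at h3
    rw [aeval_apply_eigen hv]
    refine (smul_eq_zero.1 h3).resolve_left fun h => hpq ?_
    have h4 : cc q = cc p := sub_eq_zero.1 h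
    rw [← cas_cast, ← cas_cast] at h4
    exact (cas_injective h4).symm

/-- The spectral projections are polynomials in `K`, so they preserve whatever further property `S`
records, such as being a weight vector. -/
lemma span_eigen {K : Module.End ℂ V} {J : Finset ℕ} (hJ : J.Nonempty)
    (hK : aeval K (polyJ J) = 0) {S : Set V} (hS : Submodule.span ℂ S = ⊤)
    (hS' : ∀ P : ℂ[X], ∀ v ∈ S, aeval K P v ∈ S) :
    Submodule.span ℂ {v | v ∈ S ∧ ∃ p ∈ J, K v = cc p • v} = ⊤ := by
  obtain ⟨e, he, he', -⟩ := exists_eigen_decomposition hJ hK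
  rw [eq_top_iff, ← hS, Submodule.span_le]
  intro v hv
  rw [← he v]
  exact Submodule.sum_mem _ fun p hp =>
    Submodule.subset_span ⟨hS' _ v hv, p, hp, he' p hp v⟩

lemma eq_zero_of_span {S : Set V} (hS : Submodule.span ℂ S = ⊤) {M : Module.End ℂ V}
    (h : ∀ v ∈ S, M v = 0) : M = 0 :=
  LinearMap.ext_on hS fun v hv => by simpa using h v hv

namespace Ops

/-- In an isotypic component of spin `p / 2` the raising operator has order `p + 1`. -/
lemma IsRep.E_pow_eq_zero {T : Ops V} (h : T.IsRep) {J : Finset ℕ} (hJ : J.Nonempty)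
    (hK : aeval T.K (polyJ J) = 0)
    (hS : Submodule.span ℂ {v | ∃ z : ℂ, T.H v = z • v} = ⊤) {p : ℕ} {v : V}
    (hv : T.K v = cc p • v) : (T.E ^ (p + 1)) v = 0 := by
  obtain ⟨e, he, he', he''⟩ := exists_eigen_decomposition hJ hK
  by_cases hp : p ∈ J
  -- `v` need not be a weight vector. The identity is checked on weight vectors after projection to
  -- spin `p / 2`, where the string has `i + j = p` steps, and is then applied to `v`, which the
  -- projection fixes.
  · have h1 : T.E ^ (p + 1) * aeval T.K (e p) = 0 := by
      refine eq_zero_of_span hS ?_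
      rintro u ⟨z, hz⟩
      rw [Module.End.mul_apply]
      by_cases h0 : aeval T.K (e p) u = 0
      · rw [h0, map_zero]
      obtain ⟨i, j, h1, h2, h3⟩ := h.weight_bounds h0 (he' p hp u)
        (eigen_of_commute (commute_aeval h.central_K.H _).symm hz)
      have h4 : ((i + j : ℕ) : ℂ) = p := by push_cast; linear_combination (h1 - h2) / 2
      have h5 : i + j = p := by exact_mod_cast h4
      have h6 : p + 1 = i + (j + 1) := by omega
      rw [h6, pow_add, Module.End.mul_apply, h3, map_zero]
    have h2 : v = aeval T.K (e p) v := by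
      conv_lhs => rw [← he v]
      exact Finset.sum_eq_single_of_mem p hp fun q hq hqp => he'' p v hv q hq hqp
    rw [h2, ← Module.End.mul_apply, h1, LinearMap.zero_apply]
  · have : v = 0 := by
      rw [← he v]
      exact Finset.sum_eq_zero fun q hq => he'' p v hv q hq fun h => hp (h ▸ hq)
    rw [this, map_zero]

/-- A highest weight vector of a tensor product of isotypic components leads to a joint highest
weight vector. -/
lemma IsRep.joint_highest {T U : Ops V} (hT : T.IsRep) (hU : U.IsRep) (h : T.Comm U) {p q : ℕ}
    {v : V} (hv : v ≠ 0) (hKT : T.K v = cc p • v) (hKU : U.K v = cc q • v) {z : ℂ}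
    (hH : (T + U).H v = z • v) (hE : (T + U).E v = 0) (hp : (T.E ^ (p + 1)) v = 0)
    (hq : (U.E ^ (q + 1)) v = 0) :
    ∃ k : ℕ, k ≤ p ∧ k ≤ q ∧ z + 2 * k = p + q ∧ (T.E ^ k) v ≠ 0 ∧ T.E ((T.E ^ k) v) = 0 ∧
      U.E ((T.E ^ k) v) = 0 := by
  obtain ⟨k, hk, hk'⟩ := exists_last_iterate hT.nilE hv
  have hEv : T.E v = -U.E v := by
    rw [← add_eq_zero_iff_eq_neg]; exact hE
  -- On `v` the two raising operators are negatives of each other, hence so are their powers up to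
  -- sign. The last nonzero `T.E`-iterate is then killed by `U.E` too, and the bound `k ≤ q` can be
  -- read from `U`.
  have hpow : ∀ n : ℕ, (T.E ^ n) v = (-1 : ℂ) ^ n • (U.E ^ n) v := by
    intro n
    induction n with
    | zero => simp
    | succ n ih =>
      rw [pow_succ, Module.End.mul_apply, hEv, map_neg,
        commute_apply (h.EE.pow_left n), ih, pow_succ' U.E, Module.End.mul_apply, map_smul,
        pow_succ]
      module
  have hle : ∀ {A : Module.End ℂ V} {m n : ℕ}, n ≤ m → (A ^ n) v = 0 → (A ^ m) v = 0 := by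
    intro A m n hmn h0
    rw [← Nat.sub_add_cancel hmn, pow_add, Module.End.mul_apply, h0, map_zero]
  have hTE : T.E ((T.E ^ k) v) = 0 := by
    rw [← Module.End.mul_apply, ← pow_succ', hk']
  have hUE : U.E ((T.E ^ k) v) = 0 := by
    rw [hpow k, map_smul, ← Module.End.mul_apply, ← pow_succ']
    have := hpow (k + 1)
    rw [hk'] at this
    rw [(smul_eq_zero.1 this.symm).resolve_left (by simp), smul_zero]
  have hHT := hT.highest_weight (eigen_of_commute (hT.central_K.E.pow_right k) hKT) hTE
  have hHU := hU.highest_weight (p := q)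
    (eigen_of_commute (h.central_K.E.symm.pow_left k).symm hKU) hUE
  have hHtot : (T + U).H ((T.E ^ k) v) = (z + 2 * k) • (T.E ^ k) v := by
    have : ∀ n : ℕ, (T + U).H ((T.E ^ n) v) = (z + 2 * n) • (T.E ^ n) v := by
      intro n
      induction n with
      | zero => simpa using hH
      | succ n ih =>
        have e1 : (T + U).H * T.E = T.E * (T + U).H + (2 : ℂ) • T.E := by
          rw [add_H, add_mul, hT.HE, mul_add, h.EH.eq]; abel
        have := congr($e1 ((T.E ^ n) v))
        rw [pow_succ', Module.End.mul_apply]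
        simp only [Module.End.mul_apply, LinearMap.add_apply (T.E * _), LinearMap.smul_apply, ih,
          map_smul] at this
        rw [this]; push_cast; module
    exact this k
  refine ⟨k, ?_, ?_, ?_, hk, hTE, hUE⟩
  · by_contra hlt
    exact hk (hle (by omega) hp)
  · by_contra hlt
    apply hk
    rw [hpow, hle (by omega) hq, smul_zero]
  · rw [add_H, LinearMap.add_apply, hHT, hHU, ← add_smul] at hHtot
    exact (smul_left_injective ℂ hk hHtot).symm

/-- The Clebsch–Gordan rule for a tensor product of isotypic components. -/
lemma IsRep.clebsch_gordan {T U : Ops V} (hT : T.IsRep) (hU : U.IsRep) (h : T.Comm U) {p q : ℕ}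
    (hp : ∀ v, T.K v = cc p • v → (T.E ^ (p + 1)) v = 0)
    (hq : ∀ v, U.K v = cc q • v → (U.E ^ (q + 1)) v = 0)
    {v : V} (hKT : T.K v = cc p • v) (hKU : U.K v = cc q • v) {z : ℂ}
    (hH : (T + U).H v = z • v) : aeval (T + U).K (polyJ (J₂ p q)) v = 0 := by
  have hTU := hT.add hU h
  have cT : (T + U).Central T.K := hT.central_K.add h.symm.central_K
  have cU : (T + U).Central U.K := h.central_K.add hU.central_K
  -- Induction on the order of nilpotency of the total `E` at `v`. The set `s` collects spins that
  -- are at least the weight `z`; this bound is what makes a newly inserted spin `l = z` distinct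
  -- from those found above it.
  have key : ∀ N : ℕ, ∀ v : V, ∀ z : ℂ, T.K v = cc p • v → U.K v = cc q • v →
      (T + U).H v = z • v → ((T + U).E ^ N) v = 0 →
      ∃ s : Finset ℕ, s ⊆ J₂ p q ∧ (∀ l ∈ s, ∃ j : ℕ, (l : ℂ) = z + 2 * j) ∧
        aeval (T + U).K (polyJ s) v = 0 := by
    intro N
    induction N with
    | zero =>
      intro v z _ _ _ h0
      refine ⟨∅, by simp, by simp, ?_⟩
      have : v = 0 := by simpa using h0
      rw [this, map_zero]
    | succ N ih =>
      intro v z h1 h2 h3 h4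
      obtain ⟨s, hs, hs', hs''⟩ := ih ((T + U).E v) (z + 2) (eigen_of_commute cT.E h1)
        (eigen_of_commute cU.E h2) (hTU.H_E h3)
        (by rwa [← Module.End.mul_apply, ← pow_succ])
      have hsz : ∀ l ∈ s, ∃ j : ℕ, (l : ℂ) = z + 2 * j := by
        intro l hl
        obtain ⟨j, hj⟩ := hs' l hl
        exact ⟨j + 1, by rw [hj]; push_cast; ring⟩
      by_cases hz : ∃ l ∈ J₂ p q, (l : ℂ) = z
      · obtain ⟨l, hl, rfl⟩ := hz
        have hls : l ∉ s := by
          intro hl'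
          obtain ⟨j, hj⟩ := hs' l hl'
          have : ((2 + 2 * j : ℕ) : ℂ) = 0 := by push_cast; linear_combination -hj
          have := Nat.cast_eq_zero.1 this
          omega
        refine ⟨insert l s, Finset.insert_subset hl hs, ?_, ?_⟩
        · intro l' hl'
          rcases Finset.mem_insert.1 hl' with rfl | hl'
          · exact ⟨0, by simp⟩
          · exact hsz l' hl'
        · have e1 : polyJ (insert l s) = polyJ s * (X - C ((cas l : ℚ) : ℂ)) := by
            unfold polyJ; rw [Finset.prod_insert hls, mul_comm]
          have e2 : aeval (T + U).K (X - C ((cas l : ℚ) : ℂ)) v = (T + U).F ((T + U).E v) := by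
            simp [(T + U).K_apply h3, cas_cast, Module.algebraMap_end_apply]
          rw [e1, map_mul, Module.End.mul_apply, e2,
            commute_apply (commute_aeval hTU.central_K.F _), hs'', map_zero]
      · refine ⟨s, hs, hsz, ?_⟩
        by_contra hne
        -- A nonzero `polyJ s` applied to `v` would be killed by the total `E`, and `joint_highest`
        -- would place its weight `z` in `J₂ p q`.
        have f1 := eigen_of_commute (commute_aeval cT.K.symm (polyJ s)).symm h1
        have f2 := eigen_of_commute (commute_aeval cU.K.symm (polyJ s)).symm h2
        have f3 := eigen_of_commute (commute_aeval hTU.central_K.H (polyJ s)).symm h3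
        obtain ⟨k, hk1, hk2, hk3, -⟩ := hT.joint_highest hU h hne f1 f2 f3
          (by rw [← commute_apply (commute_aeval hTU.central_K.E _), hs'']) (hp _ f1) (hq _ f2)
        refine hz ⟨p + q - 2 * k, mem_J₂.2 ⟨k, hk1, hk2, by omega⟩, ?_⟩
        rw [Nat.cast_sub (by omega)]
        push_cast
        linear_combination -hk3
  obtain ⟨N, hN⟩ := hTU.nilE
  obtain ⟨s, hs, -, hs'⟩ := key N v z hKT hKU hH (by rw [hN]; rfl)
  exact aeval_apply_eq_zero_of_dvd (polyJ_dvd hs) hs'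

end Ops

end


/-! ### Spectra of the Casimirs on a triple product -/

open Polynomial

section

variable {V : Type*} [AddCommGroup V] [Module ℂ V]

namespace Ops

/-- Three commuting spins: `V` behaves as `[n₁] ⊗ [n₂] ⊗ [n₃]`. -/
structure IsTriple (T₁ T₂ T₃ : Ops V) (n₁ n₂ n₃ : ℕ) : Prop where
  rep₁ : T₁.IsRep
  rep₂ : T₂.IsRep
  rep₃ : T₃.IsRep
  comm₁₂ : T₁.Comm T₂
  comm₁₃ : T₁.Comm T₃
  comm₂₃ : T₂.Comm T₃
  cas₁ : ∀ v, T₁.K v = cc n₁ • v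
  cas₂ : ∀ v, T₂.K v = cc n₂ • v
  cas₃ : ∀ v, T₃.K v = cc n₃ • v
  span : Submodule.span ℂ {v | (∃ z : ℂ, T₁.H v = z • v) ∧ (∃ z : ℂ, T₂.H v = z • v) ∧
    ∃ z : ℂ, T₃.H v = z • v} = ⊤
  top : ∃ w, w ≠ 0 ∧ (T₁.E w = 0 ∧ T₂.E w = 0 ∧ T₃.E w = 0) ∧
    ∀ v, T₁.H v = (n₁ : ℂ) • v → T₂.H v = (n₂ : ℂ) • v → T₃.H v = (n₃ : ℂ) • v → ∃ c : ℂ, v = c • w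

namespace IsTriple

variable {T₁ T₂ T₃ : Ops V} {n₁ n₂ n₃ : ℕ}

lemma swap₁₂ (h : IsTriple T₁ T₂ T₃ n₁ n₂ n₃) : IsTriple T₂ T₁ T₃ n₂ n₁ n₃ where
  rep₁ := h.rep₂
  rep₂ := h.rep₁
  rep₃ := h.rep₃
  comm₁₂ := h.comm₁₂.symm
  comm₁₃ := h.comm₂₃
  comm₂₃ := h.comm₁₃
  cas₁ := h.cas₂
  cas₂ := h.cas₁
  cas₃ := h.cas₃
  span := by
    rw [← h.span]; congr 1; ext v; simp only [Set.mem_ofPred_eq]; tauto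
  top := by
    obtain ⟨w, h1, h2, h3⟩ := h.top
    exact ⟨w, h1, ⟨h2.2.1, h2.1, h2.2.2⟩, fun v a b c => h3 v b a c⟩

lemma swap₂₃ (h : IsTriple T₁ T₂ T₃ n₁ n₂ n₃) : IsTriple T₁ T₃ T₂ n₁ n₃ n₂ where
  rep₁ := h.rep₁
  rep₂ := h.rep₃
  rep₃ := h.rep₂
  comm₁₂ := h.comm₁₃
  comm₁₃ := h.comm₁₂
  comm₂₃ := h.comm₂₃.symm
  cas₁ := h.cas₁
  cas₂ := h.cas₃
  cas₃ := h.cas₂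
  span := by
    rw [← h.span]; congr 1; ext v; simp only [Set.mem_ofPred_eq]; tauto
  top := by
    obtain ⟨w, h1, h2, h3⟩ := h.top
    exact ⟨w, h1, ⟨h2.1, h2.2.2, h2.2.1⟩, fun v a b c => h3 v a c b⟩

lemma rep₁₂ (h : IsTriple T₁ T₂ T₃ n₁ n₂ n₃) : (T₁ + T₂).IsRep := h.rep₁.add h.rep₂ h.comm₁₂

lemma comm₁₂₃ (h : IsTriple T₁ T₂ T₃ n₁ n₂ n₃) : (T₁ + T₂).Comm T₃ :=
  h.comm₁₃.add_left h.comm₂₃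

lemma rep₁₂₃ (h : IsTriple T₁ T₂ T₃ n₁ n₂ n₃) : (T₁ + T₂ + T₃).IsRep :=
  h.rep₁₂.add h.rep₃ h.comm₁₂₃

lemma central_K₁₂ (h : IsTriple T₁ T₂ T₃ n₁ n₂ n₃) : (T₁ + T₂ + T₃).Central (T₁ + T₂).K :=
  h.rep₁₂.central_K.add h.comm₁₂₃.symm.central_K

lemma span_weight₁ (h : IsTriple T₁ T₂ T₃ n₁ n₂ n₃) :
    Submodule.span ℂ {v | ∃ z : ℂ, T₁.H v = z • v} = ⊤ := by
  rw [eq_top_iff, ← h.span]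
  exact Submodule.span_mono fun v hv => hv.1

lemma span_weight₁₂ (h : IsTriple T₁ T₂ T₃ n₁ n₂ n₃) :
    Submodule.span ℂ {v | ∃ z : ℂ, (T₁ + T₂).H v = z • v} = ⊤ := by
  rw [eq_top_iff, ← h.span]
  refine Submodule.span_mono ?_
  rintro v ⟨⟨x, hx⟩, ⟨y, hy⟩, -⟩
  exact ⟨x + y, by rw [add_H, LinearMap.add_apply, hx, hy, add_smul]⟩

lemma span_weight (h : IsTriple T₁ T₂ T₃ n₁ n₂ n₃) :
    Submodule.span ℂ {v | ∃ z : ℂ, (T₁ + T₂ + T₃).H v = z • v} = ⊤ := by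
  rw [eq_top_iff, ← h.span]
  refine Submodule.span_mono ?_
  rintro v ⟨⟨x, hx⟩, ⟨y, hy⟩, ⟨z, hz⟩⟩
  exact ⟨x + y + z, by simp only [add_H, LinearMap.add_apply, hx, hy, hz, add_smul]⟩

lemma E_pow₁ (h : IsTriple T₁ T₂ T₃ n₁ n₂ n₃) (v : V) : (T₁.E ^ (n₁ + 1)) v = 0 := by
  refine h.rep₁.E_pow_eq_zero (J := {n₁}) (by simp) ?_ h.span_weight₁ (h.cas₁ v)
  ext v
  simp [polyJ, cas_cast, Module.algebraMap_end_apply, h.cas₁ v]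

lemma E_pow₂ (h : IsTriple T₁ T₂ T₃ n₁ n₂ n₃) (v : V) : (T₂.E ^ (n₂ + 1)) v = 0 :=
  h.swap₁₂.E_pow₁ v

lemma E_pow₃ (h : IsTriple T₁ T₂ T₃ n₁ n₂ n₃) (v : V) : (T₃.E ^ (n₃ + 1)) v = 0 :=
  h.swap₂₃.swap₁₂.E_pow₁ v

/-- The spectrum of the intermediate Casimir. -/
lemma polyJ_K₁₂ (h : IsTriple T₁ T₂ T₃ n₁ n₂ n₃) :
    aeval (T₁ + T₂).K (polyJ (J₂ n₁ n₂)) = 0 := by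
  refine eq_zero_of_span h.span_weight₁₂ ?_
  rintro v ⟨z, hz⟩
  exact h.rep₁.clebsch_gordan h.rep₂ h.comm₁₂ (fun v _ => h.E_pow₁ v) (fun v _ => h.E_pow₂ v)
    (h.cas₁ v) (h.cas₂ v) hz

lemma E_pow₁₂ (h : IsTriple T₁ T₂ T₃ n₁ n₂ n₃) {p : ℕ} {v : V} (hv : (T₁ + T₂).K v = cc p • v) :
    ((T₁ + T₂).E ^ (p + 1)) v = 0 :=
  h.rep₁₂.E_pow_eq_zero (J₂_nonempty n₁ n₂) h.polyJ_K₁₂ h.span_weight₁₂ hv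

lemma span_weight_eigen (h : IsTriple T₁ T₂ T₃ n₁ n₂ n₃) :
    Submodule.span ℂ {v | (∃ z : ℂ, (T₁ + T₂ + T₃).H v = z • v) ∧
      ∃ p ∈ J₂ n₁ n₂, (T₁ + T₂).K v = cc p • v} = ⊤ := by
  refine span_eigen (J₂_nonempty n₁ n₂) h.polyJ_K₁₂ h.span_weight ?_
  rintro P v ⟨z, hz⟩
  exact ⟨z, eigen_of_commute (commute_aeval h.central_K₁₂.H P).symm hz⟩

lemma polyJ_K₁₂₃_apply (h : IsTriple T₁ T₂ T₃ n₁ n₂ n₃) {v : V} {z : ℂ} {p : ℕ}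
    (hz : (T₁ + T₂ + T₃).H v = z • v) (hv : (T₁ + T₂).K v = cc p • v) :
    aeval (T₁ + T₂ + T₃).K (polyJ (J₂ p n₃)) v = 0 :=
  h.rep₁₂.clebsch_gordan h.rep₃ h.comm₁₂₃ (fun _ hv => h.E_pow₁₂ hv) (fun v _ => h.E_pow₃ v)
    hv (h.cas₃ v) hz

/-- The spectrum of the total Casimir. -/
lemma polyJ_K₁₂₃ (h : IsTriple T₁ T₂ T₃ n₁ n₂ n₃) :
    aeval (T₁ + T₂ + T₃).K (polyJ (J₃ n₁ n₂ n₃)) = 0 := by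
  refine eq_zero_of_span h.span_weight_eigen ?_
  rintro v ⟨⟨z, hz⟩, p, hp, hv⟩
  exact aeval_apply_eq_zero_of_dvd (polyJ_dvd fun l hl => mem_J₃.2 ⟨p, hp, hl⟩)
    (h.polyJ_K₁₂₃_apply hz hv)

/-- The joint spectrum of the total and the intermediate Casimir. -/
lemma polyM_sub (h : IsTriple T₁ T₂ T₃ n₁ n₂ n₃) :
    aeval ((T₁ + T₂ + T₃).K - (T₁ + T₂).K) (polyM (M₃ n₁ n₂ n₃)) = 0 := by
  refine eq_zero_of_span h.span_weight_eigen ?_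
  rintro v ⟨⟨z, hz⟩, p, hp, hv⟩
  have hsub : (J₂ p n₃).image (fun l => cas l - cas p) ⊆ M₃ n₁ n₂ n₃ := by
    intro m hm
    obtain ⟨l, hl, rfl⟩ := Finset.mem_image.1 hm
    exact mem_M₃.2 ⟨p, hp, l, hl, rfl⟩
  have hdvd : polyM ((J₂ p n₃).image (fun l => cas l - cas p)) ∣ polyM (M₃ n₁ n₂ n₃) :=
    Finset.prod_dvd_prod_of_subset _ _ _ hsub
  refine aeval_apply_eq_zero_of_dvd hdvd ?_
  rw [aeval_sub_apply h.central_K₁₂.K.symm hv]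
  -- With `p` fixed, distinct `l` give distinct differences, so taking the image merges no factors
  -- and the shift by `cc p` recovers the roots `cas l`.
  have : (polyM ((J₂ p n₃).image (fun l => cas l - cas p))).comp (X - C (cc p)) =
      polyJ (J₂ p n₃) := by
    unfold polyM polyJ
    rw [Finset.prod_image, prod_comp]
    · refine Finset.prod_congr rfl fun l _ => ?_
      simp [← cas_cast]
    · intro l _ l' _ hll
      apply cas_injective
      have : cas l = cas l' := by simpa using hll
      simp [this]
  rw [this]
  exact h.polyJ_K₁₂₃_apply hz hv

/-- Operators commuting with the total spin are determined by their values on highest weight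
vectors. -/
lemma eq_zero_of_central (h : IsTriple T₁ T₂ T₃ n₁ n₂ n₃) {M : Module.End ℂ V}
    (hM : (T₁ + T₂ + T₃).Central M)
    (h0 : ∀ x ∈ J₃ n₁ n₂ n₃, ∀ v, (T₁ + T₂ + T₃).K v = cc x • v → (T₁ + T₂ + T₃).E v = 0 →
      M v = 0) : M = 0 := by
  have hr := h.rep₁₂₃
  have hspan := span_eigen (J₃_nonempty n₁ n₂ n₃) h.polyJ_K₁₂₃ h.span_weight (by
    rintro P v ⟨z, hz⟩
    exact ⟨z, eigen_of_commute (commute_aeval hr.central_K.H P).symm hz⟩)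
  refine eq_zero_of_span hspan ?_
  rintro v ⟨⟨z, hz⟩, p, hp, hv⟩
  -- If `cc z ≠ cc p`, then `v` is a multiple of `F (E v)` and `M v` is determined by `M (E v)`. If
  -- they agree, the weight string ends at `v`, which is then a highest weight vector.
  have key : ∀ N : ℕ, ∀ v : V, ∀ z : ℂ, (T₁ + T₂ + T₃).K v = cc p • v →
      (T₁ + T₂ + T₃).H v = z • v → ((T₁ + T₂ + T₃).E ^ N) v = 0 → M v = 0 := by
    intro N
    induction N with
    | zero =>
      intro v z _ _ h3
      have : v = 0 := by simpa using h3
      rw [this, map_zero]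
    | succ N ih =>
      intro v z h1 h2 h3
      by_cases hv0 : v = 0
      · rw [hv0, map_zero]
      by_cases hc : cc z = cc p
      · obtain ⟨i, j, e1, e2, e3⟩ := hr.weight_bounds hv0 h1 h2
        rcases (cc_eq_iff _ _).1 hc with hc | hc
        · have hj : j = 0 := by
            have : (j : ℂ) = 0 := by linear_combination (e1 - hc) / 2
            exact_mod_cast this
          subst hj
          exact h0 p hp v h1 (by simpa using e3)
        · exfalso
          have : ((2 * i + 2 : ℕ) : ℂ) = 0 := by push_cast; linear_combination hc - e2
          have := Nat.cast_eq_zero.1 this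
          omega
      · have e1 := ih _ (z + 2) (eigen_of_commute hr.central_K.E h1) (hr.H_E h2)
          (by rwa [← Module.End.mul_apply, ← pow_succ])
        have e2 : (T₁ + T₂ + T₃).F ((T₁ + T₂ + T₃).E v) = (cc p - cc z) • v := by
          have := (T₁ + T₂ + T₃).K_apply h2
          rw [h1] at this
          rw [sub_smul, this]; abel
        have e3 := congr(M $e2)
        rw [commute_apply hM.F, e1, map_zero, map_smul] at e3
        exact (smul_eq_zero.1 e3.symm).resolve_left (sub_ne_zero.2 (Ne.symm hc))
  obtain ⟨N, hN⟩ := hr.nilE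
  exact key N v z hv hz (by rw [hN]; rfl)

end IsTriple

end Ops

end


/-! ### Highest weight vectors: existence and multiplicity -/

open Polynomial

section

variable {V : Type*} [AddCommGroup V] [Module ℂ V]

namespace Ops

lemma IsRep.E_F_pow {T : Ops V} (h : T.IsRep) {w : V} {p : ℂ} (hE : T.E w = 0)
    (hH : T.H w = p • w) (i : ℕ) :
    T.E ((T.F ^ (i + 1)) w) = ((i + 1) * (p - i)) • (T.F ^ i) w := by
  have hEF : ∀ u, T.E (T.F u) = T.F (T.E u) + T.H u := fun u => congr($(h.EF) u)
  induction i with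
  | zero => simp [hEF, hE, hH]
  | succ i ih =>
    rw [pow_succ', Module.End.mul_apply, hEF, ih, h.H_F_pow hH, map_smul,
      ← Module.End.mul_apply T.F, ← pow_succ']
    push_cast
    module

lemma IsRep.E_pow_F_pow {T : Ops V} (h : T.IsRep) {w : V} {p : ℕ} (hE : T.E w = 0)
    (hH : T.H w = (p : ℂ) • w) {n : ℕ} (hn : n ≤ p) :
    ∃ c : ℂ, c ≠ 0 ∧ (T.E ^ n) ((T.F ^ n) w) = c • w := by
  induction n with
  | zero => exact ⟨1, one_ne_zero, by simp⟩
  | succ n ih =>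
    obtain ⟨c, hc, hc'⟩ := ih (by omega)
    refine ⟨((n + 1) * (p - n)) * c, ?_, ?_⟩
    · have h1 : (n : ℂ) + 1 ≠ 0 := by exact_mod_cast Nat.succ_ne_zero n
      have h2 : (p : ℂ) - n ≠ 0 := by
        rw [sub_ne_zero]; exact_mod_cast (by omega : p ≠ n)
      exact mul_ne_zero (mul_ne_zero h1 h2) hc
    · rw [pow_succ, Module.End.mul_apply, h.E_F_pow hE hH, map_smul, hc', smul_smul]

/-- Existence of highest weight vectors in the Clebsch–Gordan decomposition. -/
lemma IsRep.exists_highest {T U : Ops V} (hT : T.IsRep) (hU : U.IsRep) (h : T.Comm U) {p q m : ℕ}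
    (hm : m ∈ J₂ p q) {w : V} (hw : w ≠ 0) (hKT : T.K w = cc p • w) (hKU : U.K w = cc q • w)
    (hET : T.E w = 0) (hEU : U.E w = 0) :
    ∃ v, v ≠ 0 ∧ (T + U).E v = 0 ∧ (T + U).K v = cc m • v ∧
      ∀ M : Module.End ℂ V, Commute M T.F → Commute M U.F → M w = 0 → M v = 0 := by
  obtain ⟨k, hkp, hkq, hk⟩ := mem_J₂.1 hm
  have hHT := hT.highest_weight hKT hET
  have hHU := hU.highest_weight hKU hEU
  -- The highest weight vector is sought as `∑ x i • F^i F^(k-i) w`. The recursion makes the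
  -- contributions of `T.E` and `U.E` cancel; its denominators are nonzero for `i < k`, since `k ≤
  -- p`.
  let x : ℕ → ℂ := fun n => Nat.rec 1
    (fun i y => -(y * ((k - i) * (q - k + i + 1)) / ((i + 1) * (p - i)))) n
  have hx : ∀ i < k, x (i + 1) * ((i + 1) * (p - i)) + x i * ((k - i) * (q - k + i + 1)) = 0 := by
    intro i hi
    have h1 : ((i : ℂ) + 1) * (p - i) ≠ 0 := by
      refine mul_ne_zero (by exact_mod_cast Nat.succ_ne_zero i) ?_
      rw [sub_ne_zero]; exact_mod_cast (by omega : p ≠ i)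
    show -(x i * ((k - i) * (q - k + i + 1)) / ((i + 1) * (p - i))) * ((i + 1) * (p - i)) + _ = 0
    rw [neg_mul, div_mul_cancel₀ _ h1]
    ring
  let t : ℕ → V := fun i => (T.F ^ i) ((U.F ^ (k - i)) w)
  let v := ∑ i ∈ Finset.range (k + 1), x i • t i
  have hTE : ∀ n (u : V), T.E ((U.F ^ n) u) = (U.F ^ n) (T.E u) := fun n u =>
    commute_apply (h.EF.pow_right n) u
  have hUE : ∀ n (u : V), U.E ((T.F ^ n) u) = (T.F ^ n) (U.E u) := fun n u =>
    (commute_apply (h.FE.pow_left n) u).symm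
  have hTF : ∀ i n, (T.F ^ i) ((U.F ^ n) w) = (U.F ^ n) ((T.F ^ i) w) := fun i n =>
    commute_apply (h.FF.pow_pow i n) w
  have hEt1 : ∀ i, T.E (t (i + 1)) = (((i : ℂ) + 1) * (p - i)) • (T.F ^ i) ((U.F ^ (k - (i + 1))) w) := by
    intro i
    show T.E ((T.F ^ (i + 1)) ((U.F ^ (k - (i + 1))) w)) = _
    rw [hTF, hTE, hT.E_F_pow hET hHT, map_smul, hTF]
  have hEt2 : ∀ i < k, U.E (t i) =
      (((k : ℂ) - i) * (q - k + i + 1)) • (T.F ^ i) ((U.F ^ (k - (i + 1))) w) := by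
    intro i hi
    obtain ⟨r, rfl⟩ : ∃ r, k = i + 1 + r := ⟨k - (i + 1), by omega⟩
    show U.E ((T.F ^ i) ((U.F ^ (i + 1 + r - i)) w)) = _
    rw [hUE, show i + 1 + r - i = r + 1 by omega, show i + 1 + r - (i + 1) = r by omega,
      hU.E_F_pow hEU hHU, map_smul]
    push_cast
    congr 1
    ring
  have hEv : (T + U).E v = 0 := by
    have e1 : T.E v = ∑ i ∈ Finset.range k, (x (i + 1) * ((i + 1) * (p - i))) •
        (T.F ^ i) ((U.F ^ (k - (i + 1))) w) := by
      have h0 : T.E (t 0) = 0 := by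
        show T.E ((T.F ^ 0) ((U.F ^ (k - 0)) w)) = 0
        rw [pow_zero, Module.End.one_apply, hTE, hET, map_zero]
      rw [map_sum, Finset.sum_range_succ', map_smul, h0, smul_zero, add_zero]
      exact Finset.sum_congr rfl fun i _ => by rw [map_smul, hEt1, smul_smul]
    have e2 : U.E v = ∑ i ∈ Finset.range k, (x i * ((k - i) * (q - k + i + 1))) •
        (T.F ^ i) ((U.F ^ (k - (i + 1))) w) := by
      have h0 : U.E (t k) = 0 := by
        show U.E ((T.F ^ k) ((U.F ^ (k - k)) w)) = 0
        rw [hUE, Nat.sub_self, pow_zero, Module.End.one_apply, hEU, map_zero]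
      rw [map_sum, Finset.sum_range_succ, map_smul, h0, smul_zero, add_zero]
      exact Finset.sum_congr rfl fun i hi => by
        rw [map_smul, hEt2 i (Finset.mem_range.1 hi), smul_smul]
    rw [add_E, LinearMap.add_apply, e1, e2, ← Finset.sum_add_distrib]
    refine Finset.sum_eq_zero fun i hi => ?_
    rw [← add_smul, hx i (Finset.mem_range.1 hi), zero_smul]
  have hHv : (T + U).H v = (m : ℂ) • v := by
    rw [map_sum, Finset.smul_sum]
    refine Finset.sum_congr rfl fun i hi => ?_
    have hik : i ≤ k := by have := Finset.mem_range.1 hi; omega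
    rw [map_smul, smul_comm]
    congr 1
    have g1 : T.H (t i) = ((p : ℂ) - 2 * i) • t i :=
      hT.H_F_pow (eigen_of_commute (h.HF.pow_right _) hHT) i
    have g2 : U.H (t i) = ((q : ℂ) - 2 * (k - i : ℕ)) • t i :=
      eigen_of_commute (h.FH.symm.pow_right i) (hU.H_F_pow hHU _)
    have g3 : (m : ℂ) + 2 * k = p + q := by exact_mod_cast hk
    rw [add_H, LinearMap.add_apply, g1, g2, ← add_smul, Nat.cast_sub hik]
    congr 1
    linear_combination -g3
  have hne : v ≠ 0 := by
    intro hv0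
    -- `U.E ^ k` isolates the term `i = 0`: every other term contains fewer than `k` factors `U.F`.
    have e1 : (U.E ^ k) v = (U.E ^ k) ((U.F ^ k) w) := by
      rw [map_sum, Finset.sum_eq_single_of_mem 0 (by simp)]
      · rw [map_smul]
        show (1 : ℂ) • (U.E ^ k) ((T.F ^ 0) ((U.F ^ (k - 0)) w)) = _
        simp
      · intro i hi hi0
        have hik : i ≤ k := by have := Finset.mem_range.1 hi; omega
        obtain ⟨r, hr⟩ : ∃ r, k = r + (1 + (k - i)) := ⟨i - 1, by omega⟩
        obtain ⟨c, -, hc⟩ := hU.E_pow_F_pow hEU hHU (n := k - i) (by omega)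
        rw [map_smul]
        show x i • (U.E ^ k) ((T.F ^ i) ((U.F ^ (k - i)) w)) = 0
        rw [← commute_apply (h.FE.pow_pow i k)]
        conv_lhs => enter [2, 2, 1]; rw [hr]
        rw [pow_add, pow_add, Module.End.mul_apply, Module.End.mul_apply, hc, pow_one, map_smul,
          hEU, smul_zero, map_zero, map_zero, smul_zero]
    obtain ⟨c, hc, hc'⟩ := hU.E_pow_F_pow hEU hHU hkq
    rw [hv0, map_zero, hc'] at e1
    exact (smul_ne_zero hc hw) e1.symm
  refine ⟨v, hne, hEv, ?_, ?_⟩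
  · rw [(T + U).K_apply hHv, hEv, map_zero, zero_add]
  · intro M hMT hMU hM
    rw [map_sum]
    refine Finset.sum_eq_zero fun i _ => ?_
    rw [map_smul, commute_apply (hMT.pow_right _), commute_apply (hMU.pow_right _), hM, map_zero,
      map_zero, smul_zero]

/-- The space of highest weight vectors of spin `x / 2`. -/
def hw (T : Ops V) (x : ℕ) : Submodule ℂ V :=
  LinearMap.ker (T.K - cc x • (1 : Module.End ℂ V)) ⊓ LinearMap.ker T.E

lemma mem_hw {T : Ops V} {x : ℕ} {v : V} : v ∈ T.hw x ↔ T.K v = cc x • v ∧ T.E v = 0 := by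
  simp [hw, sub_eq_zero]

lemma Central.map_hw {T : Ops V} {M : Module.End ℂ V} (h : T.Central M) {x : ℕ} {v : V}
    (hv : v ∈ T.hw x) : M v ∈ T.hw x := by
  rw [mem_hw] at hv ⊢
  exact ⟨eigen_of_commute h.K.symm hv.1, by rw [← commute_apply h.E, hv.2, map_zero]⟩

namespace IsTriple

variable {T₁ T₂ T₃ : Ops V} {n₁ n₂ n₃ : ℕ}

lemma exists_hw (h : IsTriple T₁ T₂ T₃ n₁ n₂ n₃) {x : ℕ} (hx : x ∈ J₃ n₁ n₂ n₃) :
    ∃ v ∈ (T₁ + T₂ + T₃).hw x, v ≠ 0 := by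
  obtain ⟨p, hp, hx⟩ := mem_J₃.1 hx
  obtain ⟨w, hw0, ⟨hw1, hw2, hw3⟩, -⟩ := h.top
  obtain ⟨v, hv0, hvE, hvK, hv3⟩ := h.rep₁.exists_highest h.rep₂ h.comm₁₂ hp hw0 (h.cas₁ w)
    (h.cas₂ w) hw1 hw2
  -- `v` is made from `w` by lowering operators of the first two factors, so `T₃.E` still kills it
  -- and it can be coupled to the third factor.
  obtain ⟨u, hu0, huE, huK, -⟩ := h.rep₁₂.exists_highest h.rep₃ h.comm₁₂₃ hx hv0 hvK (h.cas₃ v)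
    hvE (hv3 _ h.comm₁₃.FE.symm h.comm₂₃.FE.symm hw3)
  exact ⟨u, mem_hw.2 ⟨huK, huE⟩, hu0⟩

/-- The joint eigenspaces of the intermediate and the total Casimir in the highest weight vectors
are lines. -/
lemma hw_eigen_le (h : IsTriple T₁ T₂ T₃ n₁ n₂ n₃) (p x : ℕ) :
    ∃ u, ∀ v ∈ (T₁ + T₂ + T₃).hw x, (T₁ + T₂).K v = cc p • v → ∃ c : ℂ, v = c • u := by
  obtain ⟨w, -, -, hw⟩ := h.top
  -- Applying `joint_highest` twice sends a nonzero `v` to a nonzero multiple of the top vector `w`.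
  -- The exponents depend only on `p` and `x`, so one linear map embeds the eigenspace into the line
  -- of `w`.
  have key : ∀ v ∈ (T₁ + T₂ + T₃).hw x, (T₁ + T₂).K v = cc p • v → v ≠ 0 →
      ∃ k k' : ℕ, (x : ℂ) + 2 * k = p + n₃ ∧ (p : ℂ) + 2 * k' = n₁ + n₂ ∧
        (T₁.E ^ k') (((T₁ + T₂).E ^ k) v) ≠ 0 ∧
        ∃ c : ℂ, (T₁.E ^ k') (((T₁ + T₂).E ^ k) v) = c • w := by
    intro v hv hp hv0
    obtain ⟨hvK, hvE⟩ := mem_hw.1 hv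
    obtain ⟨k, -, -, hk, h1, h2, h3⟩ := h.rep₁₂.joint_highest h.rep₃ h.comm₁₂₃ hv0 hp (h.cas₃ v)
      (h.rep₁₂₃.highest_weight hvK hvE) hvE (h.E_pow₁₂ hp) (h.E_pow₃ v)
    have h4 := eigen_of_commute (h.rep₁₂.central_K.E.pow_right k) hp
    obtain ⟨k', -, -, hk', h1', h2', h3'⟩ := h.rep₁.joint_highest h.rep₂ h.comm₁₂ h1 (h.cas₁ _)
      (h.cas₂ _) (h.rep₁₂.highest_weight h4 h2) h2 (h.E_pow₁ _) (h.E_pow₂ _)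
    refine ⟨k, k', hk, hk', h1', hw _ (h.rep₁.highest_weight (h.cas₁ _) h2')
      (h.rep₂.highest_weight (h.cas₂ _) h3') (h.rep₃.highest_weight (h.cas₃ _) ?_)⟩
    rw [commute_apply (h.comm₁₃.EE.symm.pow_right _), h3, map_zero]
  by_cases hex : ∃ u ∈ (T₁ + T₂ + T₃).hw x, (T₁ + T₂).K u = cc p • u ∧ u ≠ 0
  · obtain ⟨u, hu, hup, hu0⟩ := hex
    refine ⟨u, fun v hv hp => ?_⟩
    obtain ⟨k, k', hk, hk', h1, c, hc⟩ := key u hu hup hu0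
    have hc0 : c ≠ 0 := by
      rintro rfl
      exact h1 (by rw [hc, zero_smul])
    have hL : ∀ v ∈ (T₁ + T₂ + T₃).hw x, (T₁ + T₂).K v = cc p • v → v ≠ 0 →
        (T₁.E ^ k') (((T₁ + T₂).E ^ k) v) ≠ 0 ∧
        ∃ c : ℂ, (T₁.E ^ k') (((T₁ + T₂).E ^ k) v) = c • w := by
      intro v hv hp hv0
      obtain ⟨m, m', hm, hm', h2⟩ := key v hv hp hv0
      have e1 : (m : ℂ) = k := by linear_combination (hm - hk) / 2
      have e2 : (m' : ℂ) = k' := by linear_combination (hm' - hk') / 2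
      have e1 : m = k := by exact_mod_cast e1
      have e2 : m' = k' := by exact_mod_cast e2
      subst e1 e2
      exact h2
    by_cases hv0 : v = 0
    · exact ⟨0, by rw [hv0, zero_smul]⟩
    obtain ⟨-, d, hd⟩ := hL v hv hp hv0
    refine ⟨d / c, ?_⟩
    by_contra hne
    refine (hL (v - (d / c) • u) (Submodule.sub_mem _ hv (Submodule.smul_mem _ _ hu)) ?_
      (sub_ne_zero.2 hne)).1 ?_
    · rw [map_sub, map_smul, hp, hup]; module
    · rw [map_sub, map_sub, map_smul, map_smul, hd, hc, smul_smul, div_mul_cancel₀ _ hc0, sub_self]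
  · push Not at hex
    exact ⟨0, fun v hv hp => ⟨0, by rw [hex v hv hp, smul_zero]⟩⟩

/-- The multiplicity of `[x]` is bounded by the number of intermediate spins. -/
lemma finrank_hw_le (h : IsTriple T₁ T₂ T₃ n₁ n₂ n₃) (x : ℕ) :
    Module.Finite ℂ ((T₁ + T₂ + T₃).hw x) ∧
      Module.finrank ℂ ((T₁ + T₂ + T₃).hw x) ≤ (J₂ n₁ n₂).card := by
  classical
  choose u hu using fun p => h.hw_eigen_le p x
  obtain ⟨e, he, he', -⟩ := exists_eigen_decomposition (J₂_nonempty n₁ n₂) h.polyJ_K₁₂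
  have hle : (T₁ + T₂ + T₃).hw x ≤ Submodule.span ℂ ((J₂ n₁ n₂).image u : Set V) := by
    intro v hv
    rw [← he v]
    refine Submodule.sum_mem _ fun p hp => ?_
    obtain ⟨c, hc⟩ := hu p (aeval (T₁ + T₂).K (e p) v)
      (Central.map_hw ⟨commute_aeval h.central_K₁₂.E _, commute_aeval h.central_K₁₂.F _,
        commute_aeval h.central_K₁₂.H _⟩ hv) (he' p hp v)
    rw [hc]
    exact Submodule.smul_mem _ _ (Submodule.subset_span (by
      simpa using ⟨p, hp, rfl⟩))
  have : Module.Finite ℂ (Submodule.span ℂ ((J₂ n₁ n₂).image u : Set V)) :=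
    Module.Finite.span_finset ℂ _
  refine ⟨Submodule.finiteDimensional_of_le hle, ?_⟩
  exact (Submodule.finrank_mono hle).trans ((finrank_span_finset_le_card _).trans
    Finset.card_image_le)

end IsTriple

end Ops

end


/-! ### The Racah bracket and the Clifford relation for a spin 1/2 -/

open Polynomial

section Brackets

variable {R : Type*} [Ring R] [Algebra ℂ R]

/-- The double commutator relation of the Racah algebra, with scalar `α₁, α₂, α₃`. -/
def Bracket (A B C : R) (α₁ α₂ α₃ : ℂ) : Prop :=
  A * (B * A) - A * (A * B) - (B * A * A - A * B * A) =
    (-2 : ℂ) • (A * A) - (2 : ℂ) • (A * B + B * A) + (2 : ℂ) • (C * A)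
      + (2 * (α₁ + α₂ + α₃)) • A + (2 * (α₁ - α₂)) • (α₃ • (1 : R) - C)

/-- `Z` plays the role of the third pair Casimir. Since `C` commutes with `A`, the double commutator
only changes sign, and the relation goes over to the one with the first two spins exchanged. -/
lemma Bracket.third {A B C : R} {α₁ α₂ α₃ : ℂ} (h : Bracket A B C α₁ α₂ α₃) (hA : C * A = A * C)
    {Z : R} (hZ : Z = C + (α₁ + α₂ + α₃) • (1 : R) - A - B) : Bracket A Z C α₂ α₁ α₃ := by
  subst hZ
  unfold Bracket at *
  simp only [mul_add, add_mul, mul_sub, sub_mul, smul_mul_assoc, mul_smul_comm, mul_one, one_mul,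
    ← mul_assoc, ← hA] at h ⊢
  linear_combination (norm := module) (-1 : ℂ) • h

/-- Modulo central terms `Z` is `-A - B`, so `[Z, [A, Z]] = [B, [A, B]] - [A, [B, A]]` and the
relation is the difference of the two given ones. -/
lemma Bracket.third' {A B C : R} {α₁ α₂ α₃ : ℂ} (h : Bracket A B C α₁ α₂ α₃)
    (h' : Bracket B A C α₃ α₂ α₁) (hA : C * A = A * C) (hB : C * B = B * C)
    {Z : R} (hZ : Z = C + (α₁ + α₂ + α₃) • (1 : R) - A - B) : Bracket Z A C α₃ α₁ α₂ := by
  subst hZ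
  unfold Bracket at *
  have hAB : A * B * C = C * A * B := by rw [mul_assoc, ← hB, ← mul_assoc, hA]
  have hBA : B * A * C = C * B * A := by rw [mul_assoc, ← hA, ← mul_assoc, hB]
  have hAA : A * A * C = C * A * A := by rw [mul_assoc, ← hA, ← mul_assoc, hA]
  have hBB : B * B * C = C * B * B := by rw [mul_assoc, ← hB, ← mul_assoc, hB]
  have hAC : C * A * C = C * C * A := by rw [mul_assoc, ← hA, mul_assoc]
  have hBC : C * B * C = C * C * B := by rw [mul_assoc, ← hB, mul_assoc]
  simp only [mul_add, add_mul, mul_sub, sub_mul, smul_mul_assoc, mul_smul_comm, mul_one, one_mul,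
    ← mul_assoc, ← hA, ← hB, hAB, hBA, hAA, hAC] at h h' ⊢
  linear_combination (norm := module) h' - h

/-- The square of half the dimension of the spin-`n/2` representation. -/
def dimSq (n : ℕ) : ℂ := ((n : ℂ) + 1) ^ 2 / 4

/-- The bracket relation, in terms of the traceless parts, when one spin is `1/2`. -/
lemma bracket_iff {x y C : R} {a b : ℕ} (hx : x * x = dimSq a • (1 : R)) (hC : C * x = x * C) :
    Bracket (x + dimSq a • (1 : R)) (y + dimSq b • (1 : R)) C (cc a) (cc 1) (cc b) ↔
      (x + 1) * (x * y + y * x - C + (cc a + cc b + 1 / 4) • (1 : R)) = 0 := by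
  unfold Bracket
  have h1 : y * x * x = dimSq a • y := by rw [mul_assoc, hx, mul_smul_comm, mul_one]
  have ea : cc a = dimSq a - 1 / 4 := by unfold cc dimSq; ring
  have eb : cc b = dimSq b - 1 / 4 := by unfold cc dimSq; ring
  have e1 : cc 1 = 3 / 4 := by unfold cc; norm_num
  simp only [ea, eb, e1]
  rw [← sub_eq_zero]
  -- The difference of the two sides of the bracket relation is exactly twice the product on the
  -- right.
  have : ∀ u v : R, u = (2 : ℂ) • v → (u = 0 ↔ v = 0) := by
    rintro u v rfl
    simp
  apply this
  simp only [mul_add, add_mul, mul_sub, smul_mul_assoc, mul_smul_comm, mul_one, one_mul,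
    ← mul_assoc, hx, h1, hC]
  module

end Brackets

section

variable {V : Type*} [AddCommGroup V] [Module ℂ V]

namespace Ops

/-- Polarization: the Casimir is a quadratic expression in the operators. No commutation is needed.
-/
lemma K_add_add (T U W : Ops V) : (T + U).K + (U + W).K + (T + W).K =
    (T + U + W).K + T.K + U.K + W.K := by
  simp only [K, add_E, add_F, add_H, pow_two, mul_add, add_mul, smul_add]
  abel

namespace IsTriple

variable {T₁ T₂ T₃ : Ops V} {a b : ℕ}

lemma H_sq_of_half (h : IsTriple T₁ T₂ T₃ 1 a b) : T₁.H * T₁.H = 1 := by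
  rw [← sub_eq_zero]
  refine eq_zero_of_span h.span_weight₁ ?_
  rintro v ⟨z, hz⟩
  by_cases hv : v = 0
  · rw [hv, map_zero]
  obtain ⟨i, j, h1, h2, -⟩ := h.rep₁.weight_bounds hv (h.cas₁ v) hz
  have h3 : ((i + j : ℕ) : ℂ) = 1 := by
    push_cast at h1 h2 ⊢; linear_combination (h1 - h2) / 2
  have h3 : i + j = 1 := by exact_mod_cast h3
  have hz2 : z * z = 1 := by
    have : i = 0 ∨ i = 1 := by omega
    rcases this with rfl | rfl
    · have : z = -1 := by push_cast at h2; linear_combination h2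
      rw [this]; norm_num
    · have : z = 1 := by push_cast at h2; linear_combination h2
      rw [this]; norm_num
  simp [hz, smul_smul, hz2]

/-- The Pauli relations for a factor of spin `1/2`. -/
lemma pauli (h : IsTriple T₁ T₂ T₃ 1 a b) : T₁.E * T₁.E = 0 ∧ T₁.F * T₁.F = 0 ∧
    T₁.E * T₁.H + T₁.H * T₁.E = 0 ∧ T₁.F * T₁.H + T₁.H * T₁.F = 0 ∧
    T₁.E * T₁.F + T₁.F * T₁.E = 1 := by
  have hH := h.H_sq_of_half
  have hE := h.rep₁.HE
  have hF := h.rep₁.HF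
  have half : ∀ {u : Module.End ℂ V}, (2 : ℂ) • u = 0 → u = 0 := fun {u} hu => by simpa using hu
  -- Since `H² = 1`, its commutator with `E` vanishes; the `sl₂` relations compute that commutator
  -- as `2 (E H + H E)`.
  have e1 : T₁.E * T₁.H + T₁.H * T₁.E = 0 := by
    apply half
    have h1 : T₁.H * (T₁.H * T₁.E) = T₁.E * T₁.H * T₁.H + (2 : ℂ) • (T₁.E * T₁.H)
        + (2 : ℂ) • (T₁.H * T₁.E) := by
      conv_lhs => rw [hE, mul_add, ← mul_assoc, hE, mul_smul_comm]
      rw [add_mul, smul_mul_assoc, hE]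
    rw [← mul_assoc, hH, mul_assoc, hH, mul_one, one_mul] at h1
    rw [smul_add]
    have := sub_eq_zero.2 h1
    linear_combination (norm := module) (-1 : ℂ) • this
  have f1 : T₁.F * T₁.H + T₁.H * T₁.F = 0 := by
    apply half
    have h1 : T₁.H * (T₁.H * T₁.F) = T₁.F * T₁.H * T₁.H - (2 : ℂ) • (T₁.F * T₁.H)
        - (2 : ℂ) • (T₁.H * T₁.F) := by
      conv_lhs => rw [hF, mul_sub, ← mul_assoc, hF, mul_smul_comm]
      rw [sub_mul, smul_mul_assoc, hF]
    rw [← mul_assoc, hH, mul_assoc, hH, mul_one, one_mul] at h1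
    rw [smul_add]
    have := sub_eq_zero.2 h1
    linear_combination (norm := module) this
  have e2 : T₁.H * T₁.E = T₁.E := by
    have : (2 : ℂ) • (T₁.H * T₁.E - T₁.E) = 0 := by
      linear_combination (norm := module) hE + e1
    exact sub_eq_zero.1 (half this)
  have f2 : T₁.H * T₁.F = -T₁.F := by
    have : (2 : ℂ) • (T₁.H * T₁.F + T₁.F) = 0 := by
      linear_combination (norm := module) hF + f1
    exact eq_neg_of_add_eq_zero_left (half this)
  have e3 : T₁.E * T₁.H = -T₁.E := by
    rw [e2] at e1; exact eq_neg_of_add_eq_zero_left e1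
  have f3 : T₁.F * T₁.H = T₁.F := by
    rw [f2, add_neg_eq_zero] at f1; exact f1
  refine ⟨?_, ?_, e1, f1, ?_⟩
  -- The two bracketings of `E H E` give `-E²` and `E²`.
  · have h1 : T₁.E * T₁.H * T₁.E = T₁.E * (T₁.H * T₁.E) := mul_assoc _ _ _
    rw [e3, e2, neg_mul] at h1
    apply half
    linear_combination (norm := module) (-1 : ℂ) • h1
  · have h1 : T₁.F * T₁.H * T₁.F = T₁.F * (T₁.H * T₁.F) := mul_assoc _ _ _
    rw [f3, f2, mul_neg] at h1
    apply half
    linear_combination (norm := module) h1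
  · have h1 : T₁.H * (T₁.E * T₁.F) = T₁.H * (T₁.F * T₁.E + T₁.H) := by rw [h.rep₁.EF]
    rw [mul_add, hH, ← mul_assoc, ← mul_assoc, e2, f2, neg_mul] at h1
    linear_combination (norm := module) h1

/-- The scalar part of the spin–spin coupling. -/
lemma K_add_eq (h : IsTriple T₁ T₂ T₃ 1 a b) : (T₁ + T₂).K =
    (T₁.F * T₂.E + T₁.E * T₂.F + (1 / 2 : ℂ) • (T₁.H * T₂.H)) + (cc 1 + cc a) • 1 := by
  have h1 : T₁.K = cc 1 • 1 := by ext v; simpa using congr($(h.cas₁ v))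
  have h2 : T₂.K = cc a • 1 := by ext v; simpa using congr($(h.cas₂ v))
  rw [add_smul, ← h1, ← h2]
  simp only [K, add_E, add_F, add_H, pow_two, mul_add, add_mul, ← h.comm₁₂.HH.eq, ← h.comm₁₂.EF.eq]
  module

/-- Each coupling is a scalar product of the Pauli matrices with a partner spin. The partner spins
commute, so the anticommutator involves only the anticommutators of Pauli matrices, and those are
scalars. -/
lemma coupling_anticomm (h : IsTriple T₁ T₂ T₃ 1 a b) :
    (T₁.F * T₂.E + T₁.E * T₂.F + (1 / 2 : ℂ) • (T₁.H * T₂.H)) *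
      (T₁.F * T₃.E + T₁.E * T₃.F + (1 / 2 : ℂ) • (T₁.H * T₃.H)) +
    (T₁.F * T₃.E + T₁.E * T₃.F + (1 / 2 : ℂ) • (T₁.H * T₃.H)) *
      (T₁.F * T₂.E + T₁.E * T₂.F + (1 / 2 : ℂ) • (T₁.H * T₂.H)) =
    T₂.F * T₃.E + T₂.E * T₃.F + (1 / 2 : ℂ) • (T₂.H * T₃.H) := by
  obtain ⟨p1, p2, p3, p4, p5⟩ := h.pauli
  have hH := h.H_sq_of_half
  have key : ∀ {A B P Q : Module.End ℂ V}, Commute B P → Commute A Q → Commute P Q →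
      (A * P) * (B * Q) + (B * Q) * (A * P) = (A * B + B * A) * (P * Q) := by
    intro A B P Q h1 h2 h3
    have e1 : (A * P) * (B * Q) = A * B * (P * Q) := by
      rw [mul_assoc, ← mul_assoc P, ← h1.eq]; simp only [mul_assoc]
    have e2 : (B * Q) * (A * P) = B * A * (P * Q) := by
      rw [mul_assoc, ← mul_assoc Q, ← h2.eq, h3.eq]; simp only [mul_assoc]
    rw [e1, e2, add_mul]
  have k := h.comm₁₂
  have l := h.comm₁₃
  have m := h.comm₂₃
  have r1 := key k.FE l.FE m.EE
  have r2 := key k.EE l.FF m.EF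
  have r3 := key k.HE l.FH m.EH
  have r4 := key k.FF l.EE m.FE
  have r5 := key k.EF l.EF m.FF
  have r6 := key k.HF l.EH m.FH
  have r7 := key k.FH l.HE m.HE
  have r8 := key k.EH l.HF m.HF
  have r9 := key k.HH l.HH m.HH
  have p5' : T₁.F * T₁.E + T₁.E * T₁.F = 1 := by rw [add_comm]; exact p5
  rw [p2, add_zero, zero_mul] at r1
  rw [p5', one_mul] at r2
  rw [p4, zero_mul] at r3
  rw [p5, one_mul] at r4
  rw [p1, add_zero, zero_mul] at r5
  rw [p3, zero_mul] at r6
  rw [add_comm (T₁.H * T₁.F), p4, zero_mul] at r7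
  rw [add_comm (T₁.H * T₁.E), p3, zero_mul] at r8
  rw [hH, add_mul, one_mul] at r9
  simp only [mul_add, add_mul, smul_mul_assoc, mul_smul_comm]
  linear_combination (norm := module) r1 + r2 + (1 / 2 : ℂ) • r3 + r4 + r5 + (1 / 2 : ℂ) • r6 +
    (1 / 2 : ℂ) • r7 + (1 / 2 : ℂ) • r8 + (1 / 4 : ℂ) • r9

/-- The Clifford relation between the two couplings to a spin `1/2`. -/
lemma clifford_anticomm (h : IsTriple T₁ T₂ T₃ 1 a b) {x y : Module.End ℂ V}
    (hx : x = (T₁ + T₂).K - dimSq a • 1) (hy : y = (T₁ + T₃).K - dimSq b • 1) :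
    x * y + y * x = (T₁ + T₂ + T₃).K - (cc a + cc b + 1 / 4) • 1 := by
  have h0 := h.coupling_anticomm
  have e1 := h.K_add_eq
  have e2 := h.swap₂₃.K_add_eq
  have e3 : (T₂ + T₃).K =
      (T₂.F * T₃.E + T₂.E * T₃.F + (1 / 2 : ℂ) • (T₂.H * T₃.H)) + (cc a + cc b) • 1 := by
    have h1 : T₂.K = cc a • 1 := by ext v; simpa using congr($(h.cas₂ v))
    have h2 : T₃.K = cc b • 1 := by ext v; simpa using congr($(h.cas₃ v))
    rw [add_smul, ← h1, ← h2]
    simp only [K, add_E, add_F, add_H, pow_two, mul_add, add_mul, ← h.comm₂₃.HH.eq,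
      ← h.comm₂₃.EF.eq]
    module
  have e4 := K_add_add T₁ T₂ T₃
  have g1 : T₁.K = cc 1 • 1 := by ext v; simpa using congr($(h.cas₁ v))
  have g2 : T₂.K = cc a • 1 := by ext v; simpa using congr($(h.cas₂ v))
  have g3 : T₃.K = cc b • 1 := by ext v; simpa using congr($(h.cas₃ v))
  rw [e1, e2, e3, g1, g2, g3] at e4
  set D₂ := T₁.F * T₂.E + T₁.E * T₂.F + (1 / 2 : ℂ) • (T₁.H * T₂.H)
  set D₃ := T₁.F * T₃.E + T₁.E * T₃.F + (1 / 2 : ℂ) • (T₁.H * T₃.H)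
  set D := T₂.F * T₃.E + T₂.E * T₃.F + (1 / 2 : ℂ) • (T₂.H * T₃.H)
  have c1 : cc 1 = 3 / 4 := by unfold cc; norm_num
  -- `dimSq a = cc a + 1/4` and `cc 1 = 3/4`; the shift by `dimSq a` thus leaves the coupling plus
  -- `1/2`.
  have ex : x = D₂ + (1 / 2 : ℂ) • 1 := by
    rw [hx, e1, c1]; unfold cc dimSq; module
  have ey : y = D₃ + (1 / 2 : ℂ) • 1 := by
    rw [hy, e2, c1]; unfold cc dimSq; module
  rw [c1] at e4
  rw [ex, ey]
  simp only [mul_add, add_mul, smul_mul_assoc, mul_smul_comm, mul_one, one_mul]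
  linear_combination (norm := module) h0 + e4

end IsTriple

end Ops

end


/-! ### The abstract algebra: Clifford relation and spanning sets -/

open Polynomial

lemma cas_lt {m n : ℕ} (h : m < n) : cas m < cas n := by
  have : (m : ℚ) < n := by exact_mod_cast h
  have h0 : (0 : ℚ) ≤ m := Nat.cast_nonneg m
  unfold cas
  nlinarith

lemma cas_le {m n : ℕ} (h : m ≤ n) : cas m ≤ cas n := by
  rcases h.lt_or_eq with h | rfl
  · exact (cas_lt h).le
  · rfl

lemma J₂_one {a : ℕ} (ha : 0 < a) : J₂ 1 a = {a + 1, a - 1} := by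
  ext c
  simp only [mem_J₂, Finset.mem_insert, Finset.mem_singleton]
  constructor
  · rintro ⟨k, h1, h2, h3⟩
    omega
  · rintro (h | h)
    · exact ⟨0, by omega, by omega, by omega⟩
    · exact ⟨1, by omega, by omega, by omega⟩

lemma cas_add_one (a : ℕ) : ((cas (a + 1) : ℚ) : ℂ) = dimSq a + (a + 1) / 2 := by
  rw [cas_cast]; unfold cc dimSq; push_cast; ring

lemma cas_sub_one {a : ℕ} (ha : 0 < a) : ((cas (a - 1) : ℚ) : ℂ) = dimSq a - (a + 1) / 2 := by
  obtain ⟨a, rfl⟩ : ∃ c, a = c + 1 := ⟨a - 1, by omega⟩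
  rw [cas_cast]; unfold cc dimSq; push_cast; ring

lemma polyM_eval_ne {M : Finset ℚ} {r : ℚ} (h : r ∉ M) : (polyM M).eval (r : ℂ) ≠ 0 := by
  unfold polyM
  rw [eval_prod, Finset.prod_ne_zero_iff]
  intro m hm
  simp only [eval_sub, eval_X, eval_C, sub_ne_zero]
  intro h1
  have : r = m := by exact_mod_cast h1
  exact h (this ▸ hm)

/-- The value exceeds every element of `M₃`: it pairs the largest total spin with the smaller
intermediate spin, and these two do not occur together. -/
lemma notMem_M₃_of_top {a b n : ℕ} (ha : 0 < a) (hn : n = a + b + 1) :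
    cas n - cas (a - 1) ∉ M₃ 1 a b := by
  rw [mem_M₃]
  rintro ⟨k, hk, l, hl, h⟩
  rw [J₂_one ha, Finset.mem_insert, Finset.mem_singleton] at hk
  obtain ⟨r, h1, h2, h3⟩ := mem_J₂.1 hl
  rcases hk with rfl | rfl
  · have e1 := cas_le (show l ≤ n by omega)
    have e2 := cas_lt (show a - 1 < a + 1 by omega)
    linarith
  · have e1 := cas_lt (show l < n by omega)
    linarith

/-- The value lies below every element of `M₃`: the total spin `n = a - b - 1` can only come from
the intermediate spin `a - 1`. -/
lemma notMem_M₃_of_bottom {a b n : ℕ} (ha : 0 < a) (hn : n + b + 1 = a) :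
    cas n - cas (a + 1) ∉ M₃ 1 a b := by
  rw [mem_M₃]
  rintro ⟨k, hk, l, hl, h⟩
  rw [J₂_one ha, Finset.mem_insert, Finset.mem_singleton] at hk
  obtain ⟨r, h1, h2, h3⟩ := mem_J₂.1 hl
  rcases hk with rfl | rfl
  · have e1 := cas_lt (show n < l by omega)
    linarith
  · have e1 := cas_le (show n ≤ l by omega)
    have e2 := cas_lt (show a - 1 < a + 1 by omega)
    linarith

section

variable {R : Type*} [Ring R] [Algebra ℂ R]

lemma aeval_mul_eigen {D u : R} {c : ℂ} (h : D * u = c • u) (P : ℂ[X]) :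
    aeval D P * u = P.eval c • u := by
  induction P using Polynomial.induction_on' with
  | add p q hp hq => simp [hp, hq, add_smul, add_mul]
  | monomial n a =>
    have : D ^ n * u = c ^ n • u := by
      induction n with
      | zero => simp
      | succ n ih => rw [pow_succ', mul_assoc, ih, mul_smul_comm, h, smul_smul, pow_succ]
    rw [aeval_monomial, ← Algebra.smul_def, smul_mul_assoc, this, eval_monomial, smul_smul]

/-- The two roots are `dimSq a ± (a + 1)/2`, and `((a + 1)/2)²` is again `dimSq a`. -/
lemma sq_of_polyJ {X : R} {a : ℕ} (ha : 0 < a) (h : aeval X (polyJ (J₂ 1 a)) = 0) :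
    (X - dimSq a • (1 : R)) * (X - dimSq a • (1 : R)) = dimSq a • (1 : R) := by
  have hne : a + 1 ≠ a - 1 := by omega
  rw [J₂_one ha, polyJ, Finset.prod_pair hne, cas_add_one, cas_sub_one ha] at h
  simp only [map_mul, map_sub, aeval_X, aeval_C, Algebra.algebraMap_eq_smul_one, mul_sub, sub_mul,
    smul_mul_assoc, mul_smul_comm, one_mul, mul_one] at h ⊢
  have e : dimSq a = ((a : ℂ) + 1) / 2 * (((a : ℂ) + 1) / 2) := by unfold dimSq; ring
  linear_combination (norm := skip) h
  generalize dimSq a = d at *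
  subst e
  module

/-- The relations between the two Casimirs `X`, `Y` that involve the spin `1/2`, and the total
Casimir `C`. -/
structure HalfAlg (a b : ℕ) (X Y C : R) : Prop where
  commX : C * X = X * C
  commY : C * Y = Y * C
  quadX : aeval X (polyJ (J₂ 1 a)) = 0
  quadY : aeval Y (polyJ (J₂ 1 b)) = 0
  quadZ : aeval (C + (cc a + cc 1 + cc b) • (1 : R) - X - Y) (polyJ (J₂ a b)) = 0
  polyX : aeval (C - X) (polyM (M₃ 1 a b)) = 0
  polyY : aeval (C - Y) (polyM (M₃ 1 b a)) = 0
  polyC : aeval C (polyJ (J₃ 1 a b)) = 0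
  brX : Bracket X Y C (cc a) (cc 1) (cc b)
  brY : Bracket Y X C (cc b) (cc 1) (cc a)
  gen : Algebra.adjoin ℂ {X, Y, C} = ⊤

namespace HalfAlg

variable {a b : ℕ} {X Y C : R}

lemma swap (h : HalfAlg a b X Y C) : HalfAlg b a Y X C where
  commX := h.commY
  commY := h.commX
  quadX := h.quadY
  quadY := h.quadX
  quadZ := by
    rw [J₂_comm, ← h.quadZ]
    congr 2
    rw [show cc b + cc 1 + cc a = cc a + cc 1 + cc b by ring]
    abel
  polyX := h.polyY
  polyY := h.polyX
  polyC := by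
    have : J₃ 1 b a = J₃ 1 a b := by
      ext l; simp only [mem_J₃_iff]; omega
    rw [this]; exact h.polyC
  brX := h.brY
  brY := h.brX
  gen := by rw [Set.insert_comm]; exact h.gen

lemma map (h : HalfAlg a b X Y C) {S : Type*} [Ring S] [Algebra ℂ S] (f : R →ₐ[ℂ] S)
    (hf : Function.Surjective f) : HalfAlg a b (f X) (f Y) (f C) where
  commX := by rw [← map_mul, h.commX, map_mul]
  commY := by rw [← map_mul, h.commY, map_mul]
  quadX := by rw [aeval_algHom_apply, h.quadX, map_zero]
  quadY := by rw [aeval_algHom_apply, h.quadY, map_zero]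
  quadZ := by
    rw [← map_one f, ← map_smul, ← map_add, ← map_sub, ← map_sub, aeval_algHom_apply, h.quadZ,
      map_zero]
  polyX := by rw [← map_sub, aeval_algHom_apply, h.polyX, map_zero]
  polyY := by rw [← map_sub, aeval_algHom_apply, h.polyY, map_zero]
  polyC := by rw [aeval_algHom_apply, h.polyC, map_zero]
  brX := by simpa [Bracket] using congr(f $(h.brX))
  brY := by simpa [Bracket] using congr(f $(h.brY))
  gen := by
    have := congr(Subalgebra.map f $(h.gen))
    rw [AlgHom.map_adjoin, Algebra.map_top, (AlgHom.range_eq_top f).2 hf] at this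
    rw [← this]
    congr 1
    simp [Set.image_insert_eq]

/-- Multiplying the factored bracket relation by `x - 1` replaces `x + 1` by the scalar `dimSq a -
1`, which vanishes only at `a = 1`. -/
lemma anticomm_of_ne_one (h : HalfAlg a b X Y C) (ha : 0 < a) (ha1 : a ≠ 1) {x y : R}
    (hx : x = X - dimSq a • (1 : R)) (hy : y = Y - dimSq b • (1 : R)) :
    x * y + y * x = C - (cc a + cc b + 1 / 4) • (1 : R) := by
  have hxx := sq_of_polyJ ha h.quadX
  rw [← hx] at hxx
  have hC : C * x = x * C := by
    rw [hx, mul_sub, sub_mul, h.commX, mul_smul_comm, smul_mul_assoc, mul_one, one_mul]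
  have hXx : X = x + dimSq a • (1 : R) := by rw [hx, sub_add_cancel]
  have hYy : Y = y + dimSq b • (1 : R) := by rw [hy, sub_add_cancel]
  have h1 := h.brX
  rw [hXx, hYy, bracket_iff hxx hC] at h1
  set Q := x * y + y * x - C + (cc a + cc b + 1 / 4) • (1 : R) with hQ
  have h2 : (dimSq a - 1) • Q = 0 := by
    have : (x - 1) * ((x + 1) * Q) = 0 := by rw [h1, mul_zero]
    rw [← mul_assoc] at this
    have e : (x - 1) * (x + 1) = (dimSq a - 1) • (1 : R) := by
      rw [sub_smul, ← hxx, one_smul]; noncomm_ring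
    rwa [e, smul_mul_assoc, one_mul] at this
  have hne : dimSq a - 1 ≠ 0 := by
    have : dimSq a - 1 = ((a : ℂ) - 1) * ((a + 3 : ℕ) : ℂ) / 4 := by
      unfold dimSq; push_cast; ring
    rw [this]
    refine div_ne_zero (mul_ne_zero ?_ (Nat.cast_ne_zero.2 (by omega))) (by norm_num)
    rw [sub_ne_zero]
    exact_mod_cast ha1
  have h3 := (smul_eq_zero.1 h2).resolve_left hne
  rw [hQ] at h3
  linear_combination (norm := module) h3

/-- In the part of the algebra where `C` has eigenvalue `n / 2 (n / 2 + 1)`, membership of a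
candidate value in the joint spectrum forces `X` to be scalar. -/
lemma eigen_of_notMem (h : HalfAlg a b X Y C) (ha : 0 < a) {e x : R} {n : ℕ}
    (hx : x = X - dimSq a • (1 : R)) (hCe : C * e = cc n • e) {t : ℂ} (ht : t * t = dimSq a) {r : ℚ}
    (hr : r ∉ M₃ 1 a b) (hr' : (r : ℂ) = cc n - (dimSq a - t)) : x * e = t • e := by
  have hxx := sq_of_polyJ ha h.quadX
  rw [← hx] at hxx
  have hXx : X = x + dimSq a • (1 : R) := by rw [hx, sub_add_cancel]
  have hC : C * x = x * C := by
    rw [hx, mul_sub, sub_mul, h.commX, mul_smul_comm, smul_mul_assoc, mul_one, one_mul]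
  -- `(x - t) e` is killed by `x + t`, because `x² = t²`. So `C - X` acts on it by the scalar `r`,
  -- which is not a root of its polynomial.
  have hu : (C - X) * (x * e - t • e) = (r : ℂ) • (x * e - t • e) := by
    have e1 : x * (x * e) = dimSq a • e := by rw [← mul_assoc, hxx, smul_mul_assoc, one_mul]
    have e2 : C * (x * e) = cc n • (x * e) := by
      rw [← mul_assoc, hC, mul_assoc, hCe, mul_smul_comm]
    rw [hXx, hr']
    simp only [sub_mul, add_mul, mul_sub, mul_smul_comm, smul_mul_assoc, one_mul, e1, e2, hCe]
    rw [← ht]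
    module
  have h1 := aeval_mul_eigen hu (polyM (M₃ 1 a b))
  rw [h.polyX, zero_mul] at h1
  exact sub_eq_zero.1 ((smul_eq_zero.1 h1.symm).resolve_left (polyM_eval_ne hr))

/-- The eigenvalue ruled out by `notMem_M₃_of_top` is the one of intermediate spin `a - 1`; the
other one remains. -/
lemma eigen_top (h : HalfAlg a b X Y C) (ha : 0 < a) {e x : R} {n : ℕ} (hn : n = a + b + 1)
    (hx : x = X - dimSq a • (1 : R)) (hCe : C * e = cc n • e) :
    x * e = (((a : ℂ) + 1) / 2) • e := by
  refine h.eigen_of_notMem ha hx hCe (by unfold dimSq; ring) (notMem_M₃_of_top ha hn) ?_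
  push_cast
  rw [cas_sub_one ha, cas_cast]

lemma eigen_bottom (h : HalfAlg a b X Y C) (ha : 0 < a) {e x : R} {n : ℕ} (hn : n + b + 1 = a)
    (hx : x = X - dimSq a • (1 : R)) (hCe : C * e = cc n • e) :
    x * e = (-(((a : ℂ) + 1) / 2)) • e := by
  refine h.eigen_of_notMem ha hx hCe (by unfold dimSq; ring) (notMem_M₃_of_bottom ha hn) ?_
  push_cast
  rw [cas_add_one, cas_cast]
  ring

/-- The Clifford relation on the part where `C` has eigenvalue `n / 2 (n / 2 + 1)`. -/
lemma anticomm (h : HalfAlg a b X Y C) (ha : 0 < a) (hb : 0 < b) {e x y : R} {n : ℕ}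
    (hn : n ∈ J₃ 1 a b)
    (hx : x = X - dimSq a • (1 : R)) (hy : y = Y - dimSq b • (1 : R)) (hCe : C * e = cc n • e) :
    (x * y + y * x) * e = (cc n - cc a - cc b - 1 / 4) • e := by
  have fin : x * y + y * x = C - (cc a + cc b + 1 / 4) • (1 : R) →
      (x * y + y * x) * e = (cc n - cc a - cc b - 1 / 4) • e := by
    intro h1
    rw [h1, sub_mul, hCe, smul_mul_assoc, one_mul]
    module
  by_cases ha1 : a = 1
  · by_cases hb1 : b = 1
    · subst ha1 hb1
      have h1 : n = 1 ∨ n = 3 := by rw [mem_J₃_iff] at hn; omega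
      rcases h1 with rfl | rfl
      -- All spins 1/2, total spin 1/2: neither bracket relation determines the anticommutator. On
      -- `e` the third quadratic relation reads `(x + y)² = 1`; with `x² = y² = 1` it gives `xy + yx
      -- = -1`.
      · have hxx := sq_of_polyJ ha h.quadX
        have hyy := sq_of_polyJ ha h.quadY
        have hzz := sq_of_polyJ ha h.quadZ
        rw [← hx] at hxx
        rw [← hy] at hyy
        have d1 : dimSq 1 = 1 := by unfold dimSq; norm_num
        have c1 : cc ((1 : ℕ) : ℂ) = 3 / 4 := by unfold cc; norm_num
        have c1' : cc 1 = 3 / 4 := by unfold cc; norm_num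
        have hC : C * x = x * C := by
          rw [hx, mul_sub, sub_mul, h.commX, mul_smul_comm, smul_mul_assoc, mul_one, one_mul]
        have hC' : C * y = y * C := by
          rw [hy, mul_sub, sub_mul, h.commY, mul_smul_comm, smul_mul_assoc, mul_one, one_mul]
        have hz : C + (cc (1 : ℕ) + cc 1 + cc (1 : ℕ)) • (1 : R) - X - Y - dimSq 1 • (1 : R) =
            (C - (3 / 4 : ℂ) • (1 : R)) - (x + y) := by
          rw [hx, hy, d1, c1, c1']; module
        rw [hz] at hzz
        rw [d1, one_smul] at hxx hyy hzz
        rw [c1] at hCe ⊢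
        have k1 : (C - (3 / 4 : ℂ) • (1 : R)) * e = 0 := by
          rw [sub_mul, hCe, smul_mul_assoc, one_mul, sub_self]
        have k2 : (C - (3 / 4 : ℂ) • (1 : R)) * (x + y) =
            (x + y) * (C - (3 / 4 : ℂ) • (1 : R)) := by
          simp only [sub_mul, mul_sub, mul_add, add_mul, hC, hC', smul_mul_assoc, mul_smul_comm,
            one_mul, mul_one]
          module
        set D := C - (3 / 4 : ℂ) • (1 : R)
        have k3 := congr($hzz * e)
        have k4 : (D - (x + y)) * (D - (x + y)) = (D - (x + y)) * D - (x + y) * D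
            + (x + y) * (x + y) := by
          rw [mul_sub, sub_mul _ _ (x + y), k2]; abel
        rw [k4, add_mul, sub_mul, mul_assoc, k1, mul_assoc (x + y), k1, mul_zero, mul_zero,
          sub_zero, zero_add] at k3
        have k5 : (x + y) * (x + y) = x * x + y * y + (x * y + y * x) := by noncomm_ring
        rw [k5, hxx, hyy, add_mul, one_mul] at k3
        rw [add_mul, one_mul] at k3
        linear_combination (norm := module) k3
      -- Total spin 3/2 is extremal for both pairs, so `x` and `y` act as scalars.
      · have e1 := h.eigen_top ha (e := e) (by norm_num) hx hCe
        have e2 := h.swap.eigen_top ha (e := e) (by norm_num) hy hCe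
        rw [add_mul, mul_assoc, mul_assoc, e1, e2, mul_smul_comm, mul_smul_comm, e1, e2]
        have c1 : cc ((1 : ℕ) : ℂ) = 3 / 4 := by unfold cc; norm_num
        have c3 : cc ((3 : ℕ) : ℂ) = 15 / 4 := by unfold cc; norm_num
        rw [c1, c3]
        push_cast
        module
    · refine fin ?_
      rw [add_comm, h.swap.anticomm_of_ne_one hb hb1 hy hx, add_comm (cc b)]
  · exact fin (h.anticomm_of_ne_one ha ha1 hx hy)

/-- At an extremal spin, `X` and `Y` are scalar. -/
lemma extremal (h : HalfAlg a b X Y C) (ha : 0 < a) (hb : 0 < b) {e x y : R} {n : ℕ}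
    (hn : n ∈ J₃ 1 a b) (hn' : n = a + b + 1 ∨ n + b + 1 = a ∨ n + a + 1 = b)
    (hx : x = X - dimSq a • (1 : R)) (hy : y = Y - dimSq b • (1 : R)) (hCe : C * e = cc n • e)
    (hxe : x * e = e * x) (hye : y * e = e * y) :
    (∃ p : ℕ, X * e = cc p • e ∨ Y * e = cc p • e) ∧ ∃ s t : ℂ, x * e = s • e ∧ y * e = t • e := by
  have hXx : X = x + dimSq a • (1 : R) := by rw [hx, sub_add_cancel]
  have hYy : Y = y + dimSq b • (1 : R) := by rw [hy, sub_add_cancel]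
  have hQ := h.anticomm ha hb hn hx hy hCe
  -- Once one generator acts on `e` as a nonzero scalar `t`, the Clifford relation says that `2 t`
  -- times the other is `q`.
  have other : ∀ {u v : R} {t q : ℂ}, t ≠ 0 → u * e = t • e → (u * v + v * u) * e = q • e →
      v * e = e * v → v * e = (q / (2 * t)) • e := by
    intro u v t q ht h1 h2 h3
    have h4 : (2 * t) • (v * e) = q • e := by
      rw [← h2, add_mul, mul_assoc, h3, ← mul_assoc, h1, mul_assoc, h1, mul_smul_comm,
        smul_mul_assoc, h3]
      module
    rw [div_eq_inv_mul, mul_smul, ← h4, smul_smul, inv_mul_cancel₀ (by simpa using ht), one_smul]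
  have hne : ∀ c : ℕ, -(((c : ℂ) + 1) / 2) ≠ 0 := fun c => by
    have : (c : ℂ) + 1 ≠ 0 := by exact_mod_cast Nat.succ_ne_zero c
    simpa using this
  rcases hn' with hn' | hn' | hn'
  · have e1 := h.eigen_top ha hn' hx hCe
    have e2 := h.swap.eigen_top hb (by omega) hy hCe
    refine ⟨⟨a + 1, Or.inl ?_⟩, _, _, e1, e2⟩
    rw [hXx, add_mul, e1, smul_mul_assoc, one_mul, ← cas_cast, cas_add_one]
    module
  · have e1 := h.eigen_bottom ha hn' hx hCe
    refine ⟨⟨a - 1, Or.inl ?_⟩, _, _, e1, other (hne a) e1 hQ hye⟩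
    rw [hXx, add_mul, e1, smul_mul_assoc, one_mul, ← cas_cast, cas_sub_one ha]
    module
  · have e1 := h.swap.eigen_bottom hb hn' hy hCe
    rw [add_comm] at hQ
    refine ⟨⟨b - 1, Or.inr ?_⟩, _, _, other (hne b) e1 hQ hxe, e1⟩
    rw [hYy, add_mul, e1, smul_mul_assoc, one_mul, ← cas_cast, cas_sub_one hb]
    module

/-- The part of the algebra where `C` has eigenvalue `n / 2 (n / 2 + 1)` is spanned by four
elements. -/
lemma exists_four (h : HalfAlg a b X Y C) (ha : 0 < a) (hb : 0 < b) {e x y : R} {n : ℕ}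
    (hn : n ∈ J₃ 1 a b)
    (hx : x = X - dimSq a • (1 : R)) (hy : y = Y - dimSq b • (1 : R)) (hCe : C * e = cc n • e)
    (hye : y * e = e * y) (r : R) :
    ∃ α β γ δ : ℂ, r * e = (α • (1 : R) + β • x + γ • y + δ • (x * y)) * e := by
  have hXx : X = x + dimSq a • (1 : R) := by rw [hx, sub_add_cancel]
  have hYy : Y = y + dimSq b • (1 : R) := by rw [hy, sub_add_cancel]
  have hQ := h.anticomm ha hb hn hx hy hCe
  have hxx := sq_of_polyJ ha h.quadX
  have hyy := sq_of_polyJ hb h.quadY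
  rw [← hx] at hxx
  rw [← hy] at hyy
  have hC : C * x = x * C := by
    rw [hx, mul_sub, sub_mul, h.commX, mul_smul_comm, smul_mul_assoc, mul_one, one_mul]
  have hC' : C * y = y * C := by
    rw [hy, mul_sub, sub_mul, h.commY, mul_smul_comm, smul_mul_assoc, mul_one, one_mul]
  set q := cc n - cc a - cc b - 1 / 4
  have hyxe : y * x * e = q • e - x * y * e := by
    rw [← hQ, add_mul]; abel
  have hyxye : y * x * y * e = q • (y * e) - dimSq b • (x * e) := by
    rw [mul_assoc _ y e, hye, ← mul_assoc, hyxe, sub_mul, smul_mul_assoc, mul_assoc (x * y), ← hye,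
      ← mul_assoc, mul_assoc x y y, hyy, mul_smul_comm, mul_one, smul_mul_assoc]
  -- The span of `e, x e, y e, xy e` is shown to be stable under left multiplication by the
  -- generators, so it contains all of `R e`.
  let P : R → Prop := fun w => ∃ α β γ δ : ℂ, w = (α • (1 : R) + β • x + γ • y + δ • (x * y)) * e
  have hPx : ∀ w, P w → P (x * w) := by
    rintro _ ⟨α, β, γ, δ, rfl⟩
    refine ⟨dimSq a * β, α, dimSq a * δ, γ, ?_⟩
    simp only [add_mul, mul_add, smul_mul_assoc, mul_smul_comm, one_mul, ← mul_assoc, hxx]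
    module
  -- Reordering `y x` and `y x y` by the Clifford relation gives the four coefficients.
  have hPy : ∀ w, P w → P (y * w) := by
    rintro _ ⟨α, β, γ, δ, rfl⟩
    refine ⟨q * β + dimSq b * γ, -dimSq b * δ, α + q * δ, -β, ?_⟩
    simp only [add_mul, mul_add, smul_mul_assoc, mul_smul_comm, one_mul, ← mul_assoc, hyy, hyxye,
      hyxe]
    module
  have hPs : ∀ (c : ℂ) w, P w → P (c • w) := by
    rintro c _ ⟨α, β, γ, δ, rfl⟩
    refine ⟨c * α, c * β, c * γ, c * δ, ?_⟩
    simp only [add_mul, smul_mul_assoc, one_mul]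
    module
  have hPa : ∀ w w', P w → P w' → P (w + w') := by
    rintro _ _ ⟨α, β, γ, δ, rfl⟩ ⟨α', β', γ', δ', rfl⟩
    refine ⟨α + α', β + β', γ + γ', δ + δ', ?_⟩
    simp only [add_mul, smul_mul_assoc, one_mul]
    module
  have hPC : ∀ w, P w → P (C * w) := by
    rintro _ ⟨α, β, γ, δ, rfl⟩
    refine ⟨cc n * α, cc n * β, cc n * γ, cc n * δ, ?_⟩
    have k1 : C * x * e = cc n • (x * e) := by rw [hC, mul_assoc, hCe, mul_smul_comm]
    have k2 : C * y * e = cc n • (y * e) := by rw [hC', mul_assoc, hCe, mul_smul_comm]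
    have k3 : C * x * y * e = cc n • (x * y * e) := by
      rw [hC, mul_assoc x, hC', mul_assoc, mul_assoc, hCe, mul_smul_comm, mul_smul_comm, mul_assoc]
    simp only [add_mul, mul_add, smul_mul_assoc, mul_smul_comm, one_mul, ← mul_assoc, hCe, k1, k2,
      k3]
    module
  have key : ∀ r : R, ∀ w, P w → P (r * w) := by
    intro r
    have hr : r ∈ Algebra.adjoin ℂ {X, Y, C} := by rw [h.gen]; trivial
    induction hr using Algebra.adjoin_induction with
    | mem r hr =>
      intro w hw
      simp only [Set.mem_insert_iff, Set.mem_singleton_iff] at hr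
      rcases hr with rfl | rfl | rfl
      · rw [hXx, add_mul, smul_mul_assoc, one_mul]
        exact hPa _ _ (hPx w hw) (hPs _ _ hw)
      · rw [hYy, add_mul, smul_mul_assoc, one_mul]
        exact hPa _ _ (hPy w hw) (hPs _ _ hw)
      · exact hPC w hw
    | algebraMap c =>
      intro w hw
      rw [← Algebra.smul_def]
      exact hPs c w hw
    | add r r' _ _ h1 h2 =>
      intro w hw
      rw [add_mul]
      exact hPa _ _ (h1 w hw) (h2 w hw)
    | mul r r' _ _ h1 h2 =>
      intro w hw
      rw [mul_assoc]
      exact h1 _ (h2 w hw)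
  exact key r e ⟨1, 0, 0, 0, by simp⟩

/-- At an extremal spin a single element spans. -/
lemma exists_one (h : HalfAlg a b X Y C) (ha : 0 < a) (hb : 0 < b) {e x y : R} {n : ℕ}
    (hn : n ∈ J₃ 1 a b) (hn' : n = a + b + 1 ∨ n + b + 1 = a ∨ n + a + 1 = b)
    (hx : x = X - dimSq a • (1 : R)) (hy : y = Y - dimSq b • (1 : R)) (hCe : C * e = cc n • e)
    (hxe : x * e = e * x) (hye : y * e = e * y) (r : R) :
    ∃ α : ℂ, r * e = α • e := by
  obtain ⟨-, s, t, hs, ht⟩ := h.extremal ha hb hn hn' hx hy hCe hxe hye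
  obtain ⟨α, β, γ, δ, hr⟩ := h.exists_four ha hb hn hx hy hCe hye r
  refine ⟨α + β * s + γ * t + δ * (t * s), ?_⟩
  rw [hr]
  simp only [add_mul, smul_mul_assoc, one_mul, mul_assoc, ht, mul_smul_comm, hs]
  module

/-- When `C` is scalar on the whole algebra, `exists_four` applies with `e = 1`. -/
lemma rank_le_four (h : HalfAlg a b X Y C) (ha : 0 < a) (hb : 0 < b) {n : ℕ} (hn : n ∈ J₃ 1 a b)
    (hC : C = cc n • (1 : R)) : Module.rank ℂ R ≤ 4 := by
  let f : Fin 4 → R := ![1, X - dimSq a • (1 : R), Y - dimSq b • (1 : R),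
    (X - dimSq a • (1 : R)) * (Y - dimSq b • (1 : R))]
  have htop : Submodule.span ℂ (Set.range f) = ⊤ := by
    rw [eq_top_iff]
    intro r _
    obtain ⟨α, β, γ, δ, hr⟩ := h.exists_four ha hb hn rfl rfl (e := 1) (by rw [hC, mul_one])
      (by simp) r
    rw [mul_one, mul_one] at hr
    have hm : ∀ i, f i ∈ Submodule.span ℂ (Set.range f) := fun i =>
      Submodule.subset_span ⟨i, rfl⟩
    rw [hr]
    exact Submodule.add_mem _ (Submodule.add_mem _ (Submodule.add_mem _
      (Submodule.smul_mem _ _ (hm 0)) (Submodule.smul_mem _ _ (hm 1)))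
      (Submodule.smul_mem _ _ (hm 2))) (Submodule.smul_mem _ _ (hm 3))
  rw [← rank_top ℂ R, ← htop]
  refine (rank_span_le _).trans ?_
  have := Cardinal.mk_range_le_lift (f := f)
  simpa using this

lemma rank_le_one (h : HalfAlg a b X Y C) (ha : 0 < a) (hb : 0 < b) {n : ℕ} (hn : n ∈ J₃ 1 a b)
    (hn' : n = a + b + 1 ∨ n + b + 1 = a ∨ n + a + 1 = b)
    (hC : C = cc n • (1 : R)) : Module.rank ℂ R ≤ 1 := by
  refine _root_.rank_le_one 1 fun r => ?_
  obtain ⟨α, hr⟩ := h.exists_one ha hb hn hn' rfl rfl (e := 1) (by rw [hC, mul_one])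
    (by simp) (by simp) r
  exact ⟨α, by rw [← hr, mul_one]⟩

end HalfAlg

end


/-! ### Faithfulness and surjectivity of the action -/

open Polynomial

/-- A nondegenerate rank two Clifford algebra acts faithfully. -/
lemma clifford_independent {S : Type*} [Ring S] [Algebra ℂ S] [Nontrivial S] {x y : S} {m n q : ℂ}
    (hx : x * x = m • (1 : S)) (hy : y * y = n • (1 : S)) (hxy : x * y + y * x = q • (1 : S))
    (hm : m ≠ 0) (hq : q ^ 2 ≠ 4 * (m * n)) {α β γ δ : ℂ}
    (h : α • (1 : S) + β • x + γ • y + δ • (x * y) = 0) : α = 0 ∧ β = 0 ∧ γ = 0 ∧ δ = 0 := by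
  have hne : (1 : S) ≠ 0 := one_ne_zero
  have hyx : y * x = q • (1 : S) - x * y := by rw [← hxy]; abel
  have hxxy : x * x * y = m • y := by rw [hx, smul_mul_assoc, one_mul]
  have hxyx : x * y * x = q • x - m • y := by
    rw [mul_assoc, hyx, mul_sub, ← mul_assoc, hxxy, mul_smul_comm, mul_one]
  have hyxy : y * x * y = q • y - n • x := by
    rw [hyx, sub_mul, mul_assoc, hy, smul_mul_assoc, one_mul, mul_smul_comm, mul_one]
  -- conjugation by `x`
  have e1 : x * (α • (1 : S) + β • x + γ • y + δ • (x * y)) * x =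
      (m * α) • (1 : S) + (β * m) • x + γ • (q • x - m • y)
        + (δ * m) • (q • (1 : S) - x * y) := by
    simp only [mul_add, add_mul, mul_smul_comm, smul_mul_assoc, mul_one, ← mul_assoc, hx, hxyx,
      one_mul, hyx]
    module
  rw [h, mul_zero, zero_mul] at e1
  -- even and odd parts
  have e2 : (2 * m * α + m * q * δ) • (1 : S) + (2 * m * β + q * γ) • x = 0 := by
    linear_combination (norm := module) m • h - e1
  have e3 : (q ^ 2 - 4 * (m * n)) ≠ 0 := sub_ne_zero.2 hq
  have sc : ∀ {c : ℂ}, c • (1 : S) = 0 → c = 0 := fun hc =>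
    (smul_eq_zero.1 hc).resolve_right hne
  -- commuting `s + t x = 0` with `y`
  have lin : ∀ {s t : ℂ}, s • (1 : S) + t • x = 0 → s = 0 ∧ t = 0 := by
    intro s t hst
    have f1 : y * (s • (1 : S) + t • x) + (s • (1 : S) + t • x) * y =
        (2 * s) • y + (t * q) • (1 : S) := by
      simp only [mul_add, add_mul, mul_smul_comm, smul_mul_assoc, mul_one, one_mul, hyx]
      module
    rw [hst, mul_zero, zero_mul, add_zero] at f1
    have f2 : x * (s • (1 : S) + t • x) = s • x + (t * m) • (1 : S) := by
      simp only [mul_add, mul_smul_comm, mul_one, hx]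
      module
    rw [hst, mul_zero] at f2
    have f3 : (s ^ 2 - t ^ 2 * m) • (1 : S) = 0 := by
      linear_combination (norm := module) s • hst + t • f2
    have f3 := sc f3
    have f4 : y * ((2 * s) • y + (t * q) • (1 : S)) = (2 * s * n) • (1 : S) + (t * q) • y := by
      simp only [mul_add, mul_smul_comm, mul_one, hy]
      module
    rw [← f1, mul_zero] at f4
    have f5 : (4 * s ^ 2 * n - t ^ 2 * q ^ 2) • (1 : S) = 0 := by
      linear_combination (norm := module) (-2 * s) • f4 + (t * q) • f1
    have f5 := sc f5
    have f6 : t ^ 2 * (q ^ 2 - 4 * (m * n)) = 0 := by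
      linear_combination (-1 : ℂ) * f5 + (4 * n) * f3
    have ht : t = 0 := by
      rcases mul_eq_zero.1 f6 with h | h
      · exact pow_eq_zero_iff (two_ne_zero) |>.1 h
      · exact absurd h e3
    subst ht
    refine ⟨?_, rfl⟩
    have : s ^ 2 = 0 := by linear_combination f3
    exact pow_eq_zero_iff (two_ne_zero) |>.1 this
  obtain ⟨g1, g2⟩ := lin e2
  have g3 : α = -(q * δ / 2) := by
    have : m * (2 * α + q * δ) = 0 := by linear_combination g1
    have := (mul_eq_zero.1 this).resolve_left hm
    linear_combination this / 2
  -- The relation, multiplied by `2 m`, factors through `w = (2m) y - q x`, the part of `y` that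
  -- anticommutes with `x`. Its square is a scalar, nonzero by the discriminant condition, so `w`
  -- can be cancelled.
  have g4 : (γ • (1 : S) + δ • x) * ((2 * m) • y - q • x) = 0 := by
    have : (γ • (1 : S) + δ • x) * ((2 * m) • y - q • x) =
        (2 * m) • (γ • y + δ • (x * y)) - (γ * q) • x - (δ * q * m) • (1 : S) := by
      simp only [mul_sub, add_mul, mul_smul_comm, smul_mul_assoc, one_mul, hx]
      module
    rw [this]
    have g5 : (q * γ) • x = (-(2 * m * β)) • x := by congr 1; linear_combination g2
    subst g3
    linear_combination (norm := module) (2 * m) • h - g5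
  have g6 : ((2 * m) • y - q • x) * ((2 * m) • y - q • x) =
      (-(m * (q ^ 2 - 4 * (m * n)))) • (1 : S) := by
    simp only [mul_sub, sub_mul, mul_smul_comm, smul_mul_assoc, hx, hy, hyx]
    module
  have g7 : (-(m * (q ^ 2 - 4 * (m * n)))) • (γ • (1 : S) + δ • x) = 0 := by
    have := congr($g4 * ((2 * m) • y - q • x))
    rwa [mul_assoc, g6, zero_mul, mul_smul_comm, mul_one] at this
  obtain ⟨rfl, rfl⟩ := lin ((smul_eq_zero.1 g7).resolve_left (neg_ne_zero.2 (mul_ne_zero hm e3)))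
  refine ⟨by rw [g3]; ring, ?_, rfl, rfl⟩
  have : m * β = 0 := by linear_combination g2 / 2
  exact (mul_eq_zero.1 this).resolve_left hm

section

variable {V : Type*} [AddCommGroup V] [Module ℂ V]

open Ops

/-- The situation of the main theorem: an algebra with the relations of the Racah algebra, acting
on a triple tensor product with one factor of spin `1/2`. -/
structure Setup (a b : ℕ) (T₁ T₂ T₃ : Ops V) {R : Type*} [Ring R] [Algebra ℂ R] (X Y C : R)
    (Φ : R →ₐ[ℂ] Module.End ℂ V) : Prop where
  ha : 0 < a
  hb : 0 < b
  triple : IsTriple T₁ T₂ T₃ 1 a b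
  alg : HalfAlg a b X Y C
  mapX : Φ X = (T₁ + T₂).K
  mapY : Φ Y = (T₁ + T₃).K
  mapC : Φ C = (T₁ + T₂ + T₃).K

namespace Setup

variable {a b : ℕ} {T₁ T₂ T₃ : Ops V} {R : Type*} [Ring R] [Algebra ℂ R] {X Y C : R}
  {Φ : R →ₐ[ℂ] Module.End ℂ V}

lemma central (h : Setup a b T₁ T₂ T₃ X Y C Φ) (r : R) : (T₁ + T₂ + T₃).Central (Φ r) := by
  have hr : r ∈ Algebra.adjoin ℂ {X, Y, C} := by rw [h.alg.gen]; trivial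
  induction hr using Algebra.adjoin_induction with
  | mem r hr =>
    simp only [Set.mem_insert_iff, Set.mem_singleton_iff] at hr
    rcases hr with rfl | rfl | rfl
    · rw [h.mapX]; exact h.triple.central_K₁₂
    · rw [h.mapY]
      have := h.triple.swap₂₃.central_K₁₂
      rwa [add_assoc', add_comm' T₃, ← add_assoc'] at this
    · rw [h.mapC]; exact h.triple.rep₁₂₃.central_K
  | algebraMap c =>
    rw [AlgHom.commutes]
    exact ⟨Algebra.commute_algebraMap_left _ _, Algebra.commute_algebraMap_left _ _,
      Algebra.commute_algebraMap_left _ _⟩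
  | add r r' _ _ h1 h2 =>
    rw [map_add]
    exact ⟨h1.E.add_left h2.E, h1.F.add_left h2.F, h1.H.add_left h2.H⟩
  | mul r r' _ _ h1 h2 =>
    rw [map_mul]
    exact ⟨h1.E.mul_left h2.E, h1.F.mul_left h2.F, h1.H.mul_left h2.H⟩

/-- The spectral idempotents of `C`. -/
lemma exists_idempotents (h : Setup a b T₁ T₂ T₃ X Y C Φ) : ∃ e : ℕ → R,
    (∑ n ∈ J₃ 1 a b, e n = 1) ∧ (∀ n ∈ J₃ 1 a b, C * e n = cc n • e n) ∧
    (∀ n, X * e n = e n * X ∧ Y * e n = e n * Y) ∧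
    ∀ n ∈ J₃ 1 a b, ∀ k ∈ J₃ 1 a b, ∀ v ∈ (T₁ + T₂ + T₃).hw k,
      Φ (e n) v = if n = k then v else 0 := by
  obtain ⟨p, hp, hp', hp''⟩ := exists_lagrange (J₃_nonempty 1 a b)
  refine ⟨fun n => aeval C (p n), ?_, fun n hn => ?_, fun n => ⟨?_, ?_⟩, fun n hn k hk v hv => ?_⟩
  · rw [← map_sum, hp, map_one]
  · obtain ⟨q, hq⟩ := hp' n hn
    have := congr(aeval C $hq)
    rw [map_mul, map_mul, h.alg.polyC, zero_mul, map_sub, aeval_X, aeval_C, sub_mul, sub_eq_zero,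
      ← Algebra.smul_def, cas_cast] at this
    exact this
  · exact (commute_aeval h.alg.commX (p n)).eq.symm
  · exact (commute_aeval h.alg.commY (p n)).eq.symm
  · rw [← aeval_algHom_apply, h.mapC, aeval_apply_eigen (mem_hw.1 hv).1, ← cas_cast,
      hp'' n hn k hk]
    split_ifs <;> simp

/-- The action on the multiplicity space of `[n]`. -/
def onHw (h : Setup a b T₁ T₂ T₃ X Y C Φ) (n : ℕ) :
    R →ₐ[ℂ] Module.End ℂ ((T₁ + T₂ + T₃).hw n) :=
  AlgHom.ofLinearMap
    { toFun := fun r => (Φ r).restrict fun _ hv => (h.central r).map_hw hv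
      map_add' := fun r r' => by ext v; simp
      map_smul' := fun c r => by ext v; simp }
    (by ext v; simp) (fun r r' => by ext v; simp)

lemma onHw_apply (h : Setup a b T₁ T₂ T₃ X Y C Φ) (n : ℕ) (r : R) (v : (T₁ + T₂ + T₃).hw n) :
    (h.onHw n r v : V) = Φ r v := rfl

lemma onHw_eq_one (h : Setup a b T₁ T₂ T₃ X Y C Φ) {n : ℕ} {r : R}
    (hr : ∀ v ∈ (T₁ + T₂ + T₃).hw n, Φ r v = v) : h.onHw n r = 1 := by
  ext v
  exact hr v v.2

lemma nontrivial_hw (h : Setup a b T₁ T₂ T₃ X Y C Φ) {n : ℕ} (hn : n ∈ J₃ 1 a b) :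
    Nontrivial ((T₁ + T₂ + T₃).hw n) := by
  obtain ⟨v, hv, hv0⟩ := h.triple.exists_hw hn
  exact ⟨⟨⟨v, hv⟩, 0, fun h => hv0 congr(($h : V))⟩⟩

/-- The discriminant factors, as in Heron's formula, into linear terms in `n, a, b`; their possible
zeros are the three extremal cases. -/
lemma nondegenerate {n : ℕ} (hn : ¬(n = a + b + 1 ∨ n + b + 1 = a ∨ n + a + 1 = b)) :
    (cc n - cc a - cc b - 1 / 4) ^ 2 ≠ 4 * (dimSq a * dimSq b) := by
  push Not at hn
  obtain ⟨h1, h2, h3⟩ := hn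
  rw [← sub_ne_zero]
  have e : (cc n - cc a - cc b - 1 / 4) ^ 2 - 4 * (dimSq a * dimSq b) =
      ((n : ℂ) - (a + b + 1 : ℕ)) * ((n + a + b + 3 : ℕ) : ℂ) * (((n + b + 1 : ℕ) : ℂ) - a) *
        (((n + a + 1 : ℕ) : ℂ) - b) / 16 := by
    unfold cc dimSq; push_cast; ring
  rw [e]
  refine div_ne_zero (mul_ne_zero (mul_ne_zero (mul_ne_zero ?_ ?_) ?_) ?_) (by norm_num)
  · rw [sub_ne_zero]; exact_mod_cast h1
  · exact Nat.cast_ne_zero.2 (by omega)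
  · rw [sub_ne_zero]; exact_mod_cast h2
  · rw [sub_ne_zero]; exact_mod_cast h3

/-- Away from the extremal spins, the multiplicity space carries a faithful action of a
nondegenerate Clifford algebra. -/
lemma independent (h : Setup a b T₁ T₂ T₃ X Y C Φ) {n : ℕ} (hn : n ∈ J₃ 1 a b)
    (hn' : ¬(n = a + b + 1 ∨ n + b + 1 = a ∨ n + a + 1 = b)) {x y : R}
    (hx : x = X - dimSq a • (1 : R)) (hy : y = Y - dimSq b • (1 : R)) {α β γ δ : ℂ}
    (h0 : h.onHw n (α • (1 : R) + β • x + γ • y + δ • (x * y)) = 0) :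
    α = 0 ∧ β = 0 ∧ γ = 0 ∧ δ = 0 := by
  obtain ⟨e, -, he, -, he'⟩ := h.exists_idempotents
  have := h.nontrivial_hw hn
  have hxx := sq_of_polyJ h.ha h.alg.quadX
  have hyy := sq_of_polyJ h.hb h.alg.quadY
  have hQ := h.alg.anticomm h.ha h.hb hn hx hy (he n hn)
  have h1 : h.onHw n (e n) = 1 := h.onHw_eq_one fun v hv => by rw [he' n hn n hn v hv, if_pos rfl]
  have hQ := congr(h.onHw n $hQ)
  rw [map_mul, h1, mul_one, map_smul, h1] at hQ
  have hxx := congr(h.onHw n $hxx)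
  have hyy := congr(h.onHw n $hyy)
  rw [← hx] at hxx
  rw [← hy] at hyy
  simp only [map_mul, map_add, map_smul, map_one] at hxx hyy hQ h0
  have hm : dimSq a ≠ 0 := by
    have : (a : ℂ) + 1 ≠ 0 := by exact_mod_cast Nat.succ_ne_zero a
    exact div_ne_zero (pow_ne_zero 2 this) (by norm_num)
  exact clifford_independent hxx hyy hQ hm (nondegenerate hn') h0

/-- It suffices to treat each `r * e n`. This is a combination of four elements (one at an extremal
spin) times `e n`, and `e n` acts as the identity on the highest weight vectors of spin `n / 2`,
where the combination must vanish. -/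
lemma injective (h : Setup a b T₁ T₂ T₃ X Y C Φ) : Function.Injective Φ := by
  rw [injective_iff_map_eq_zero]
  intro r hr
  obtain ⟨e, he1, he, hXe, he'⟩ := h.exists_idempotents
  suffices ∀ n ∈ J₃ 1 a b, r * e n = 0 by
    rw [← mul_one r, ← he1, Finset.mul_sum]
    exact Finset.sum_eq_zero this
  intro n hn
  have hxe : (X - dimSq a • (1 : R)) * e n = e n * (X - dimSq a • (1 : R)) := by
    simp only [sub_mul, mul_sub, (hXe n).1, smul_mul_assoc, mul_smul_comm, one_mul, mul_one]
  have hye : (Y - dimSq b • (1 : R)) * e n = e n * (Y - dimSq b • (1 : R)) := by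
    simp only [sub_mul, mul_sub, (hXe n).2, smul_mul_assoc, mul_smul_comm, one_mul, mul_one]
  have h1 : h.onHw n (e n) = 1 := h.onHw_eq_one fun v hv => by rw [he' n hn n hn v hv, if_pos rfl]
  have h2 : h.onHw n (r * e n) = 0 := by
    ext v
    rw [onHw_apply, map_mul, hr, zero_mul]
    rfl
  by_cases hn' : n = a + b + 1 ∨ n + b + 1 = a ∨ n + a + 1 = b
  · obtain ⟨α, hα⟩ := h.alg.exists_one h.ha h.hb hn hn' rfl rfl (he n hn) hxe hye r
    have := h.nontrivial_hw hn
    rw [hα, map_smul, h1] at h2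
    rw [hα, (smul_eq_zero.1 h2).resolve_right one_ne_zero, zero_smul]
  · obtain ⟨α, β, γ, δ, hα⟩ := h.alg.exists_four h.ha h.hb hn rfl rfl (he n hn) hye r
    rw [hα, map_mul, h1, mul_one] at h2
    obtain ⟨rfl, rfl, rfl, rfl⟩ := h.independent hn hn' rfl rfl h2
    rw [hα]
    simp

/-- On each multiplicity space, the algebra acts by all operators. -/
lemma onHw_surjective (h : Setup a b T₁ T₂ T₃ X Y C Φ) {n : ℕ} (hn : n ∈ J₃ 1 a b) :
    Function.Surjective (h.onHw n) := by
  have hfin := h.triple.finrank_hw_le n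
  have := hfin.1
  have := h.nontrivial_hw hn
  by_cases hn' : n = a + b + 1 ∨ n + b + 1 = a ∨ n + a + 1 = b
  · obtain ⟨e, he1, he, hXe, he'⟩ := h.exists_idempotents
    have hxe : (X - dimSq a • (1 : R)) * e n = e n * (X - dimSq a • (1 : R)) := by
      simp only [sub_mul, mul_sub, (hXe n).1, smul_mul_assoc, mul_smul_comm, one_mul, mul_one]
    have hye : (Y - dimSq b • (1 : R)) * e n = e n * (Y - dimSq b • (1 : R)) := by
      simp only [sub_mul, mul_sub, (hXe n).2, smul_mul_assoc, mul_smul_comm, one_mul, mul_one]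
    obtain ⟨⟨p, hp⟩, -⟩ := h.alg.extremal h.ha h.hb hn hn' rfl rfl (he n hn) hxe hye
    have hev : ∀ v ∈ (T₁ + T₂ + T₃).hw n, Φ (e n) v = v := fun v hv => by
      rw [he' n hn n hn v hv, if_pos rfl]
    -- At an extremal spin the relations force one of the two pair Casimirs to a single eigenvalue,
    -- whose joint eigenspace with the total Casimir is at most a line.
    have hline : ∃ u, ∀ v ∈ (T₁ + T₂ + T₃).hw n, ∃ c : ℂ, v = c • u := by
      rcases hp with hp | hp
      · obtain ⟨u, hu⟩ := h.triple.hw_eigen_le p n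
        refine ⟨u, fun v hv => hu v hv ?_⟩
        have := congr(Φ $hp v)
        rwa [map_mul, Module.End.mul_apply, map_smul, LinearMap.smul_apply, hev v hv, h.mapX]
          at this
      · obtain ⟨u, hu⟩ := h.triple.swap₂₃.hw_eigen_le p n
        rw [add_assoc', add_comm' T₃, ← add_assoc'] at hu
        refine ⟨u, fun v hv => hu v hv ?_⟩
        have := congr(Φ $hp v)
        rwa [map_mul, Module.End.mul_apply, map_smul, LinearMap.smul_apply, hev v hv, h.mapY]
          at this
    obtain ⟨u, hu⟩ := hline
    obtain ⟨v₀, hv₀⟩ := exists_ne (0 : (T₁ + T₂ + T₃).hw n)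
    obtain ⟨c, hc⟩ := hu v₀ v₀.2
    have hc0 : c ≠ 0 := by
      rintro rfl
      exact hv₀ (Subtype.ext (by rw [hc, zero_smul]; rfl))
    have hall : ∀ v : (T₁ + T₂ + T₃).hw n, ∃ d : ℂ, v = d • v₀ := by
      intro v
      obtain ⟨d, hd⟩ := hu v v.2
      refine ⟨d / c, Subtype.ext ?_⟩
      rw [Submodule.coe_smul, hc, smul_smul, div_mul_cancel₀ _ hc0, hd]
    intro M
    obtain ⟨t, ht⟩ := hall (M v₀)
    refine ⟨t • 1, ?_⟩
    rw [map_smul, map_one]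
    refine LinearMap.ext fun v => ?_
    obtain ⟨d, rfl⟩ := hall v
    rw [map_smul, map_smul, ht]
    rfl
  · set x := X - dimSq a • (1 : R) with hx
    set y := Y - dimSq b • (1 : R) with hy
    let f : Fin 4 → Module.End ℂ ((T₁ + T₂ + T₃).hw n) :=
      fun i => h.onHw n ((![1, x, y, x * y] : Fin 4 → R) i)
    have hf : LinearIndependent ℂ f := by
      rw [Fintype.linearIndependent_iff]
      intro g hg
      have h0 : h.onHw n (g 0 • (1 : R) + g 1 • x + g 2 • y + g 3 • (x * y)) = 0 := by
        rw [← hg, Fin.sum_univ_four]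
        simp [f]
      obtain ⟨h1, h2, h3, h4⟩ := h.independent hn hn' hx hy h0
      intro i
      fin_cases i <;> assumption
    have hcard : (J₂ 1 a).card ≤ 2 := by
      rw [J₂_one h.ha]
      exact Finset.card_le_two
    -- There are at most two intermediate spins, so the endomorphisms have dimension at most `2²`;
    -- the four independent operators must exhaust them.
    have hdim : Module.finrank ℂ (Module.End ℂ ((T₁ + T₂ + T₃).hw n)) ≤ 4 := by
      rw [Module.finrank_linearMap]
      have := hfin.2.trans hcard
      nlinarith
    have hspan : Submodule.span ℂ (Set.range f) = ⊤ :=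
      hf.span_eq_top_of_card_eq_finrank' (le_antisymm hf.fintype_card_le_finrank (by simpa using hdim))
    intro M
    have hM : M ∈ Submodule.span ℂ (Set.range f) := by rw [hspan]; trivial
    have hle : Submodule.span ℂ (Set.range f) ≤ LinearMap.range (h.onHw n).toLinearMap := by
      rw [Submodule.span_le]
      rintro _ ⟨i, rfl⟩
      exact ⟨_, rfl⟩
    exact hle hM

/-- `M` is matched separately on each space of highest weight vectors. Idempotents glue the
preimages, and `eq_zero_of_central` shows that agreement on highest weight vectors is enough. -/
lemma surjective (h : Setup a b T₁ T₂ T₃ X Y C Φ) {M : Module.End ℂ V}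
    (hM : (T₁ + T₂ + T₃).Central M) : ∃ r, Φ r = M := by
  obtain ⟨e, he1, he, hXe, he'⟩ := h.exists_idempotents
  have hex : ∀ n, ∃ r, n ∈ J₃ 1 a b → ∀ v ∈ (T₁ + T₂ + T₃).hw n, Φ r v = M v := by
    intro n
    by_cases hn : n ∈ J₃ 1 a b
    · obtain ⟨r, hr⟩ := h.onHw_surjective hn (M.restrict fun _ hv => hM.map_hw hv)
      exact ⟨r, fun _ v hv => congr((($hr : Module.End ℂ _) ⟨v, hv⟩ : V))⟩
    · exact ⟨0, fun h => absurd h hn⟩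
  choose r hr using hex
  refine ⟨∑ n ∈ J₃ 1 a b, r n * e n, sub_eq_zero.1 ?_⟩
  have hc := h.central (∑ n ∈ J₃ 1 a b, r n * e n)
  refine h.triple.eq_zero_of_central
    ⟨hc.E.sub_left hM.E, hc.F.sub_left hM.F, hc.H.sub_left hM.H⟩ fun n hn v hK hE => ?_
  have hv := mem_hw.2 ⟨hK, hE⟩
  rw [LinearMap.sub_apply, map_sum, LinearMap.sum_apply, Finset.sum_eq_single_of_mem n hn,
    map_mul, Module.End.mul_apply, he' n hn n hn v hv, if_pos rfl, hr n hn v hv, sub_self]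
  intro k hk hkn
  rw [map_mul, Module.End.mul_apply, he' k hk n hn v hv, if_neg hkn, map_zero]

end Setup

end


/-! ### Spin components and the matrices of the irreducible representations -/

open Polynomial

section

variable {V : Type*} [AddCommGroup V] [Module ℂ V]

namespace Ops

/-- The hermitian spin components. -/
def spin (T : Ops V) : Fin 3 → Module.End ℂ V :=
  ![(1 / 2 : ℂ) • (T.E + T.F), (-Complex.I / 2) • (T.E - T.F), (1 / 2 : ℂ) • T.H]

lemma spin_add (T U : Ops V) (α : Fin 3) : (T + U).spin α = T.spin α + U.spin α := by
  fin_cases α <;> simp [spin] <;> module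

/-- `K` is the normally ordered form of the sum of squares: rewriting `E F` as `F E + H` produces
the linear term in `H`. -/
lemma IsRep.sum_spin_sq {T : Ops V} (h : T.IsRep) : ∑ α, T.spin α ^ 2 = T.K := by
  have hI : (-Complex.I / 2) * (-Complex.I / 2) = -1 / 4 := by
    linear_combination Complex.I_mul_I / 4
  rw [Fin.sum_univ_three]
  simp only [spin, Matrix.cons_val_zero, Matrix.cons_val_one, Matrix.cons_val, pow_two,
    smul_mul_smul_comm, hI, mul_add, add_mul, mul_sub, sub_mul, K, h.EF]
  module

lemma central_iff {T : Ops V} {M : Module.End ℂ V} :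
    T.Central M ↔ ∀ α, T.spin α * M = M * T.spin α := by
  constructor
  · rintro ⟨hE, hF, hH⟩ α
    have : Commute M (T.spin α) := by
      fin_cases α
      · exact (hE.add_right hF).smul_right _
      · exact (hE.sub_right hF).smul_right _
      · exact hH.smul_right _
    exact this.eq.symm
  · intro h
    have h' : ∀ α, Commute M (T.spin α) := fun α => (h α).symm
    have e1 : T.E = T.spin 0 + Complex.I • T.spin 1 := by
      have hI : Complex.I * (-Complex.I / 2) = 1 / 2 := by
        linear_combination -Complex.I_mul_I / 2
      simp only [spin, Matrix.cons_val_zero, Matrix.cons_val_one, smul_smul, hI]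
      module
    have e2 : T.F = T.spin 0 - Complex.I • T.spin 1 := by
      have hI : Complex.I * (-Complex.I / 2) = 1 / 2 := by
        linear_combination -Complex.I_mul_I / 2
      simp only [spin, Matrix.cons_val_zero, Matrix.cons_val_one, smul_smul, hI]
      module
    have e3 : T.H = (2 : ℂ) • T.spin 2 := by
      simp [spin, smul_smul]
    refine ⟨?_, ?_, ?_⟩
    · rw [e1]; exact (h' 0).add_right ((h' 1).smul_right _)
    · rw [e2]; exact (h' 0).sub_right ((h' 1).smul_right _)
    · rw [e3]; exact (h' 2).smul_right _

/-- Transport along an algebra homomorphism. -/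
def map {W : Type*} [AddCommGroup W] [Module ℂ W] (T : Ops V)
    (f : Module.End ℂ V →ₐ[ℂ] Module.End ℂ W) : Ops W := ⟨f T.E, f T.F, f T.H⟩

lemma IsRep.map {W : Type*} [AddCommGroup W] [Module ℂ W] {T : Ops V} (h : T.IsRep)
    (f : Module.End ℂ V →ₐ[ℂ] Module.End ℂ W) : (T.map f).IsRep where
  HE := by simpa [Ops.map] using congr(f $(h.HE))
  HF := by simpa [Ops.map] using congr(f $(h.HF))
  EF := by simpa [Ops.map] using congr(f $(h.EF))
  nilE := h.nilE.map f
  nilF := h.nilF.map f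

lemma map_K {W : Type*} [AddCommGroup W] [Module ℂ W] (T : Ops V)
    (f : Module.End ℂ V →ₐ[ℂ] Module.End ℂ W) : (T.map f).K = f T.K := by
  simp [K, map]

lemma map_spin {W : Type*} [AddCommGroup W] [Module ℂ W] (T : Ops V)
    (f : Module.End ℂ V →ₐ[ℂ] Module.End ℂ W) (α : Fin 3) : (T.map f).spin α = f (T.spin α) := by
  fin_cases α <;> simp [spin, map]

end Ops

end

lemma sPlus_mul_apply (n : ℕ) (M : Matrix (Fin (n + 1)) (Fin (n + 1)) ℂ) (r c : Fin (n + 1)) :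
    (sPlus n * M) r c =
      if h : (r : ℕ) + 1 < n + 1 then ((n : ℂ) - (r : ℕ)) * M ⟨r + 1, h⟩ c else 0 := by
  rw [Matrix.mul_apply]
  split_ifs with h
  · rw [Finset.sum_eq_single_of_mem ⟨r + 1, h⟩ (Finset.mem_univ _)]
    · simp [sPlus]
    · intro k _ hk
      have : (r : ℕ) + 1 ≠ k := fun h => hk (Fin.ext h.symm)
      simp [sPlus, this]
  · refine Finset.sum_eq_zero fun k _ => ?_
    have : (r : ℕ) + 1 ≠ k := by omega
    simp [sPlus, this]

/-- At `r = 0` the truncated index `r - 1` is meaningless, but its coefficient `r` is zero. -/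
lemma sMinus_mul_apply (n : ℕ) (M : Matrix (Fin (n + 1)) (Fin (n + 1)) ℂ) (r c : Fin (n + 1)) :
    (sMinus n * M) r c = ((r : ℕ) : ℂ) * M ⟨r - 1, by omega⟩ c := by
  rw [Matrix.mul_apply]
  by_cases h : (r : ℕ) = 0
  · have h0 : ((r : ℕ) : ℂ) = 0 := by rw [h, Nat.cast_zero]
    rw [h0, zero_mul]
    refine Finset.sum_eq_zero fun k _ => ?_
    have : (k : ℕ) + 1 ≠ r := by omega
    simp [sMinus, this]
  · rw [Finset.sum_eq_single_of_mem ⟨r - 1, by omega⟩ (Finset.mem_univ _)]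
    · have : (r : ℕ) - 1 + 1 = r := by omega
      simp [sMinus, this]
    · intro k _ hk
      have : (k : ℕ) + 1 ≠ r := fun h => hk (Fin.ext (by simp only; omega))
      simp [sMinus, this]

/-- The weight matrix. -/
def sWeight (n : ℕ) : Matrix (Fin (n + 1)) (Fin (n + 1)) ℂ :=
  Matrix.diagonal fun i => (n : ℂ) - 2 * ((i : ℕ) : ℂ)

/-- The operators of the irreducible representation `[n]`. -/
def irr (n : ℕ) : Ops (Spin n) :=
  ⟨Matrix.toLin' (sPlus n), Matrix.toLin' (sMinus n), Matrix.toLin' (sWeight n)⟩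

lemma irr_spin (n : ℕ) (α : Fin 3) : (irr n).spin α = s n α := by
  fin_cases α
  · simp [Ops.spin, irr, s, sMat]
  · simp [Ops.spin, irr, s, sMat]
  · simp only [Ops.spin, irr, s, sMat]
    show (1 / 2 : ℂ) • Matrix.toLin' (sWeight n) = Matrix.toLin' (Matrix.diagonal _)
    rw [← map_smul]
    congr 1
    ext i j
    by_cases h : i = j
    · subst h; simp [sWeight]; ring
    · simp [sWeight, h]

lemma sWeight_mul_sPlus (n : ℕ) :
    sWeight n * sPlus n = sPlus n * sWeight n + (2 : ℂ) • sPlus n := by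
  ext i j
  simp only [sWeight, Matrix.diagonal_mul, Matrix.mul_diagonal, Matrix.add_apply,
    Matrix.smul_apply, smul_eq_mul, sPlus, Matrix.of_apply]
  split_ifs with h
  · rw [← h]; push_cast; ring
  · simp

lemma sWeight_mul_sMinus (n : ℕ) :
    sWeight n * sMinus n = sMinus n * sWeight n - (2 : ℂ) • sMinus n := by
  ext i j
  simp only [sWeight, Matrix.diagonal_mul, Matrix.mul_diagonal, Matrix.sub_apply,
    Matrix.smul_apply, smul_eq_mul, sMinus, Matrix.of_apply]
  split_ifs with h
  · rw [← h]; push_cast; ring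
  · simp

lemma sMinus_mul_sPlus (n : ℕ) : sMinus n * sPlus n =
    Matrix.diagonal fun i : Fin (n + 1) => ((i : ℕ) : ℂ) * ((n : ℂ) - (i : ℕ) + 1) := by
  ext i j
  rw [sMinus_mul_apply]
  by_cases hi : (i : ℕ) = 0
  · by_cases h : i = j
    · subst h; simp [hi]
    · simp [hi, h]
  · by_cases h : i = j
    · subst h
      have : (i : ℕ) - 1 + 1 = i := by omega
      simp only [sPlus, Matrix.of_apply, this, if_true, Matrix.diagonal_apply_eq]
      rw [Nat.cast_sub (by omega)]
      push_cast; ring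
    · have : (i : ℕ) - 1 + 1 ≠ j := fun h' => h (Fin.ext (by omega))
      simp [sPlus, this, h]

lemma sPlus_mul_sMinus (n : ℕ) : sPlus n * sMinus n = sMinus n * sPlus n + sWeight n := by
  rw [sMinus_mul_sPlus, sWeight, Matrix.diagonal_add]
  ext i j
  rw [sPlus_mul_apply]
  by_cases h : i = j
  · subst h
    split_ifs with hi
    · simp [sMinus]; ring
    · have : (i : ℕ) = n := by omega
      simp [this]; ring
  · have : (j : ℕ) ≠ i := fun h' => h (Fin.ext h'.symm)
    simp [sMinus, this, h]

lemma irr_E_pow (n k : ℕ) : ∀ i j : Fin (n + 1), n < i + k → (sPlus n ^ k) i j = 0 := by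
  induction k with
  | zero => intro i j h; omega
  | succ k ih =>
    intro i j h
    rw [pow_succ', sPlus_mul_apply]
    split_ifs with hi
    · rw [ih _ _ (by simp only; omega), mul_zero]
    · rfl

lemma irr_F_pow (n k : ℕ) : ∀ i j : Fin (n + 1), (i : ℕ) < k → (sMinus n ^ k) i j = 0 := by
  induction k with
  | zero => intro i j h; omega
  | succ k ih =>
    intro i j h
    rw [pow_succ', sMinus_mul_apply]
    by_cases hi : (i : ℕ) = 0
    · simp [hi]
    · rw [ih _ _ (by simp only; omega), mul_zero]

lemma irr_isRep (n : ℕ) : (irr n).IsRep where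
  HE := by
    simp only [irr, Module.End.mul_eq_comp, ← Matrix.toLin'_mul, sWeight_mul_sPlus, map_add,
      map_smul]
  HF := by
    simp only [irr, Module.End.mul_eq_comp, ← Matrix.toLin'_mul, sWeight_mul_sMinus, map_sub,
      map_smul]
  EF := by
    simp only [irr, Module.End.mul_eq_comp, ← Matrix.toLin'_mul, sPlus_mul_sMinus, map_add]
  nilE := by
    refine ⟨n + 1, ?_⟩
    have : sPlus n ^ (n + 1) = 0 := by
      ext i j; exact irr_E_pow n _ i j (by omega)
    simp only [irr, ← Matrix.toLin'_pow, this, map_zero]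
  nilF := by
    refine ⟨n + 1, ?_⟩
    have : sMinus n ^ (n + 1) = 0 := by
      ext i j; exact irr_F_pow n _ i j i.2
    simp only [irr, ← Matrix.toLin'_pow, this, map_zero]

lemma irr_K (n : ℕ) : (irr n).K = cc n • 1 := by
  simp only [Ops.K, irr, Module.End.mul_eq_comp, ← Matrix.toLin'_mul, sMinus_mul_sPlus,
    ← Matrix.toLin'_pow, sWeight, Matrix.diagonal_pow, ← map_smul, ← map_add]
  rw [Module.End.one_eq_id, ← Matrix.toLin'_one, ← map_smul]
  congr 1
  ext i j
  by_cases h : i = j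
  · subst h; simp [cc]; ring
  · simp [h]

lemma irr_H_single (n : ℕ) (i : Fin (n + 1)) :
    (irr n).H (Pi.single i 1) = ((n : ℂ) - 2 * ((i : ℕ) : ℂ)) • Pi.single i 1 := by
  rw [← Pi.single_smul]
  simp [irr, sWeight]

lemma irr_E_single_zero (n : ℕ) : (irr n).E (Pi.single 0 1) = 0 := by
  ext i
  simp [irr, sPlus]


/-! ### The concrete threefold tensor product -/

open Polynomial

section

variable (n₁ n₂ n₃ : ℕ)

/-- Operators on the first factor. -/
def ι₁ : Module.End ℂ (Spin n₁) →ₐ[ℂ] Module.End ℂ (Triple n₁ n₂ n₃) :=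
  (Module.End.rTensorAlgHom ℂ (Spin n₁ ⊗[ℂ] Spin n₂) (Spin n₃)).comp
    (Module.End.rTensorAlgHom ℂ (Spin n₁) (Spin n₂))

/-- Operators on the second factor. -/
def ι₂ : Module.End ℂ (Spin n₂) →ₐ[ℂ] Module.End ℂ (Triple n₁ n₂ n₃) :=
  (Module.End.rTensorAlgHom ℂ (Spin n₁ ⊗[ℂ] Spin n₂) (Spin n₃)).comp
    (Module.End.lTensorAlgHom ℂ (Spin n₂) (Spin n₁))

/-- Operators on the third factor. -/
def ι₃ : Module.End ℂ (Spin n₃) →ₐ[ℂ] Module.End ℂ (Triple n₁ n₂ n₃) :=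
  Module.End.lTensorAlgHom ℂ (Spin n₃) (Spin n₁ ⊗[ℂ] Spin n₂)

variable {n₁ n₂ n₃}

lemma ι₁_tmul (f : Module.End ℂ (Spin n₁)) (u : Spin n₁) (v : Spin n₂) (w : Spin n₃) :
    ι₁ n₁ n₂ n₃ f ((u ⊗ₜ v) ⊗ₜ w) = (f u ⊗ₜ v) ⊗ₜ w := rfl

lemma ι₂_tmul (f : Module.End ℂ (Spin n₂)) (u : Spin n₁) (v : Spin n₂) (w : Spin n₃) :
    ι₂ n₁ n₂ n₃ f ((u ⊗ₜ v) ⊗ₜ w) = (u ⊗ₜ f v) ⊗ₜ w := rfl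

lemma ι₃_tmul (f : Module.End ℂ (Spin n₃)) (u : Spin n₁) (v : Spin n₂) (w : Spin n₃) :
    ι₃ n₁ n₂ n₃ f ((u ⊗ₜ v) ⊗ₜ w) = (u ⊗ₜ v) ⊗ₜ f w := rfl

lemma commute_ι₁₂ (f : Module.End ℂ (Spin n₁)) (g : Module.End ℂ (Spin n₂)) :
    Commute (ι₁ n₁ n₂ n₃ f) (ι₂ n₁ n₂ n₃ g) := by
  refine TensorProduct.ext_threefold fun u v w => ?_
  simp only [Module.End.mul_apply, ι₁_tmul, ι₂_tmul]

lemma commute_ι₁₃ (f : Module.End ℂ (Spin n₁)) (g : Module.End ℂ (Spin n₃)) :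
    Commute (ι₁ n₁ n₂ n₃ f) (ι₃ n₁ n₂ n₃ g) := by
  refine TensorProduct.ext_threefold fun u v w => ?_
  simp only [Module.End.mul_apply, ι₁_tmul, ι₃_tmul]

lemma commute_ι₂₃ (f : Module.End ℂ (Spin n₂)) (g : Module.End ℂ (Spin n₃)) :
    Commute (ι₂ n₁ n₂ n₃ f) (ι₃ n₁ n₂ n₃ g) := by
  refine TensorProduct.ext_threefold fun u v w => ?_
  simp only [Module.End.mul_apply, ι₂_tmul, ι₃_tmul]

variable (n₁ n₂ n₃)

/-- The first spin. -/
def op₁ : Ops (Triple n₁ n₂ n₃) := (irr n₁).map (ι₁ n₁ n₂ n₃)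

/-- The second spin. -/
def op₂ : Ops (Triple n₁ n₂ n₃) := (irr n₂).map (ι₂ n₁ n₂ n₃)

/-- The third spin. -/
def op₃ : Ops (Triple n₁ n₂ n₃) := (irr n₃).map (ι₃ n₁ n₂ n₃)

/-- The basis of pure tensors. -/
def tensorBasis : Module.Basis ((Fin (n₁ + 1) × Fin (n₂ + 1)) × Fin (n₃ + 1)) ℂ (Triple n₁ n₂ n₃) :=
  ((Pi.basisFun ℂ _).tensorProduct (Pi.basisFun ℂ _)).tensorProduct (Pi.basisFun ℂ _)

variable {n₁ n₂ n₃}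

lemma tensorBasis_apply (i : (Fin (n₁ + 1) × Fin (n₂ + 1)) × Fin (n₃ + 1)) :
    tensorBasis n₁ n₂ n₃ i =
      ((Pi.single i.1.1 1 : Spin n₁) ⊗ₜ (Pi.single i.1.2 1 : Spin n₂)) ⊗ₜ
        (Pi.single i.2 1 : Spin n₃) := by
  simp [tensorBasis, Module.Basis.tensorProduct_apply']

lemma op₁_H (i : (Fin (n₁ + 1) × Fin (n₂ + 1)) × Fin (n₃ + 1)) :
    (op₁ n₁ n₂ n₃).H (tensorBasis n₁ n₂ n₃ i) =
      ((n₁ : ℂ) - 2 * ((i.1.1 : ℕ) : ℂ)) • tensorBasis n₁ n₂ n₃ i := by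
  rw [tensorBasis_apply]
  show ι₁ n₁ n₂ n₃ (irr n₁).H _ = _
  rw [ι₁_tmul, irr_H_single, TensorProduct.smul_tmul', TensorProduct.smul_tmul']

lemma op₂_H (i : (Fin (n₁ + 1) × Fin (n₂ + 1)) × Fin (n₃ + 1)) :
    (op₂ n₁ n₂ n₃).H (tensorBasis n₁ n₂ n₃ i) =
      ((n₂ : ℂ) - 2 * ((i.1.2 : ℕ) : ℂ)) • tensorBasis n₁ n₂ n₃ i := by
  rw [tensorBasis_apply]
  show ι₂ n₁ n₂ n₃ (irr n₂).H _ = _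
  rw [ι₂_tmul, irr_H_single, TensorProduct.tmul_smul, ← TensorProduct.smul_tmul']

lemma op₃_H (i : (Fin (n₁ + 1) × Fin (n₂ + 1)) × Fin (n₃ + 1)) :
    (op₃ n₁ n₂ n₃).H (tensorBasis n₁ n₂ n₃ i) =
      ((n₃ : ℂ) - 2 * ((i.2 : ℕ) : ℂ)) • tensorBasis n₁ n₂ n₃ i := by
  rw [tensorBasis_apply]
  show ι₃ n₁ n₂ n₃ (irr n₃).H _ = _
  rw [ι₃_tmul, irr_H_single, TensorProduct.tmul_smul]

lemma repr_of_diagonal {ι V : Type*} [AddCommGroup V] [Module ℂ V] (B : Module.Basis ι ℂ V)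
    {D : Module.End ℂ V} {d : ι → ℂ} (h : ∀ i, D (B i) = d i • B i) (v : V) (i : ι) :
    B.repr (D v) i = d i * B.repr v i := by
  have : (B.coord i).comp D = d i • B.coord i := by
    refine B.ext fun j => ?_
    classical
    by_cases hij : j = i
    · subst hij; simp [h]
    · simp [h, hij]
  exact congr($this v)

lemma isTriple (n₁ n₂ n₃ : ℕ) :
    Ops.IsTriple (op₁ n₁ n₂ n₃) (op₂ n₁ n₂ n₃) (op₃ n₁ n₂ n₃) n₁ n₂ n₃ where
  rep₁ := (irr_isRep n₁).map _
  rep₂ := (irr_isRep n₂).map _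
  rep₃ := (irr_isRep n₃).map _
  comm₁₂ := by constructor <;> exact commute_ι₁₂ _ _
  comm₁₃ := by constructor <;> exact commute_ι₁₃ _ _
  comm₂₃ := by constructor <;> exact commute_ι₂₃ _ _
  cas₁ v := by simp [op₁, Ops.map_K, irr_K]
  cas₂ v := by simp [op₂, Ops.map_K, irr_K]
  cas₃ v := by simp [op₃, Ops.map_K, irr_K]
  span := by
    rw [eq_top_iff, ← (tensorBasis n₁ n₂ n₃).span_eq]
    refine Submodule.span_mono ?_
    rintro _ ⟨i, rfl⟩
    exact ⟨⟨_, op₁_H i⟩, ⟨_, op₂_H i⟩, ⟨_, op₃_H i⟩⟩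
  top := by
    refine ⟨tensorBasis n₁ n₂ n₃ ((0, 0), 0), Module.Basis.ne_zero _ _, ⟨?_, ?_, ?_⟩, ?_⟩
    · rw [tensorBasis_apply]
      show ι₁ n₁ n₂ n₃ (irr n₁).E _ = _
      rw [ι₁_tmul, irr_E_single_zero, TensorProduct.zero_tmul, TensorProduct.zero_tmul]
    · rw [tensorBasis_apply]
      show ι₂ n₁ n₂ n₃ (irr n₂).E _ = _
      rw [ι₂_tmul, irr_E_single_zero, TensorProduct.tmul_zero, TensorProduct.zero_tmul]
    · rw [tensorBasis_apply]
      show ι₃ n₁ n₂ n₃ (irr n₃).E _ = _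
      rw [ι₃_tmul, irr_E_single_zero, TensorProduct.tmul_zero]
    · intro v h1 h2 h3
      refine ⟨(tensorBasis n₁ n₂ n₃).repr v ((0, 0), 0), (tensorBasis n₁ n₂ n₃).ext_elem ?_⟩
      -- A coordinate at a nonzero index has a weight different from the top weight `n`, so it
      -- vanishes on a vector of top weight.
      have key : ∀ {n : ℕ} {i : Fin (n + 1)} {z : ℂ}, n * z = ((n : ℂ) - 2 * ((i : ℕ) : ℂ)) * z →
          i ≠ 0 → z = 0 := by
        intro n i z h hi
        have : ((i : ℕ) : ℂ) * z = 0 := by linear_combination h / 2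
        refine (mul_eq_zero.1 this).resolve_left (Nat.cast_ne_zero.2 fun h0 => hi (Fin.ext h0))
      rintro ⟨⟨i, j⟩, k⟩
      have e1 := repr_of_diagonal (tensorBasis n₁ n₂ n₃) op₁_H v ((i, j), k)
      have e2 := repr_of_diagonal (tensorBasis n₁ n₂ n₃) op₂_H v ((i, j), k)
      have e3 := repr_of_diagonal (tensorBasis n₁ n₂ n₃) op₃_H v ((i, j), k)
      rw [h1, map_smul, Finsupp.smul_apply, smul_eq_mul] at e1
      rw [h2, map_smul, Finsupp.smul_apply, smul_eq_mul] at e2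
      rw [h3, map_smul, Finsupp.smul_apply, smul_eq_mul] at e3
      by_cases h : ((i, j), k) = (((0, 0), 0) : (Fin (n₁ + 1) × Fin (n₂ + 1)) × Fin (n₃ + 1))
      · simp [h]
      · have : (tensorBasis n₁ n₂ n₃).repr v ((i, j), k) = 0 := by
          by_cases hi : i = 0
          · by_cases hj : j = 0
            · refine key e3 fun hk => h (by simp only at hk; rw [hi, hj, hk])
            · exact key e2 hj
          · exact key e1 hi
        rw [this, map_smul, Finsupp.smul_apply, Module.Basis.repr_self,
          Finsupp.single_eq_of_ne h, smul_zero]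

lemma op₁_spin (α : Fin 3) : (op₁ n₁ n₂ n₃).spin α = s₁ n₁ n₂ n₃ α := by
  rw [op₁, Ops.map_spin, irr_spin]; rfl

lemma op₂_spin (α : Fin 3) : (op₂ n₁ n₂ n₃).spin α = s₂ n₁ n₂ n₃ α := by
  rw [op₂, Ops.map_spin, irr_spin]; rfl

lemma op₃_spin (α : Fin 3) : (op₃ n₁ n₂ n₃).spin α = s₃ n₁ n₂ n₃ α := by
  rw [op₃, Ops.map_spin, irr_spin, s₃, TensorProduct.map_id]; rfl

lemma K₁₂_eq : (op₁ n₁ n₂ n₃ + op₂ n₁ n₂ n₃).K = K₁₂ n₁ n₂ n₃ := by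
  rw [← (isTriple n₁ n₂ n₃).rep₁₂.sum_spin_sq, K₁₂]
  simp only [Ops.spin_add, op₁_spin, op₂_spin]

lemma K₂₃_eq : (op₂ n₁ n₂ n₃ + op₃ n₁ n₂ n₃).K = K₂₃ n₁ n₂ n₃ := by
  rw [← (isTriple n₁ n₂ n₃).swap₁₂.swap₂₃.rep₁₂.sum_spin_sq, K₂₃]
  simp only [Ops.spin_add, op₂_spin, op₃_spin]

lemma K₁₂₃_eq : (op₁ n₁ n₂ n₃ + op₂ n₁ n₂ n₃ + op₃ n₁ n₂ n₃).K = K₁₂₃ n₁ n₂ n₃ := by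
  rw [← (isTriple n₁ n₂ n₃).rep₁₂₃.sum_spin_sq, K₁₂₃]
  simp only [Ops.spin_add, op₁_spin, op₂_spin, op₃_spin]

lemma mem_cent_iff {M : Module.End ℂ (Triple n₁ n₂ n₃)} :
    M ∈ Cent n₁ n₂ n₃ ↔ (op₁ n₁ n₂ n₃ + op₂ n₁ n₂ n₃ + op₃ n₁ n₂ n₃).Central M := by
  rw [Ops.central_iff, Cent, Subalgebra.mem_centralizer_iff]
  simp only [Set.forall_mem_range, Ops.spin_add, op₁_spin, op₂_spin, op₃_spin]

end


/-! ### Presentations of the Racah algebras -/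

open Polynomial

section

variable {R : Type*} [Ring R] [Algebra ℂ R]

lemma bracket_iff_lie {A B C : R} {α₁ α₂ α₃ : ℂ} : Bracket A B C α₁ α₂ α₃ ↔
    ⁅A, ⁅B, A⁆⁆ = -2 * A ^ 2 - 2 * (A * B + B * A)
      + 2 * (C + algebraMap ℂ R α₁ + algebraMap ℂ R α₂ + algebraMap ℂ R α₃) * A
      + 2 * (algebraMap ℂ R α₁ - algebraMap ℂ R α₂) * (algebraMap ℂ R α₃ - C) := by
  have h2 : (2 : R) = (2 : ℂ) • (1 : R) := by rw [two_smul, one_add_one_eq_two]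
  have e1 : ⁅A, ⁅B, A⁆⁆ = A * (B * A) - A * (A * B) - (B * A * A - A * B * A) := by
    simp only [Ring.lie_def, mul_sub, sub_mul]
  have e2 : -2 * A ^ 2 - 2 * (A * B + B * A)
      + 2 * (C + algebraMap ℂ R α₁ + algebraMap ℂ R α₂ + algebraMap ℂ R α₃) * A
      + 2 * (algebraMap ℂ R α₁ - algebraMap ℂ R α₂) * (algebraMap ℂ R α₃ - C) =
      (-2 : ℂ) • (A * A) - (2 : ℂ) • (A * B + B * A) + (2 : ℂ) • (C * A)
      + (2 * (α₁ + α₂ + α₃)) • A + (2 * (α₁ - α₂)) • (α₃ • (1 : R) - C) := by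
    rw [h2]
    simp only [Algebra.algebraMap_eq_smul_one, pow_two, neg_mul, mul_add, add_mul, mul_sub,
      sub_mul, smul_mul_assoc, mul_smul_comm, one_mul, mul_one]
    module
  rw [e1, e2]
  rfl

/-- The relation for `B` is the one for `A` after exchanging `A` with `B` and `α₁` with `α₃`, so one
predicate covers both. -/
lemma bracket_iff_lie' {A B C : R} {α₁ α₂ α₃ : ℂ} : Bracket B A C α₃ α₂ α₁ ↔
    ⁅B, ⁅A, B⁆⁆ = -2 * B ^ 2 - 2 * (A * B + B * A)
      + 2 * (C + algebraMap ℂ R α₁ + algebraMap ℂ R α₂ + algebraMap ℂ R α₃) * B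
      + 2 * (algebraMap ℂ R α₁ - C) * (algebraMap ℂ R α₃ - algebraMap ℂ R α₂) := by
  rw [bracket_iff_lie]
  have e : -2 * B ^ 2 - 2 * (B * A + A * B)
      + 2 * (C + algebraMap ℂ R α₃ + algebraMap ℂ R α₂ + algebraMap ℂ R α₁) * B
      + 2 * (algebraMap ℂ R α₃ - algebraMap ℂ R α₂) * (algebraMap ℂ R α₁ - C) =
      -2 * B ^ 2 - 2 * (A * B + B * A)
      + 2 * (C + algebraMap ℂ R α₁ + algebraMap ℂ R α₂ + algebraMap ℂ R α₃) * B
      + 2 * (algebraMap ℂ R α₁ - C) * (algebraMap ℂ R α₃ - algebraMap ℂ R α₂) := by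
    simp only [Algebra.algebraMap_eq_smul_one, mul_add, add_mul, mul_sub,
      sub_mul, smul_mul_assoc, mul_smul_comm, mul_one]
    module
  rw [e]

section Transport

variable {S : Type*} [Ring S] [Algebra ℂ S] (F : S →ₐ[ℂ] R) (A B C a₁ a₂ a₃ : S)

lemma map_lie_lie : F ⁅A, ⁅B, A⁆⁆ = ⁅F A, ⁅F B, F A⁆⁆ := by
  simp only [Ring.lie_def, map_sub, map_mul]

lemma map_bracket_A : F (-2 * A ^ 2 - 2 * (A * B + B * A) + 2 * (C + a₁ + a₂ + a₃) * A
      + 2 * (a₁ - a₂) * (a₃ - C)) =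
    -2 * (F A) ^ 2 - 2 * (F A * F B + F B * F A) + 2 * (F C + F a₁ + F a₂ + F a₃) * F A
      + 2 * (F a₁ - F a₂) * (F a₃ - F C) := by
  simp only [map_add, map_sub, map_mul, map_neg, map_pow, map_ofNat]

lemma map_bracket_B : F (-2 * B ^ 2 - 2 * (A * B + B * A) + 2 * (C + a₁ + a₂ + a₃) * B
      + 2 * (a₁ - C) * (a₃ - a₂)) =
    -2 * (F B) ^ 2 - 2 * (F A * F B + F B * F A) + 2 * (F C + F a₁ + F a₂ + F a₃) * F B
      + 2 * (F a₁ - F C) * (F a₃ - F a₂) := by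
  simp only [map_add, map_sub, map_mul, map_neg, map_pow, map_ofNat]

end Transport

/-- The defining relations of the quotiented Racah algebra. -/
structure QuotAlg (n₁ n₂ n₃ : ℕ) (A B C : R) : Prop where
  commA : C * A = A * C
  commB : C * B = B * C
  brA : Bracket A B C (cc n₁) (cc n₂) (cc n₃)
  brB : Bracket B A C (cc n₃) (cc n₂) (cc n₁)
  polyA : aeval A (polyJ (J₂ n₁ n₂)) = 0
  polyB : aeval B (polyJ (J₂ n₂ n₃)) = 0
  polyC : aeval C (polyJ (J₃ n₁ n₂ n₃)) = 0
  polyCAB : aeval (C + (cc n₁ + cc n₂ + cc n₃) • (1 : R) - A - B) (polyJ (J₂ n₁ n₃)) = 0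
  polyAB : aeval (A + B - (cc n₁ + cc n₂ + cc n₃) • (1 : R)) (polyM (M₃ n₁ n₃ n₂)) = 0
  polyCA : aeval (C - A) (polyM (M₃ n₁ n₂ n₃)) = 0
  polyCB : aeval (C - B) (polyM (M₃ n₂ n₃ n₁)) = 0

lemma adjoin_eq_top_of_mem {R : Type*} [Semiring R] [Algebra ℂ R] {s t : Set R} (hs : Algebra.adjoin ℂ s = ⊤)
    (h : ∀ x ∈ s, x ∈ Algebra.adjoin ℂ t) : Algebra.adjoin ℂ t = ⊤ := by
  rw [eq_top_iff, ← hs]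
  exact Algebra.adjoin_le h

namespace QuotAlg

variable {a b n₁ n₂ n₃ : ℕ} {A B C : R}

lemma halfAlg_of_second (h : QuotAlg a 1 b A B C) (hg : Algebra.adjoin ℂ {A, B, C} = ⊤) :
    HalfAlg a b A B C where
  commX := h.commA
  commY := h.commB
  quadX := by rw [J₂_comm]; exact h.polyA
  quadY := h.polyB
  quadZ := by simpa using h.polyCAB
  polyX := by rw [M₃_comm]; exact h.polyCA
  polyY := h.polyCB
  polyC := by
    have : J₃ 1 a b = J₃ a 1 b := by ext l; simp only [mem_J₃_iff]; omega
    rw [this]; exact h.polyC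
  brX := by simpa using h.brA
  brY := by simpa using h.brB
  gen := hg

/-- With the spin 1/2 in the first place, the Casimirs that involve it are `A` and the linear
combination standing for the pair (1,3). The relation for `A + B` becomes the one for `C - Y`, and
the relation for `B` becomes the third quadratic relation. -/
lemma halfAlg_of_first (h : QuotAlg 1 a b A B C) (hg : Algebra.adjoin ℂ {A, B, C} = ⊤) :
    HalfAlg a b A (C + (cc 1 + cc a + cc b) • (1 : R) - A - B) C where
  commX := h.commA
  commY := by
    simp only [mul_sub, sub_mul, mul_add, add_mul, h.commA, h.commB, mul_smul_comm,
      smul_mul_assoc, one_mul, mul_one]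
  quadX := h.polyA
  quadY := by simpa using h.polyCAB
  quadZ := by
    convert h.polyB using 2
    congr 1
    module
  polyX := h.polyCA
  polyY := by
    convert h.polyAB using 2
    congr 1
    push_cast
    module
  polyC := h.polyC
  brX := by
    have := h.brA
    push_cast at this
    exact this.third h.commA rfl
  brY := by
    have h1 := h.brA
    have h2 := h.brB
    push_cast at h1 h2
    exact h1.third' h2 h.commA h.commB rfl
  gen := by
    refine adjoin_eq_top_of_mem hg ?_
    have hA : A ∈ Algebra.adjoin ℂ
        ({A, C + (cc 1 + cc a + cc b) • (1 : R) - A - B, C} : Set R) :=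
      Algebra.subset_adjoin (by simp)
    have hY : C + (cc 1 + cc a + cc b) • (1 : R) - A - B ∈ Algebra.adjoin ℂ
        ({A, C + (cc 1 + cc a + cc b) • (1 : R) - A - B, C} : Set R) :=
      Algebra.subset_adjoin (by simp)
    have hC : C ∈ Algebra.adjoin ℂ
        ({A, C + (cc 1 + cc a + cc b) • (1 : R) - A - B, C} : Set R) :=
      Algebra.subset_adjoin (by simp)
    intro x hx
    simp only [Set.mem_insert_iff, Set.mem_singleton_iff] at hx
    rcases hx with rfl | rfl | rfl
    · exact hA
    · have := sub_mem (sub_mem (add_mem hC (Subalgebra.smul_mem _ (one_mem _)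
        (cc 1 + cc a + cc b))) hA) hY
      convert this using 1
      abel
    · exact hC

/-- Reversing the order of the three spins. -/
lemma reverse (h : QuotAlg n₁ n₂ n₃ A B C) : QuotAlg n₃ n₂ n₁ B A C where
  commA := h.commB
  commB := h.commA
  brA := h.brB
  brB := h.brA
  polyA := by rw [J₂_comm]; exact h.polyB
  polyB := by rw [J₂_comm]; exact h.polyA
  polyC := by
    have : J₃ n₃ n₂ n₁ = J₃ n₁ n₂ n₃ := by ext l; simp only [mem_J₃_iff]; omega
    rw [this]; exact h.polyC
  polyCAB := by
    rw [J₂_comm]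
    convert h.polyCAB using 2
    congr 1
    module
  polyAB := by
    rw [M₃_comm]
    convert h.polyAB using 2
    congr 1
    module
  polyCA := by rw [M₃_comm]; exact h.polyCB
  polyCB := by rw [M₃_comm]; exact h.polyCA

lemma halfAlg_of_third (h : QuotAlg a b 1 A B C) (hg : Algebra.adjoin ℂ {A, B, C} = ⊤) :
    HalfAlg a b (C + (cc 1 + cc b + cc a) • (1 : R) - B - A) B C :=
  (h.reverse.halfAlg_of_first (by rw [Set.insert_comm]; exact hg)).swap

/-- The images of the generators. -/
def genMap (n₁ n₂ n₃ : ℕ) (A B C : R) : Gen → R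
  | .A => A
  | .B => B
  | .C => C
  | .α₁ => algebraMap ℂ R (cc n₁)
  | .α₂ => algebraMap ℂ R (cc n₂)
  | .α₃ => algebraMap ℂ R (cc n₃)

lemma exists_racah_hom (h : QuotAlg n₁ n₂ n₃ A B C) :
    ∃ φ : Racah →ₐ[ℂ] R, ∀ g, φ (gen g) = genMap n₁ n₂ n₃ A B C g := by
  refine ⟨RingQuot.liftAlgHom ℂ ⟨FreeAlgebra.lift ℂ (genMap n₁ n₂ n₃ A B C), ?_⟩, fun g => ?_⟩
  · intro x y hxy
    have hc : ∀ (c : ℂ) (r : R), algebraMap ℂ R c * r = r * algebraMap ℂ R c := fun c r =>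
      Algebra.commutes c r
    induction hxy with
    | central_C g =>
      simp only [map_mul, fgen, FreeAlgebra.lift_ι_apply]
      cases g
      · exact h.commA
      · exact h.commB
      · rfl
      · exact (hc _ _).symm
      · exact (hc _ _).symm
      · exact (hc _ _).symm
    | central_α₁ g =>
      simp only [map_mul, fgen, FreeAlgebra.lift_ι_apply]
      exact hc _ _
    | central_α₂ g =>
      simp only [map_mul, fgen, FreeAlgebra.lift_ι_apply]
      exact hc _ _
    | central_α₃ g =>
      simp only [map_mul, fgen, FreeAlgebra.lift_ι_apply]
      exact hc _ _
    | bracket_B =>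
      refine (map_lie_lie _ _ _).trans (Eq.trans ?_ (map_bracket_B _ _ _ _ _ _ _).symm)
      simp only [fgen, FreeAlgebra.lift_ι_apply]
      exact bracket_iff_lie'.1 h.brB
    | bracket_A =>
      refine (map_lie_lie _ _ _).trans (Eq.trans ?_ (map_bracket_A _ _ _ _ _ _ _).symm)
      simp only [fgen, FreeAlgebra.lift_ι_apply]
      exact bracket_iff_lie.1 h.brA
  · rw [gen, RingQuot.liftAlgHom_mkAlgHom_apply]
    simp

lemma exists_hom (h : QuotAlg n₁ n₂ n₃ A B C) :
    ∃ Φ : QRacah n₁ n₂ n₃ →ₐ[ℂ] R, ∀ g, Φ (qgen n₁ n₂ n₃ g) = genMap n₁ n₂ n₃ A B C g := by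
  obtain ⟨φ, hφ⟩ := h.exists_racah_hom
  refine ⟨RingQuot.liftAlgHom ℂ ⟨φ, ?_⟩, fun g => ?_⟩
  · intro x y hxy
    have hs : ∀ c : ℂ, algebraMap ℂ R c = c • (1 : R) := Algebra.algebraMap_eq_smul_one
    induction hxy with
    | α₁ => rw [hφ, AlgHom.commutes, cas_cast]; rfl
    | α₂ => rw [hφ, AlgHom.commutes, cas_cast]; rfl
    | α₃ => rw [hφ, AlgHom.commutes, cas_cast]; rfl
    | A => rw [← aeval_algHom_apply, hφ, map_zero]; exact h.polyA
    | B => rw [← aeval_algHom_apply, hφ, map_zero]; exact h.polyB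
    | C => rw [← aeval_algHom_apply, hφ, map_zero]; exact h.polyC
    | CAB =>
      rw [← aeval_algHom_apply, map_zero, ← h.polyCAB]
      congr 2
      simp only [map_add, map_sub, hφ, genMap, hs]
      module
    | AB =>
      rw [← aeval_algHom_apply, map_zero, ← h.polyAB]
      congr 2
      simp only [map_add, map_sub, hφ, genMap, hs]
      module
    | CA =>
      rw [← aeval_algHom_apply, map_zero, ← h.polyCA]
      simp only [map_sub, hφ, genMap]
    | CB =>
      rw [← aeval_algHom_apply, map_zero, ← h.polyCB]
      simp only [map_sub, hφ, genMap]
  · rw [qgen, RingQuot.liftAlgHom_mkAlgHom_apply]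
    exact hφ g

end QuotAlg

end

/-- The projection from the free algebra. -/
def proj (n₁ n₂ n₃ : ℕ) : FreeAlgebra ℂ Gen →ₐ[ℂ] QRacah n₁ n₂ n₃ :=
  (RingQuot.mkAlgHom ℂ (QuotRel n₁ n₂ n₃)).comp (RingQuot.mkAlgHom ℂ RacahRel)

lemma proj_fgen (n₁ n₂ n₃ : ℕ) (g : Gen) : proj n₁ n₂ n₃ (fgen g) = qgen n₁ n₂ n₃ g := rfl

lemma proj_rel (n₁ n₂ n₃ : ℕ) {x y : FreeAlgebra ℂ Gen} (h : RacahRel x y) :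
    proj n₁ n₂ n₃ x = proj n₁ n₂ n₃ y :=
  congrArg (RingQuot.mkAlgHom ℂ (QuotRel n₁ n₂ n₃)) (RingQuot.mkAlgHom_rel ℂ h)

lemma proj_surjective (n₁ n₂ n₃ : ℕ) : Function.Surjective (proj n₁ n₂ n₃) :=
  (RingQuot.mkAlgHom_surjective ℂ _).comp (RingQuot.mkAlgHom_surjective ℂ _)

lemma qgen_α₁ (n₁ n₂ n₃ : ℕ) : qgen n₁ n₂ n₃ .α₁ = algebraMap ℂ _ (cc n₁) := by
  rw [qgen, RingQuot.mkAlgHom_rel ℂ (QuotRel.α₁), AlgHom.commutes, cas_cast]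

lemma qgen_α₂ (n₁ n₂ n₃ : ℕ) : qgen n₁ n₂ n₃ .α₂ = algebraMap ℂ _ (cc n₂) := by
  rw [qgen, RingQuot.mkAlgHom_rel ℂ (QuotRel.α₂), AlgHom.commutes, cas_cast]

lemma qgen_α₃ (n₁ n₂ n₃ : ℕ) : qgen n₁ n₂ n₃ .α₃ = algebraMap ℂ _ (cc n₃) := by
  rw [qgen, RingQuot.mkAlgHom_rel ℂ (QuotRel.α₃), AlgHom.commutes, cas_cast]

/-- The quotiented Racah algebra satisfies its defining relations. -/
lemma quotAlg_qgen (n₁ n₂ n₃ : ℕ) :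
    QuotAlg n₁ n₂ n₃ (qgen n₁ n₂ n₃ .A) (qgen n₁ n₂ n₃ .B) (qgen n₁ n₂ n₃ .C) := by
  set f := RingQuot.mkAlgHom ℂ (QuotRel n₁ n₂ n₃)
  have hq' : ∀ x, f (gen x) = qgen n₁ n₂ n₃ x := fun _ => rfl
  have r2 : ∀ {x y}, QuotRel n₁ n₂ n₃ x y → f x = f y := fun h => RingQuot.mkAlgHom_rel ℂ h
  have a1 := qgen_α₁ n₁ n₂ n₃
  have a2 := qgen_α₂ n₁ n₂ n₃
  have a3 := qgen_α₃ n₁ n₂ n₃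
  have hs : ∀ c : ℂ, algebraMap ℂ (QRacah n₁ n₂ n₃) c = c • 1 := Algebra.algebraMap_eq_smul_one
  constructor
  · have := proj_rel n₁ n₂ n₃ (.central_C .A)
    simpa only [map_mul, proj_fgen] using this
  · have := proj_rel n₁ n₂ n₃ (.central_C .B)
    simpa only [map_mul, proj_fgen] using this
  · rw [bracket_iff_lie]
    have e := proj_rel n₁ n₂ n₃ .bracket_A
    replace e := (map_lie_lie (R := QRacah n₁ n₂ n₃) (proj n₁ n₂ n₃) _ _).symm.trans
      (e.trans (map_bracket_A (R := QRacah n₁ n₂ n₃) (proj n₁ n₂ n₃) _ _ _ _ _ _))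
    simpa only [proj_fgen, a1, a2, a3] using e
  · rw [bracket_iff_lie']
    have e := proj_rel n₁ n₂ n₃ .bracket_B
    replace e := (map_lie_lie (R := QRacah n₁ n₂ n₃) (proj n₁ n₂ n₃) _ _).symm.trans
      (e.trans (map_bracket_B (R := QRacah n₁ n₂ n₃) (proj n₁ n₂ n₃) _ _ _ _ _ _))
    simpa only [proj_fgen, a1, a2, a3] using e
  · have := r2 .A
    rwa [← aeval_algHom_apply, map_zero] at this
  · have := r2 .B
    rwa [← aeval_algHom_apply, map_zero] at this
  · have := r2 .C
    rwa [← aeval_algHom_apply, map_zero] at this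
  · have := r2 .CAB
    rw [← aeval_algHom_apply, map_zero] at this
    rw [← this]
    congr 2
    simp only [map_add, map_sub, hq', a1, a2, a3, hs]
    module
  · have := r2 .AB
    rw [← aeval_algHom_apply, map_zero] at this
    rw [← this]
    congr 2
    simp only [map_add, map_sub, hq', a1, a2, a3, hs]
    module
  · have := r2 .CA
    rwa [← aeval_algHom_apply, map_zero, map_sub] at this
  · have := r2 .CB
    rwa [← aeval_algHom_apply, map_zero, map_sub] at this

lemma adjoin_qgen (n₁ n₂ n₃ : ℕ) : Algebra.adjoin ℂ
    {qgen n₁ n₂ n₃ .A, qgen n₁ n₂ n₃ .B, qgen n₁ n₂ n₃ .C} = ⊤ := by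
  have h1 := congr(Subalgebra.map (proj n₁ n₂ n₃) $(FreeAlgebra.adjoin_range_ι ℂ Gen))
  rw [AlgHom.map_adjoin, Algebra.map_top, (AlgHom.range_eq_top _).2 (proj_surjective n₁ n₂ n₃)]
    at h1
  refine adjoin_eq_top_of_mem h1 ?_
  rintro _ ⟨_, ⟨x, rfl⟩, rfl⟩
  rw [proj_fgen]
  cases x
  · exact Algebra.subset_adjoin (by simp)
  · exact Algebra.subset_adjoin (by simp)
  · exact Algebra.subset_adjoin (by simp)
  · rw [qgen_α₁]; exact Subalgebra.algebraMap_mem _ _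
  · rw [qgen_α₂]; exact Subalgebra.algebraMap_mem _ _
  · rw [qgen_α₃]; exact Subalgebra.algebraMap_mem _ _


/-! ### The three positions of the spin 1/2 and the final assembly -/

open Polynomial

namespace Ops.IsTriple

section

variable {V : Type*} [AddCommGroup V] [Module ℂ V] {T₁ T₂ T₃ : Ops V} {a b n₁ n₂ n₃ : ℕ}

/-- On the representation the Clifford relation makes the second factor in `bracket_iff` vanish
outright. -/
lemma bracket_half (h : IsTriple T₁ T₂ T₃ 1 a b) (ha : 0 < a) :
    Bracket (T₁ + T₂).K (T₁ + T₃).K (T₁ + T₂ + T₃).K (cc a) (cc 1) (cc b) := by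
  set x := (T₁ + T₂).K - dimSq a • (1 : Module.End ℂ V) with hx
  set y := (T₁ + T₃).K - dimSq b • (1 : Module.End ℂ V) with hy
  have hxx := sq_of_polyJ ha h.polyJ_K₁₂
  rw [← hx] at hxx
  have hC : (T₁ + T₂ + T₃).K * x = x * (T₁ + T₂ + T₃).K := by
    rw [hx, mul_sub, sub_mul, h.central_K₁₂.K.eq, mul_smul_comm, smul_mul_assoc, mul_one, one_mul]
  have hX : (T₁ + T₂).K = x + dimSq a • (1 : Module.End ℂ V) := by rw [hx, sub_add_cancel]
  have hY : (T₁ + T₃).K = y + dimSq b • (1 : Module.End ℂ V) := by rw [hy, sub_add_cancel]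
  rw [hX, hY, bracket_iff hxx hC, h.clifford_anticomm hx hy]
  have : (T₁ + T₂ + T₃).K - (cc a + cc b + 1 / 4) • (1 : Module.End ℂ V) - (T₁ + T₂ + T₃).K
      + (cc a + cc b + 1 / 4) • (1 : Module.End ℂ V) = 0 := by abel
  rw [this, mul_zero]

lemma bracket_half' (h : IsTriple T₁ T₂ T₃ 1 a b) (hb : 0 < b) :
    Bracket (T₁ + T₃).K (T₁ + T₂).K (T₁ + T₂ + T₃).K (cc b) (cc 1) (cc a) := by
  have := h.swap₂₃.bracket_half hb
  rwa [add_assoc', add_comm' T₃, ← add_assoc'] at this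

lemma K₁₃_eq (h : IsTriple T₁ T₂ T₃ n₁ n₂ n₃) : (T₁ + T₃).K =
    (T₁ + T₂ + T₃).K + (cc n₁ + cc n₂ + cc n₃) • (1 : Module.End ℂ V) - (T₁ + T₂).K
      - (T₂ + T₃).K := by
  have h1 : T₁.K = cc n₁ • (1 : Module.End ℂ V) := by ext v; simpa using congr($(h.cas₁ v))
  have h2 : T₂.K = cc n₂ • (1 : Module.End ℂ V) := by ext v; simpa using congr($(h.cas₂ v))
  have h3 : T₃.K = cc n₃ • (1 : Module.End ℂ V) := by ext v; simpa using congr($(h.cas₃ v))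
  have := K_add_add T₁ T₂ T₃
  rw [h1, h2, h3] at this
  linear_combination (norm := module) this

/-- Only the two brackets need the spin 1/2. The polynomial relations hold for arbitrary spins, by
applying the spectral lemmas to reordered triples. -/
lemma quotAlg (h : IsTriple T₁ T₂ T₃ n₁ n₂ n₃)
    (hA : Bracket (T₁ + T₂).K (T₂ + T₃).K (T₁ + T₂ + T₃).K (cc n₁) (cc n₂) (cc n₃))
    (hB : Bracket (T₂ + T₃).K (T₁ + T₂).K (T₁ + T₂ + T₃).K (cc n₃) (cc n₂) (cc n₁)) :
    QuotAlg n₁ n₂ n₃ (T₁ + T₂).K (T₂ + T₃).K (T₁ + T₂ + T₃).K := by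
  have h' := h.swap₁₂.swap₂₃
  have tot : T₂ + T₃ + T₁ = T₁ + T₂ + T₃ := by
    rw [add_comm' _ T₁, ← add_assoc']
  have tot' : T₁ + T₃ + T₂ = T₁ + T₂ + T₃ := by
    rw [add_assoc', add_comm' T₃, ← add_assoc']
  refine ⟨h.central_K₁₂.K.eq.symm, ?_, hA, hB, h.polyJ_K₁₂, h'.polyJ_K₁₂, h.polyJ_K₁₂₃, ?_, ?_,
    h.polyM_sub, ?_⟩
  · have := h'.central_K₁₂.K.eq.symm
    rwa [tot] at this
  · rw [← h.K₁₃_eq]; exact h.swap₂₃.polyJ_K₁₂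
  · have := h.swap₂₃.polyM_sub
    rw [tot', h.K₁₃_eq] at this
    rw [← this]
    congr 2
    abel
  · have := h'.polyM_sub
    rwa [tot] at this

lemma quotAlg_of_second (h : IsTriple T₁ T₂ T₃ a 1 b) (ha : 0 < a) (hb : 0 < b) :
    QuotAlg a 1 b (T₁ + T₂).K (T₂ + T₃).K (T₁ + T₂ + T₃).K := by
  have h1 := h.swap₁₂.bracket_half ha
  have h2 := h.swap₁₂.bracket_half' hb
  rw [add_comm' T₂ T₁] at h1 h2
  exact h.quotAlg (by simpa using h1) (by simpa using h2)

lemma quotAlg_of_first (h : IsTriple T₁ T₂ T₃ 1 a b) (ha : 0 < a) (hb : 0 < b) :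
    QuotAlg 1 a b (T₁ + T₂).K (T₂ + T₃).K (T₁ + T₂ + T₃).K := by
  have h1 := h.bracket_half ha
  have h2 := h.bracket_half' hb
  have e := h.K₁₃_eq
  have hY : (T₂ + T₃).K = (T₁ + T₂ + T₃).K + (cc a + cc 1 + cc b) • (1 : Module.End ℂ V)
      - (T₁ + T₂).K - (T₁ + T₃).K := by
    rw [e]; push_cast; module
  have c1 := h.central_K₁₂.K.eq.symm
  have c2 := h.swap₂₃.central_K₁₂.K.eq.symm
  rw [add_assoc', add_comm' T₃, ← add_assoc'] at c2
  exact h.quotAlg (by simpa using h1.third c1 hY) (by simpa using h1.third' h2 c1 c2 hY)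

lemma quotAlg_of_third (h : IsTriple T₁ T₂ T₃ a b 1) (ha : 0 < a) (hb : 0 < b) :
    QuotAlg a b 1 (T₁ + T₂).K (T₂ + T₃).K (T₁ + T₂ + T₃).K := by
  have h' : IsTriple T₃ T₂ T₁ 1 b a := h.swap₂₃.swap₁₂.swap₂₃
  have := (h'.quotAlg_of_first hb ha).reverse
  rwa [add_comm' T₂ T₁, add_comm' T₃ T₂, add_comm' _ T₁, ← add_assoc'] at this

/-- A homomorphism from the quotiented Racah algebra onto the centralizer of a triple. -/
def IsoOntoCent (T₁ T₂ T₃ : Ops V) (Φ : QRacah n₁ n₂ n₃ →ₐ[ℂ] Module.End ℂ V) : Prop :=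
  Φ (qgen n₁ n₂ n₃ .A) = (T₁ + T₂).K ∧ Φ (qgen n₁ n₂ n₃ .B) = (T₂ + T₃).K ∧
  Φ (qgen n₁ n₂ n₃ .C) = (T₁ + T₂ + T₃).K ∧ Function.Injective Φ ∧
  (∀ r, (T₁ + T₂ + T₃).Central (Φ r)) ∧
  ∀ M, (T₁ + T₂ + T₃).Central M → ∃ r, Φ r = M

lemma _root_.RacahSU2.Setup.isoOntoCent {U₁ U₂ U₃ : Ops V} {X Y : QRacah n₁ n₂ n₃}
    {Φ : QRacah n₁ n₂ n₃ →ₐ[ℂ] Module.End ℂ V}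
    (S : Setup a b U₁ U₂ U₃ X Y (qgen n₁ n₂ n₃ .C) Φ)
    (htot : U₁ + U₂ + U₃ = T₁ + T₂ + T₃)
    (hA : Φ (qgen n₁ n₂ n₃ .A) = (T₁ + T₂).K) (hB : Φ (qgen n₁ n₂ n₃ .B) = (T₂ + T₃).K)
    (hC : Φ (qgen n₁ n₂ n₃ .C) = (T₁ + T₂ + T₃).K) : IsoOntoCent T₁ T₂ T₃ Φ := by
  refine ⟨hA, hB, hC, S.injective, fun r => ?_, fun M hM => ?_⟩
  · rw [← htot]; exact S.central r
  · rw [← htot] at hM; exact S.surjective hM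

lemma exists_iso_first (h : IsTriple T₁ T₂ T₃ 1 a b) (ha : 0 < a) (hb : 0 < b) :
    ∃ Φ : QRacah 1 a b →ₐ[ℂ] Module.End ℂ V, IsoOntoCent T₁ T₂ T₃ Φ := by
  obtain ⟨Φ, hΦ⟩ := (h.quotAlg_of_first ha hb).exists_hom
  have hA : Φ (qgen 1 a b .A) = (T₁ + T₂).K := hΦ .A
  have hB : Φ (qgen 1 a b .B) = (T₂ + T₃).K := hΦ .B
  have hC : Φ (qgen 1 a b .C) = (T₁ + T₂ + T₃).K := hΦ .C
  refine ⟨Φ, Setup.isoOntoCent ⟨ha, hb, h,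
    (quotAlg_qgen 1 a b).halfAlg_of_first (adjoin_qgen 1 a b), hA, ?_, hC⟩ rfl hA hB hC⟩
  rw [h.K₁₃_eq, map_sub, map_sub, map_add, map_smul, map_one, hA, hB, hC, Nat.cast_one]

lemma exists_iso_second (h : IsTriple T₁ T₂ T₃ a 1 b) (ha : 0 < a) (hb : 0 < b) :
    ∃ Φ : QRacah a 1 b →ₐ[ℂ] Module.End ℂ V, IsoOntoCent T₁ T₂ T₃ Φ := by
  obtain ⟨Φ, hΦ⟩ := (h.quotAlg_of_second ha hb).exists_hom
  have hA : Φ (qgen a 1 b .A) = (T₁ + T₂).K := hΦ .A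
  have hB : Φ (qgen a 1 b .B) = (T₂ + T₃).K := hΦ .B
  have hC : Φ (qgen a 1 b .C) = (T₁ + T₂ + T₃).K := hΦ .C
  have htot : T₂ + T₁ + T₃ = T₁ + T₂ + T₃ := by rw [add_comm' T₂ T₁]
  exact ⟨Φ, Setup.isoOntoCent ⟨ha, hb, h.swap₁₂,
    (quotAlg_qgen a 1 b).halfAlg_of_second (adjoin_qgen a 1 b), by rw [hA, add_comm'], hB,
    by rw [hC, htot]⟩ htot hA hB hC⟩

lemma exists_iso_third (h : IsTriple T₁ T₂ T₃ a b 1) (ha : 0 < a) (hb : 0 < b) :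
    ∃ Φ : QRacah a b 1 →ₐ[ℂ] Module.End ℂ V, IsoOntoCent T₁ T₂ T₃ Φ := by
  obtain ⟨Φ, hΦ⟩ := (h.quotAlg_of_third ha hb).exists_hom
  have hA : Φ (qgen a b 1 .A) = (T₁ + T₂).K := hΦ .A
  have hB : Φ (qgen a b 1 .B) = (T₂ + T₃).K := hΦ .B
  have hC : Φ (qgen a b 1 .C) = (T₁ + T₂ + T₃).K := hΦ .C
  have htot : T₃ + T₁ + T₂ = T₁ + T₂ + T₃ := by rw [add_assoc', add_comm']
  refine ⟨Φ, Setup.isoOntoCent ⟨ha, hb, h.swap₂₃.swap₁₂,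
    (quotAlg_qgen a b 1).halfAlg_of_third (adjoin_qgen a b 1), ?_, ?_,
    by rw [hC, htot]⟩ htot hA hB hC⟩
  · rw [add_comm', h.K₁₃_eq, map_sub, map_sub, map_add, map_smul, map_one, hA, hB, hC]
    push_cast
    module
  · rw [hB, add_comm']

end

end Ops.IsTriple

/-- `HalfAlg` passes to quotients, and in this quotient `C` is scalar. -/
lemma HalfAlg.rank_ringQuot {R : Type*} [Ring R] [Algebra ℂ R] {a b n : ℕ} {X Y C : R}
    (h : HalfAlg a b X Y C) (ha : 0 < a) (hb : 0 < b) (hn : n ∈ J₃ 1 a b) {r : R → R → Prop}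
    (hr : r C (algebraMap ℂ R ((cas n : ℚ) : ℂ))) : Module.rank ℂ (RingQuot r) ≤ 4 ∧
      ((n = a + b + 1 ∨ n + b + 1 = a ∨ n + a + 1 = b) → Module.rank ℂ (RingQuot r) ≤ 1) := by
  have hπ := RingQuot.mkAlgHom_surjective ℂ r
  have hC : RingQuot.mkAlgHom ℂ r C = cc n • 1 := by
    rw [RingQuot.mkAlgHom_rel ℂ hr, AlgHom.commutes, cas_cast, Algebra.algebraMap_eq_smul_one]
  have hmap := h.map (RingQuot.mkAlgHom ℂ r) hπ
  exact ⟨hmap.rank_le_four ha hb hn hC, fun hn' => hmap.rank_le_one ha hb hn hn' hC⟩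

/-- The statement of the main theorem, for spins `1/2, a/2, b/2` in some order. -/
def Conclusion (a b n₁ n₂ n₃ : ℕ) : Prop :=
  (∃ Φ : QRacah n₁ n₂ n₃ ≃ₐ[ℂ] Cent n₁ n₂ n₃,
    (Φ (qgen n₁ n₂ n₃ .A) : Module.End ℂ (Triple n₁ n₂ n₃)) = K₁₂ n₁ n₂ n₃ ∧
    (Φ (qgen n₁ n₂ n₃ .B) : Module.End ℂ (Triple n₁ n₂ n₃)) = K₂₃ n₁ n₂ n₃ ∧
    (Φ (qgen n₁ n₂ n₃ .C) : Module.End ℂ (Triple n₁ n₂ n₃)) = K₁₂₃ n₁ n₂ n₃) ∧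
  (∃ φ : Racah →ₐ[ℂ] Cent n₁ n₂ n₃,
    φ (gen .α₁) = algebraMap ℂ _ ((cas n₁ : ℚ) : ℂ) ∧
    φ (gen .α₂) = algebraMap ℂ _ ((cas n₂ : ℚ) : ℂ) ∧
    φ (gen .α₃) = algebraMap ℂ _ ((cas n₃ : ℚ) : ℂ) ∧
    (φ (gen .A) : Module.End ℂ (Triple n₁ n₂ n₃)) = K₁₂ n₁ n₂ n₃ ∧
    (φ (gen .B) : Module.End ℂ (Triple n₁ n₂ n₃)) = K₂₃ n₁ n₂ n₃ ∧
    (φ (gen .C) : Module.End ℂ (Triple n₁ n₂ n₃)) = K₁₂₃ n₁ n₂ n₃ ∧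
    Function.Surjective φ) ∧
  (∀ n ∈ J₃ n₁ n₂ n₃, Module.rank ℂ (Block n₁ n₂ n₃ n) ≤ 4 ∧
    ((n = a + b + 1 ∨ n + b + 1 = a ∨ n + a + 1 = b) → Module.rank ℂ (Block n₁ n₂ n₃ n) ≤ 1))

/-- The map from the universal algebra is the isomorphism composed with the quotient map, which is
why it is surjective. -/
lemma conclusion_of_iso {a b n₁ n₂ n₃ : ℕ} (ha : 0 < a) (hb : 0 < b)
    {X Y : QRacah n₁ n₂ n₃} (halg : HalfAlg a b X Y (qgen n₁ n₂ n₃ .C))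
    (hJ : J₃ n₁ n₂ n₃ = J₃ 1 a b)
    (hiso : ∃ Φ : QRacah n₁ n₂ n₃ →ₐ[ℂ] Module.End ℂ (Triple n₁ n₂ n₃),
      Ops.IsTriple.IsoOntoCent (op₁ n₁ n₂ n₃) (op₂ n₁ n₂ n₃) (op₃ n₁ n₂ n₃) Φ) :
    Conclusion a b n₁ n₂ n₃ := by
  obtain ⟨Φ, hA, hB, hC, hinj, hmem, hsurj⟩ := hiso
  let Ψ : QRacah n₁ n₂ n₃ →ₐ[ℂ] Cent n₁ n₂ n₃ :=
    Φ.codRestrict _ fun r => mem_cent_iff.2 (hmem r)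
  have hΨ : Function.Bijective Ψ := by
    refine ⟨fun r r' h => hinj congr(($h : Module.End ℂ (Triple n₁ n₂ n₃))), ?_⟩
    rintro ⟨M, hM⟩
    obtain ⟨r, hr⟩ := hsurj M (mem_cent_iff.1 hM)
    exact ⟨r, Subtype.ext hr⟩
  have hα : ∀ {g : Gen} {n : ℕ}, qgen n₁ n₂ n₃ g = algebraMap ℂ _ (cc n) →
      (Ψ.comp (RingQuot.mkAlgHom ℂ (QuotRel n₁ n₂ n₃))) (gen g) =
        algebraMap ℂ _ ((cas n : ℚ) : ℂ) := by
    intro g n h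
    show Ψ (qgen n₁ n₂ n₃ g) = _
    rw [h, AlgHom.commutes, cas_cast]
  refine ⟨⟨AlgEquiv.ofBijective Ψ hΨ, ?_, ?_, ?_⟩,
    ⟨Ψ.comp (RingQuot.mkAlgHom ℂ (QuotRel n₁ n₂ n₃)), hα (qgen_α₁ _ _ _), hα (qgen_α₂ _ _ _),
      hα (qgen_α₃ _ _ _), ?_, ?_, ?_, hΨ.2.comp (RingQuot.mkAlgHom_surjective ℂ _)⟩, ?_⟩
  · exact hA.trans K₁₂_eq
  · exact hB.trans K₂₃_eq
  · exact hC.trans K₁₂₃_eq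
  · exact hA.trans K₁₂_eq
  · exact hB.trans K₂₃_eq
  · exact hC.trans K₁₂₃_eq
  · intro n hn
    rw [hJ] at hn
    exact halg.rank_ringQuot ha hb hn BlockRel.C

/-- `a` and `b` enter only through the extremal condition, which is symmetric in them. -/
lemma Conclusion.swap {a b n₁ n₂ n₃ : ℕ} (h : Conclusion a b n₁ n₂ n₃) :
    Conclusion b a n₁ n₂ n₃ :=
  ⟨h.1, h.2.1, fun n hn => ⟨(h.2.2 n hn).1, fun h' => (h.2.2 n hn).2 (by omega)⟩⟩

lemma J₃_half_second (a b : ℕ) : J₃ a 1 b = J₃ 1 a b := by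
  ext l; simp only [mem_J₃_iff]; omega

lemma J₃_half_third (a b : ℕ) : J₃ a b 1 = J₃ 1 a b := by
  ext l; simp only [mem_J₃_iff]; omega

lemma conclusion_first {a b : ℕ} (ha : 0 < a) (hb : 0 < b) : Conclusion a b 1 a b :=
  conclusion_of_iso ha hb ((quotAlg_qgen 1 a b).halfAlg_of_first (adjoin_qgen 1 a b)) rfl
    ((isTriple 1 a b).exists_iso_first ha hb)

lemma conclusion_second {a b : ℕ} (ha : 0 < a) (hb : 0 < b) : Conclusion a b a 1 b :=
  conclusion_of_iso ha hb ((quotAlg_qgen a 1 b).halfAlg_of_second (adjoin_qgen a 1 b))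
    (J₃_half_second a b) ((isTriple a 1 b).exists_iso_second ha hb)

lemma conclusion_third {a b : ℕ} (ha : 0 < a) (hb : 0 < b) : Conclusion a b a b 1 :=
  conclusion_of_iso ha hb ((quotAlg_qgen a b 1).halfAlg_of_third (adjoin_qgen a b 1))
    (J₃_half_third a b) ((isTriple a b 1).exists_iso_third ha hb)

lemma pair_cases {m n a b : ℕ} (h : ({m, n} : Multiset ℕ) = {a, b}) :
    (m = a ∧ n = b) ∨ (m = b ∧ n = a) := by
  have hm : m ∈ ({a, b} : Multiset ℕ) := by rw [← h]; simp
  rcases Multiset.mem_cons.1 hm with rfl | hm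
  · exact .inl ⟨rfl, Multiset.singleton_inj.1 ((Multiset.cons_inj_right m).1 h)⟩
  · obtain rfl := Multiset.mem_singleton.1 hm
    rw [Multiset.pair_comm a m] at h
    exact .inr ⟨rfl, Multiset.singleton_inj.1 ((Multiset.cons_inj_right m).1 h)⟩

lemma conclusion_of_multiset {a b n₁ n₂ n₃ : ℕ} (ha : 0 < a) (hb : 0 < b)
    (hn : ({n₁, n₂, n₃} : Multiset ℕ) = {1, a, b}) : Conclusion a b n₁ n₂ n₃ := by
  have h1 : 1 ∈ ({n₁, n₂, n₃} : Multiset ℕ) := by rw [hn]; exact Multiset.mem_cons_self _ _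
  rcases Multiset.mem_cons.1 h1 with rfl | h1
  · rcases pair_cases ((Multiset.cons_inj_right 1).1 hn) with ⟨rfl, rfl⟩ | ⟨rfl, rfl⟩
    · exact conclusion_first ha hb
    · exact (conclusion_first hb ha).swap
  rcases Multiset.mem_cons.1 h1 with rfl | h1
  · have e := (Multiset.cons_swap 1 n₁ {n₃}).trans hn
    rcases pair_cases ((Multiset.cons_inj_right 1).1 e) with ⟨rfl, rfl⟩ | ⟨rfl, rfl⟩
    · exact conclusion_second ha hb
    · exact (conclusion_second hb ha).swap
  · obtain rfl := Multiset.mem_singleton.1 h1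
    have e : (1 ::ₘ n₁ ::ₘ {n₂} : Multiset ℕ) = {1, a, b} := by
      rw [← hn, Multiset.cons_swap]
      exact congrArg (n₁ ::ₘ ·) (Multiset.pair_comm 1 n₂)
    rcases pair_cases ((Multiset.cons_inj_right 1).1 e) with ⟨rfl, rfl⟩ | ⟨rfl, rfl⟩
    · exact conclusion_third ha hb
    · exact (conclusion_third hb ha).swap

end RacahSU2

end

/-- Doubled spins: `j₁ = n₁/2`, `j₂ = n₂/2`, `j₃ = n₃/2` are the spins `1/2`, `a/2`, `b/2` in any
order. -/
theorem mainTheorem9 (a b : ℕ) (ha : 0 < a) (hb : 0 < b) (n₁ n₂ n₃ : ℕ)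
    (hn : ({n₁, n₂, n₃} : Multiset ℕ) = {1, a, b}) :
    -- the quotiented Racah algebra is isomorphic to the centralizer, by the stated map
    (∃ Φ : RacahSU2.QRacah n₁ n₂ n₃ ≃ₐ[ℂ] RacahSU2.Cent n₁ n₂ n₃,
      (Φ (RacahSU2.qgen n₁ n₂ n₃ .A) : Module.End ℂ (RacahSU2.Triple n₁ n₂ n₃))
        = RacahSU2.K₁₂ n₁ n₂ n₃ ∧
      (Φ (RacahSU2.qgen n₁ n₂ n₃ .B) : Module.End ℂ (RacahSU2.Triple n₁ n₂ n₃))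
        = RacahSU2.K₂₃ n₁ n₂ n₃ ∧
      (Φ (RacahSU2.qgen n₁ n₂ n₃ .C) : Module.End ℂ (RacahSU2.Triple n₁ n₂ n₃))
        = RacahSU2.K₁₂₃ n₁ n₂ n₃) ∧
    -- the map from the universal Racah algebra is well defined and surjective
    (∃ φ : RacahSU2.Racah →ₐ[ℂ] RacahSU2.Cent n₁ n₂ n₃,
      φ (RacahSU2.gen .α₁) = algebraMap ℂ _ ((RacahSU2.cas n₁ : ℚ) : ℂ) ∧
      φ (RacahSU2.gen .α₂) = algebraMap ℂ _ ((RacahSU2.cas n₂ : ℚ) : ℂ) ∧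
      φ (RacahSU2.gen .α₃) = algebraMap ℂ _ ((RacahSU2.cas n₃ : ℚ) : ℂ) ∧
      (φ (RacahSU2.gen .A) : Module.End ℂ (RacahSU2.Triple n₁ n₂ n₃))
        = RacahSU2.K₁₂ n₁ n₂ n₃ ∧
      (φ (RacahSU2.gen .B) : Module.End ℂ (RacahSU2.Triple n₁ n₂ n₃))
        = RacahSU2.K₂₃ n₁ n₂ n₃ ∧
      (φ (RacahSU2.gen .C) : Module.End ℂ (RacahSU2.Triple n₁ n₂ n₃))
        = RacahSU2.K₁₂₃ n₁ n₂ n₃ ∧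
      Function.Surjective φ) ∧
    -- the blocks have dimension at most 4, and at most 1 at the extremal spins
    -- `(a + b + 1)/2` and `(|a - b| - 1)/2`
    (∀ n ∈ RacahSU2.J₃ n₁ n₂ n₃,
      Module.rank ℂ (RacahSU2.Block n₁ n₂ n₃ n) ≤ 4 ∧
      ((n = a + b + 1 ∨ n + b + 1 = a ∨ n + a + 1 = b) →
        Module.rank ℂ (RacahSU2.Block n₁ n₂ n₃ n) ≤ 1)) := by
  exact RacahSU2.conclusion_of_multiset ha hb hn
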